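/- Work on $\mathbb R^3$ and let $\nu,\beta>0$. Write $\mathcal F^{-1}[m](x)=(2\pi)^{-3/2}\int_{\mathbb R^3}e^{ix\cdot\xi}m(\xi)\,d\xi$. Let $0<c_0<2\beta/\nu$ and let $\chi_L\in C^\infty(\mathbb R^3)$ be real-valued with $\chi_L(\xi)=1$ for $|\xi|\le c_0/2$ and $\chi_L(\xi)=0$ for $|\xi|\ge c_0$. Put $\phi(\xi)=\sqrt{1-\nu^2|\xi|^2/(4\beta^2)}$, $\sigma_\pm(\xi)=\tfrac12\bigl(-\nu|\xi|^2\pm\sqrt{\nu^2|\xi|^4-4\beta^2|\xi|^2}\bigr)$ and $$\mathcal K_{00}(t,\xi)=e^{-\frac{\nu|\xi|^2t}{2}}\cos(t\beta|\xi|\phi(\xi)),\qquad \mathcal K_1(t,\xi)=\frac{e^{\sigma_+t}-e^{\sigma_-t}}{\sigma_+-\sigma_-},$$ $$\mathcal G_0(t,\xi)=e^{-\frac{\nu|\xi|^2t}{2}}\cos(\beta|\xi|t),\qquad \mathcal G_1(t,\xi)=e^{-\frac{\nu|\xi|^2t}{2}}\frac{\sin(\beta|\xi|t)}{\beta|\xi|}.$$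 For $a,b\in\{1,2,3\}$ let $$\mathbb K_{00}^{(\beta)}(t)=\mathcal F^{-1}\Bigl[\tfrac{\xi_a\xi_b}{|\xi|^2}\mathcal K_{00}(t,\xi)\chi_L\Bigr],\quad \mathbb K_{1}^{(\beta)}(t)=\mathcal F^{-1}\Bigl[\tfrac{\xi_a\xi_b}{|\xi|^2}\mathcal K_{1}(t,\xi)\chi_L\Bigr],\quad \mathbb G_{j}^{(\beta)}(t)=\mathcal F^{-1}\Bigl[\tfrac{\xi_a\xi_b}{|\xi|^2}\mathcal G_{j}(t,\xi)\chi_L\Bigr]\ (j=0,1).$$ For an even integer $2n\ge 0$ applied to $\mathbb G_j^{(\beta)}$, $|\nabla|^{2n}:=(-\Delta)^n$ (the operator with Fourier symbol $|\xi|^{2n}$); otherwise $\nabla^k$ is the tensor of all weak derivatives of order $k$. Proposition 3.1. Let $\alpha\ge\tilde\alpha\ge0$, $\ell\ge\tilde\ell\ge0$, $m\ge0$ be integers, $1\le q\le p\le\infty$, and set $$\gamma=-\tfrac32\Bigl(\tfrac1q-\tfrac1p\Bigr)-\Bigl(\tfrac1q-\tfrac1p\Bigr)-\tfrac{\ell-\tilde\ell+\alpha-\tilde\alpha}{2}.$$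 There is a constant $C>0$, independent of $t$ and $g$, such that for all $t\ge0$ and all $g$ that belong to $L^r(\mathbb R^3)$ for some $1\le r\le\infty$ and satisfy $\nabla^{\tilde\alpha+\tilde\ell}g\in L^q(\mathbb R^3)$: (i) if $\ell=2m$, $$\bigl\|\nabla^\alpha\bigl(\partial_t^\ell\mathbb K_{00}^{(\beta)}(t)*g-(-1)^{\frac{\ell}{2}}\beta^\ell|\nabla|^\ell\mathbb G_0^{(\beta)}(t)*g\bigr)\bigr\|_p\le C(1+t)^{\gamma}\|\nabla^{\tilde\alpha+\tilde\ell}g\|_q ;$$ (ii) if $\ell=2m+1$, $$\bigl\|\nabla^\alpha\bigl(\partial_t^\ell\mathbb K_{00}^{(\beta)}(t)*g-(-1)^{\frac{\ell+1}{2}}\beta^{\ell+1}|\nabla|^{\ell+1}\mathbb G_1^{(\beta)}(t)*g\bigr)\bigr\|_p\le C(1+t)^{\gamma}\|\nabla^{\tilde\alpha+\tilde\ell}g\|_q ;$$ (iii) if $\ell=2m$, $$\bigl\|\nabla^\alpha\bigl(\partial_t^\ell\mathbb K_{1}^{(\beta)}(t)*g-(-1)^{\frac{\ell}{2}}\beta^\ell|\nabla|^\ell\mathbb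 G_1^{(\beta)}(t)*g\bigr)\bigr\|_p\le C(1+t)^{\gamma+\frac12}\|\nabla^{\tilde\alpha+\tilde\ell}g\|_q ;$$ (iv) if $\ell=2m+1$, $$\bigl\|\nabla^\alpha\bigl(\partial_t^\ell\mathbb K_{1}^{(\beta)}(t)*g-(-1)^{\frac{\ell-1}{2}}\beta^{\ell-1}|\nabla|^{\ell-1}\mathbb G_0^{(\beta)}(t)*g\bigr)\bigr\|_p\le C(1+t)^{\gamma+\frac12}\|\nabla^{\tilde\alpha+\tilde\ell}g\|_q .$$ Here each difference $A(t)*g-B(t)*g$ is the absolutely convergent convolution $(A(t)-B(t))*g$; when $r<\infty$ both convolutions converge absolutely and it is their difference. The weak derivatives of order $\alpha$ on the left exist and belong to $L^p$. -/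

import Mathlib

open MeasureTheory Set
open scoped ENNReal Convolution

noncomputable section

/-- The physical and the frequency space `ℝ³`, with its Euclidean norm. -/
abbrev R3 : Type := EuclideanSpace ℝ (Fin 3)

/-- Inverse Fourier transform on `ℝ³` in the unitary normalization,
`ℱ⁻¹[m](x) = (2π)^{-3/2} ∫ e^{i x·ξ} m(ξ) dξ`. -/
def invFourier (m : R3 → ℂ) (x : R3) : ℂ :=
  (((2 * Real.pi) ^ (-(3 / 2) : ℝ) : ℝ) : ℂ) *
    ∫ ξ : R3, Complex.exp (Complex.I * ((inner ℝ x ξ : ℝ) : ℂ)) * m ξ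

/-- Symbol `ξ_a / |ξ|` of the Riesz transform `ℛ_a` (in the normalization without `-i`). -/
def rieszSymbol (a : Fin 3) (ξ : R3) : ℂ := ((ξ a / ‖ξ‖ : ℝ) : ℂ)

/-- `ℛ_a ℛ_b ℱ⁻¹[m]`. -/
def rieszRieszInvFourier (a b : Fin 3) (m : R3 → ℂ) : R3 → ℂ :=
  invFourier fun ξ => rieszSymbol a ξ * rieszSymbol b ξ * m ξ

/-- `χ` is a smooth low-frequency cut-off at level `c₀`: it is `1` for `|ξ| ≤ c₀ / 2` and
`0` for `|ξ| ≥ c₀`. -/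
structure IsLowCutoff (c₀ : ℝ) (χ : R3 → ℝ) : Prop where
  smooth : ContDiff ℝ (⊤ : ℕ∞) χ
  eq_one : ∀ ξ, ‖ξ‖ ≤ c₀ / 2 → χ ξ = 1
  eq_zero : ∀ ξ, c₀ ≤ ‖ξ‖ → χ ξ = 0

/-- `√(ν²|ξ|⁴ - 4β²|ξ|²)`, a complex square root. -/
def rootDisc (ν β : ℝ) (ξ : R3) : ℂ :=
  ((ν ^ 2 * ‖ξ‖ ^ 4 - 4 * β ^ 2 * ‖ξ‖ ^ 2 : ℝ) : ℂ) ^ (1 / 2 : ℂ)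

/-- Characteristic root `σ₊` of `σ² + ν|ξ|²σ + β²|ξ|² = 0`. -/
def sigmaPlus (ν β : ℝ) (ξ : R3) : ℂ :=
  (-((ν * ‖ξ‖ ^ 2 : ℝ) : ℂ) + rootDisc ν β ξ) / 2

/-- Characteristic root `σ₋` of `σ² + ν|ξ|²σ + β²|ξ|² = 0`. -/
def sigmaMinus (ν β : ℝ) (ξ : R3) : ℂ :=
  (-((ν * ‖ξ‖ ^ 2 : ℝ) : ℂ) - rootDisc ν β ξ) / 2

/-- `𝒦₁(t, ξ) = (e^{σ₊ t} - e^{σ₋ t}) / (σ₊ - σ₋)`. -/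
def symbolK1 (ν β t : ℝ) (ξ : R3) : ℂ :=
  (Complex.exp (sigmaPlus ν β ξ * t) - Complex.exp (sigmaMinus ν β ξ * t)) /
    (sigmaPlus ν β ξ - sigmaMinus ν β ξ)

/-- `φ(ξ) = √(1 - ν²|ξ|² / (4β²))`; it is used only for `|ξ| < 2β / ν`. -/
def phi (ν β : ℝ) (ξ : R3) : ℝ := Real.sqrt (1 - ν ^ 2 * ‖ξ‖ ^ 2 / (4 * β ^ 2))

/-- `𝒦₀₀(t, ξ) = e^{-ν|ξ|²t/2} cos(tβ|ξ|φ(ξ))`. -/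
def symbolK00 (ν β t : ℝ) (ξ : R3) : ℂ :=
  ((Real.exp (-(ν * ‖ξ‖ ^ 2 / 2) * t) * Real.cos (t * β * ‖ξ‖ * phi ν β ξ) : ℝ) : ℂ)

/-- `𝒢₀(t, ξ) = e^{-ν|ξ|²t/2} cos(β|ξ|t)`. -/
def symbolG0 (ν β t : ℝ) (ξ : R3) : ℂ :=
  ((Real.exp (-(ν * ‖ξ‖ ^ 2 / 2) * t) * Real.cos (β * ‖ξ‖ * t) : ℝ) : ℂ)

/-- `𝒢₁(t, ξ) = e^{-ν|ξ|²t/2} sin(β|ξ|t) / (β|ξ|)`. -/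
def symbolG1 (ν β t : ℝ) (ξ : R3) : ℂ :=
  ((Real.exp (-(ν * ‖ξ‖ ^ 2 / 2) * t) * (Real.sin (β * ‖ξ‖ * t) / (β * ‖ξ‖)) : ℝ) : ℂ)

/-- `ℛ_a ℛ_b ℱ⁻¹[s(t, ·) χ](x)`, for a time-dependent symbol `s`. -/
def lowKernel (s : ℝ → R3 → ℂ) (χ : R3 → ℝ) (a b : Fin 3) (t : ℝ) : R3 → ℂ :=
  rieszRieszInvFourier a b fun ξ => s t ξ * (χ ξ : ℂ)

/-- The kernel `𝕂₀₀`. -/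
def kernelK00 (ν β : ℝ) (χ : R3 → ℝ) (a b : Fin 3) : ℝ → R3 → ℂ :=
  lowKernel (symbolK00 ν β) χ a b

/-- The kernel `𝕂₁`. -/
def kernelK1 (ν β : ℝ) (χ : R3 → ℝ) (a b : Fin 3) : ℝ → R3 → ℂ :=
  lowKernel (symbolK1 ν β) χ a b

/-- The diffusion wave `𝔾₀`. -/
def kernelG0 (ν β : ℝ) (χ : R3 → ℝ) (a b : Fin 3) : ℝ → R3 → ℂ :=
  lowKernel (symbolG0 ν β) χ a b

/-- The diffusion wave `𝔾₁`. -/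
def kernelG1 (ν β : ℝ) (χ : R3 → ℝ) (a b : Fin 3) : ℝ → R3 → ℂ :=
  lowKernel (symbolG1 ν β) χ a b

/-- The kernel `∂_t^ℓ K(t, x)`. -/
def timeDeriv (l : ℕ) (K : ℝ → R3 → ℂ) (t : ℝ) (x : R3) : ℂ :=
  iteratedDeriv l (fun s => K s x) t

/-- `(-Δ)^n f`, the operator with Fourier symbol `|ξ|^{2n}`. -/
def negLaplacianPow (n : ℕ) (f : R3 → ℂ) : R3 → ℂ :=
  (fun h : R3 → ℂ => -(Laplacian.laplacian h))^[n] f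

/-- `(-1)^n β^{2n} (-Δ)^n G(t, x)`. -/
def spaceDeriv (β : ℝ) (n : ℕ) (G : ℝ → R3 → ℂ) (t : ℝ) (x : R3) : ℂ :=
  (-1) ^ n * (β : ℂ) ^ (2 * n) * negLaplacianPow n (G t) x

/-- Convolution of complex-valued functions on `ℝ³`. -/
def conv (f g : R3 → ℂ) : R3 → ℂ :=
  f ⋆[ContinuousLinearMap.mul ℂ ℂ, volume] g

/-- The integral defining `(f ∗ g)(x)` converges absolutely for every `x`. -/
def ConvExists (f g : R3 → ℂ) : Prop :=
  ConvolutionExists f g (ContinuousLinearMap.mul ℂ ℂ) volume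

/-- The classical partial derivative `∂_{I 0} ⋯ ∂_{I (k-1)} φ`. -/
def partialDeriv {k : ℕ} (I : Fin k → Fin 3) (φ : R3 → ℂ) (x : R3) : ℂ :=
  iteratedFDeriv ℝ k φ x fun i => EuclideanSpace.single (I i) (1 : ℝ)

/-- `G = ∇^k g` in the sense of distributions: `g` and `G` are locally integrable, and the
component `G_I`, for `I ∈ {1,2,3}^k`, is the weak derivative `∂_I g`. The values of `G` carry
the Euclidean norm `(∑_I |G_I|²)^{1/2}`. -/
structure HasWeakGrad (k : ℕ) (g : R3 → ℂ)
    (G : R3 → EuclideanSpace ℂ (Fin k → Fin 3)) : Prop where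
  locallyIntegrable : LocallyIntegrable g volume
  locallyIntegrable_grad : LocallyIntegrable G volume
  integral_eq : ∀ (I : Fin k → Fin 3) (φ : R3 → ℂ), ContDiff ℝ (⊤ : ℕ∞) φ → HasCompactSupport φ →
    ∫ x, g x * partialDeriv I φ x = (-1) ^ k * ∫ x, G x I * φ x

/-- Approximation of the convolution operators with kernels `A(t)` by those with kernels `B(t)`,
`‖∇^α (A(t) ∗ g - B(t) ∗ g)‖_p ≤ C (1 + t)^γ ‖∇^k g‖_q`
for all `t ≥ 0` and all `g` that lie in some `L^r`, `1 ≤ r ≤ ∞`, with `∇^k g ∈ L^q`.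
The difference is the convolution of `g` with `A(t) - B(t)`, which converges absolutely
everywhere; when `r < ∞`, both individual convolutions converge absolutely everywhere
and their difference is taken literally. -/
def ApproxBound (α k : ℕ) (p q : ℝ≥0∞) (γ : ℝ) (A B : ℝ → R3 → ℂ) : Prop :=
  ∃ C : ℝ, 0 < C ∧ ∀ t : ℝ, 0 ≤ t → ∀ (r : ℝ≥0∞), 1 ≤ r →
    ∀ (g : R3 → ℂ) (G : R3 → EuclideanSpace ℂ (Fin k → Fin 3)),
      MemLp g r volume → HasWeakGrad k g G → MemLp G q volume →
      ConvExists (A t - B t) g ∧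
      (r ≠ ∞ → ConvExists (A t) g ∧ ConvExists (B t) g ∧
        conv (A t - B t) g = conv (A t) g - conv (B t) g) ∧
      ∃ H : R3 → EuclideanSpace ℂ (Fin α → Fin 3),
        HasWeakGrad α (conv (A t - B t) g) H ∧ MemLp H p volume ∧
        eLpNorm H p volume ≤ ENNReal.ofReal (C * (1 + t) ^ γ) * eLpNorm G q volume

/-- The decay exponent `-(3/2)(1/q - 1/p) - (1/q - 1/p) - (ℓ - ℓ' + α - α') / 2`. -/
def decayExponent (α α' l l' : ℕ) (p q : ℝ≥0∞) : ℝ :=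
  -(3 / 2) * ((q⁻¹).toReal - (p⁻¹).toReal) - ((q⁻¹).toReal - (p⁻¹).toReal)
    - ((l : ℝ) - l' + α - α') / 2

end

/-! Below the threshold 2β/ν every symbol involved is a Gaussian e^{-ν|ξ|²t/2} times an even
function of a frequency vector v, and such functions are spherical means of plane waves: sinc|v| is
the mean of e^{iω·v}, and cos|v| is the mean of (1 + iω·v)e^{iω·v}. Both follow from Archimedes'
theorem (`integral_sphereMeasure_inner`). Take v = βtφ(ξ)ξ and write φ = 1 + |ξ|²h with h smooth.
The plane wave then splits as e^{iβtω·ξ}e^{iy}, where y = βt|ξ|²h(ξ) ω·ξ. In the parabolic variable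
η = √(1+t) ξ the phase y has temperate growth uniformly in t, while e^{iβtω·ξ} merely translates the
kernel by βtω. This is the notion `IsWaveSymbol`: an amplitude of size (1+t)^e, parabolically scaled
and carried along the sphere of radius βt.

Multiplying by a homogeneous polynomial of degree d and by a cut-off, the kernel is at most
(1+t)^{e-d/2-3/2} times the spherical mean of (1+|x|/√(1+t))^{-4}. That mean has mass of order
(1+t)^{3/2} and supremum O((1+t)^{-1}), the latter because the thickness √(1+t) is small against the
radius βt. Hence `hasKernelBound_invFourier`: exponent e-d/2 in L¹ and e-d/2-5/2 in L^∞. Young's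
inequality interpolates, and the loss 5/2 = 3/2 + 1 per unit of 1/q-1/p is the heat rate plus the
dispersive rate.

The Riesz symbol ξ_aξ_b/|ξ|² is not a polynomial, and alone it would give a kernel that only decays
like |x|^{-3}. The differences supply the missing |ξ|²: from e^{iy}-1 = iy∫₀¹e^{izy}dz, the
quotients (𝒦₁-𝒢₁)/|ξ|² and (𝒦₀₀-𝒢₀)/|ξ|² are again wave symbols, of orders 3/2 and 1
(`isWaveSymbol_waveSinDiff`, `isWaveSymbol_waveCosDiff`). Time derivatives stay within combinations
of 𝒦₀₀ and 𝒦₁ with coefficients polynomial in |ξ|². The leading coefficient is a power of -β²|ξ|²,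
matched by the diffusion wave, and every other term has a spare |ξ|² that cancels the Riesz
denominator (`timeStep_iterate_cos`, `timeStep_iterate_sin`).

To let derivatives fall on g, a homogeneous polynomial is factored through all monomials of order k
(`IsHomPoly.exists_eq_sum_derivSymbol_mul`), and integration by parts against test functions gives
the weak derivatives (`integral_conv_mul_partialDeriv`). The separate convolutions for r < ∞
converge because the diffusion wave kernels are O((1+|x|)^{-3}), hence in every L^s with s > 1
(`exists_norm_invFourier_riesz_le`). -/

noncomputable section

/-! ### Bounded symbols and calculus of the inverse Fourier transform -/

/-- Bounded measurable symbols that vanish outside a ball. -/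
structure IsBddSymbol (m : R3 → ℂ) : Prop where
  aesm : AEStronglyMeasurable m volume
  bdd : ∃ C : ℝ, ∀ ξ, ‖m ξ‖ ≤ C
  supp : ∃ R : ℝ, ∀ ξ, R ≤ ‖ξ‖ → m ξ = 0

namespace IsBddSymbol

lemma integrable {m : R3 → ℂ} (hm : IsBddSymbol m) : Integrable m := by
  obtain ⟨C, hC⟩ := hm.bdd
  obtain ⟨R, hR⟩ := hm.supp
  have h1 : IntegrableOn m (Metric.closedBall 0 R) :=
    Measure.integrableOn_of_bounded (M := C) (isCompact_closedBall _ _).measure_lt_top.ne hm.aesm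
      (Filter.Eventually.of_forall hC)
  refine (integrableOn_iff_integrable_of_support_subset fun ξ hξ => ?_).1 h1
  by_contra h
  simp only [Metric.mem_closedBall, dist_zero_right, not_le] at h
  exact hξ (hR ξ h.le)

lemma continuous_mul {m f : R3 → ℂ} (hm : IsBddSymbol m) (hf : Continuous f) :
    IsBddSymbol fun ξ => f ξ * m ξ := by
  obtain ⟨C, hC⟩ := hm.bdd
  obtain ⟨R, hR⟩ := hm.supp
  refine ⟨hf.aestronglyMeasurable.mul hm.aesm, ?_, R, fun ξ h => by simp [hR ξ h]⟩
  obtain ⟨D, hD⟩ := (isCompact_closedBall (0 : R3) R).exists_bound_of_continuousOn hf.continuousOn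
  refine ⟨|D| * |C|, fun ξ => ?_⟩
  by_cases h : R ≤ ‖ξ‖
  · simp only [hR ξ h, mul_zero, norm_zero]; positivity
  · rw [norm_mul]
    gcongr
    · exact (hD ξ (by simpa using (not_le.1 h).le)).trans (le_abs_self _)
    · exact (hC ξ).trans (le_abs_self _)

lemma add {m n : R3 → ℂ} (hm : IsBddSymbol m) (hn : IsBddSymbol n) :
    IsBddSymbol fun ξ => m ξ + n ξ := by
  obtain ⟨C, hC⟩ := hm.bdd
  obtain ⟨R, hR⟩ := hm.supp
  obtain ⟨C', hC'⟩ := hn.bdd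
  obtain ⟨R', hR'⟩ := hn.supp
  exact ⟨hm.aesm.add hn.aesm, ⟨C + C', fun ξ => (norm_add_le _ _).trans (add_le_add (hC ξ) (hC' ξ))⟩,
    max R R', fun ξ h => by
      simp [hR ξ ((le_max_left _ _).trans h), hR' ξ ((le_max_right _ _).trans h)]⟩

lemma const_mul {m : R3 → ℂ} (hm : IsBddSymbol m) (c : ℂ) : IsBddSymbol fun ξ => c * m ξ :=
  hm.continuous_mul continuous_const

lemma zero : IsBddSymbol fun _ => 0 :=
  ⟨aestronglyMeasurable_const, ⟨0, by simp⟩, 0, by simp⟩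

lemma sum {ι : Type*} (s : Finset ι) {m : ι → R3 → ℂ} (hm : ∀ i ∈ s, IsBddSymbol (m i)) :
    IsBddSymbol fun ξ => ∑ i ∈ s, m i ξ := by
  classical
  induction s using Finset.induction_on with
  | empty => simpa using zero
  | insert a s ha ih =>
    simp only [Finset.sum_insert ha]
    exact (hm a (by simp)).add (ih fun i hi => hm i (by simp [hi]))

lemma pow_mul_integrable {m : R3 → ℂ} (hm : IsBddSymbol m) (n : ℕ) :
    Integrable fun ξ => ‖ξ‖ ^ n * ‖m ξ‖ := by
  have := (hm.continuous_mul (f := fun ξ => ((‖ξ‖ ^ n : ℝ) : ℂ)) (by fun_prop)).integrable.norm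
  simpa using this

end IsBddSymbol

/-- The pairing for which `VectorFourier.fourierIntegral` is the unnormalized `invFourier`. -/
def invFourierPairing : R3 →L[ℝ] R3 →L[ℝ] ℝ := (-(2 * Real.pi)⁻¹ : ℝ) • innerSL ℝ

lemma invFourierPairing_apply (v w : R3) :
    invFourierPairing v w = -(2 * Real.pi)⁻¹ * inner ℝ v w := rfl

/-- The normalizing constant `(2π)^{-3/2}`. -/
def fourierConst : ℝ := (2 * Real.pi) ^ (-(3 / 2) : ℝ)

lemma fourierConst_nonneg : 0 ≤ fourierConst := by unfold fourierConst; positivity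

lemma fourierConst_le_one : fourierConst ≤ 1 := by
  unfold fourierConst
  refine Real.rpow_le_one_of_one_le_of_nonpos ?_ (by norm_num)
  nlinarith [Real.pi_gt_three]

lemma invFourier_apply (m : R3 → ℂ) (x : R3) : invFourier m x = (fourierConst : ℂ) *
    ∫ ξ : R3, Complex.exp (Complex.I * ((inner ℝ x ξ : ℝ) : ℂ)) * m ξ := rfl

lemma norm_exp_I_mul_ofReal_eq_one (a : ℝ) : ‖Complex.exp (Complex.I * (a : ℂ))‖ = 1 := by
  rw [mul_comm]; exact Complex.norm_exp_ofReal_mul_I a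

lemma invFourier_eq_vectorFourier (m : R3 → ℂ) :
    invFourier m = fun x => (fourierConst : ℂ) *
      VectorFourier.fourierIntegral Real.fourierChar volume invFourierPairing.toLinearMap₁₂ m x := by
  funext x
  rw [invFourier_apply, VectorFourier.fourierIntegral]
  congr 1
  refine integral_congr_ae (Filter.Eventually.of_forall fun ξ => ?_)
  simp only [Circle.smul_def, smul_eq_mul, Real.fourierChar_apply]
  congr 2
  rw [show (invFourierPairing.toLinearMap₁₂ ξ) x = invFourierPairing ξ x from rfl,
    invFourierPairing_apply, real_inner_comm]
  push_cast
  have : (Real.pi : ℂ) ≠ 0 := by exact_mod_cast Real.pi_ne_zero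
  field_simp

lemma contDiff_invFourier {m : R3 → ℂ} (hm : IsBddSymbol m) :
    ContDiff ℝ (⊤ : ℕ∞) (invFourier m) := by
  rw [invFourier_eq_vectorFourier]
  exact contDiff_const.mul (VectorFourier.contDiff_fourierIntegral _
    fun n _ => hm.pow_mul_integrable n)

lemma continuous_invFourier {m : R3 → ℂ} (hm : IsBddSymbol m) : Continuous (invFourier m) :=
  (contDiff_invFourier hm).continuous

/-- Differentiation under the integral; all moments are finite since the symbol is bounded with
bounded support. Each derivative brings a factor -2πi times the pairing, and the scale -(2π)^{-1} in
`invFourierPairing` turns it into i times an inner product. -/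
lemma iteratedFDeriv_invFourier_apply {m : R3 → ℂ} (hm : IsBddSymbol m) (n : ℕ) (x : R3)
    (v : Fin n → R3) : iteratedFDeriv ℝ n (invFourier m) x v =
      invFourier (fun ξ => (∏ i, Complex.I * ((inner ℝ (v i) ξ : ℝ) : ℂ)) * m ξ) x := by
  have hc := VectorFourier.contDiff_fourierIntegral (μ := volume) (N := ⊤) invFourierPairing
    (f := m) fun n _ => hm.pow_mul_integrable n
  have e1 : invFourier m = (fourierConst : ℂ) •
      VectorFourier.fourierIntegral Real.fourierChar volume invFourierPairing.toLinearMap₁₂ m := by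
    rw [invFourier_eq_vectorFourier]; rfl
  have hi : Integrable (fun ξ => VectorFourier.fourierPowSMulRight invFourierPairing m ξ n) :=
    VectorFourier.integrable_fourierPowSMulRight _ (hm.pow_mul_integrable n) hm.aesm
  rw [e1, iteratedFDeriv_const_smul_apply (hc.contDiffAt.of_le (by exact_mod_cast le_top)),
    VectorFourier.iteratedFDeriv_fourierIntegral (N := ⊤) invFourierPairing
      (fun n _ => hm.pow_mul_integrable n) hm.aesm (n := n) (by exact_mod_cast le_top),
    _root_.smul_apply, smul_eq_mul, invFourier_eq_vectorFourier]
  simp only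
  congr 1
  rw [Real.fourierIntegral_continuousMultilinearMap_apply' hi]
  congr 1
  funext ξ
  rw [VectorFourier.fourierPowSMulRight_apply]
  simp only [invFourierPairing_apply, Complex.real_smul]
  push_cast
  rw [smul_eq_mul, ← mul_assoc]
  congr 1
  have h2 : (-(2 * (Real.pi : ℂ) * Complex.I)) ^ n = ∏ _i : Fin n, (-(2 * (Real.pi : ℂ) * Complex.I)) := by
    simp
  rw [h2, ← Finset.prod_mul_distrib]
  refine Finset.prod_congr rfl fun i _ => ?_
  rw [real_inner_comm]
  have : (Real.pi : ℂ) ≠ 0 := by exact_mod_cast Real.pi_ne_zero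
  field_simp

/-- The Fourier symbol `(iξ)^J` of `∂_J`. -/
def derivSymbol {k : ℕ} (J : Fin k → Fin 3) (ξ : R3) : ℂ := ∏ i, Complex.I * (ξ (J i) : ℂ)

lemma continuous_derivSymbol {k : ℕ} (J : Fin k → Fin 3) : Continuous (derivSymbol J) := by
  unfold derivSymbol; fun_prop

lemma partialDeriv_invFourier {m : R3 → ℂ} (hm : IsBddSymbol m) {k : ℕ} (J : Fin k → Fin 3) :
    partialDeriv J (invFourier m) = invFourier fun ξ => derivSymbol J ξ * m ξ := by
  funext x
  rw [partialDeriv, iteratedFDeriv_invFourier_apply hm]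
  simp [derivSymbol, EuclideanSpace.inner_single_left]

lemma invFourier_add {m n : R3 → ℂ} (hm : IsBddSymbol m) (hn : IsBddSymbol n) :
    invFourier (fun ξ => m ξ + n ξ) = fun x => invFourier m x + invFourier n x := by
  funext x
  simp only [invFourier_apply, mul_add]
  have key : ∀ {m : R3 → ℂ}, IsBddSymbol m → Integrable fun ξ : R3 =>
    Complex.exp (Complex.I * ((inner ℝ x ξ : ℝ) : ℂ)) * m ξ := fun hm =>
    (hm.continuous_mul (by fun_prop)).integrable
  rw [integral_add (key hm) (key hn), mul_add]

lemma invFourier_const_mul (c : ℂ) (m : R3 → ℂ) :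
    invFourier (fun ξ => c * m ξ) = fun x => c * invFourier m x := by
  funext x
  simp only [invFourier_apply]
  rw [mul_left_comm, ← integral_const_mul c]
  congr 1
  refine integral_congr_ae (Filter.Eventually.of_forall fun ξ => ?_)
  ring

lemma invFourier_zero : invFourier (fun _ => 0) = 0 := by
  funext x; simp [invFourier_apply]

lemma invFourier_sum {ι : Type*} (s : Finset ι) {m : ι → R3 → ℂ}
    (hm : ∀ i ∈ s, IsBddSymbol (m i)) :
    invFourier (fun ξ => ∑ i ∈ s, m i ξ) = fun x => ∑ i ∈ s, invFourier (m i) x := by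
  classical
  induction s using Finset.induction_on with
  | empty => simp only [Finset.sum_empty]; exact invFourier_zero
  | insert a s ha ih =>
    simp only [Finset.sum_insert ha]
    rw [invFourier_add (hm a (by simp)) (IsBddSymbol.sum s fun i hi => hm i (by simp [hi])),
      ih fun i hi => hm i (by simp [hi])]

lemma invFourier_sub {m n : R3 → ℂ} (hm : IsBddSymbol m) (hn : IsBddSymbol n) :
    invFourier (fun ξ => m ξ - n ξ) = fun x => invFourier m x - invFourier n x := by
  have := invFourier_add hm (hn.const_mul (-1))
  rw [invFourier_const_mul] at this
  simpa [sub_eq_add_neg] using this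

lemma invFourier_congr_ae {m n : R3 → ℂ} (h : m =ᵐ[volume] n) : invFourier m = invFourier n := by
  funext x
  simp only [invFourier_apply]
  congr 1
  exact integral_congr_ae (h.mono fun ξ hξ => by simp only [hξ])

lemma norm_invFourier_le (m : R3 → ℂ) (x : R3) : ‖invFourier m x‖ ≤ ∫ ξ, ‖m ξ‖ := by
  rw [invFourier_apply, norm_mul, Complex.norm_real, Real.norm_of_nonneg fourierConst_nonneg]
  calc _ ≤ 1 * ∫ ξ : R3, ‖Complex.exp (Complex.I * ((inner ℝ x ξ : ℝ) : ℂ)) * m ξ‖ := by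
        gcongr
        · exact fourierConst_le_one
        · exact norm_integral_le_integral_norm _
    _ = _ := by simp only [norm_mul, norm_exp_I_mul_ofReal_eq_one, one_mul]

/-- Substitution ξ = aη; applied below with a = (1+t)^{-1/2}, the parabolic frequency scale. -/
lemma invFourier_scale {a : ℝ} (ha : 0 < a) (m : R3 → ℂ) (x : R3) :
    invFourier m x = ((a ^ 3 : ℝ) : ℂ) * invFourier (fun η => m (a • η)) (a • x) := by
  simp only [invFourier_apply]
  have := Measure.integral_comp_smul (volume : Measure R3)
    (fun ξ => Complex.exp (Complex.I * ((inner ℝ x ξ : ℝ) : ℂ)) * m ξ) a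
  simp only [inner_smul_right] at this
  simp only [inner_smul_left, RCLike.conj_to_real]
  rw [this]
  rw [finrank_euclideanSpace_fin, abs_of_pos (by positivity), Complex.real_smul]
  have : (a : ℂ) ≠ 0 := by exact_mod_cast ha.ne'
  push_cast
  field_simp

/-- The translate of an inverse Fourier transform. -/
lemma invFourier_translate (m : R3 → ℂ) (y x : R3) :
    invFourier (fun ξ => Complex.exp (Complex.I * ((inner ℝ y ξ : ℝ) : ℂ)) * m ξ) x =
      invFourier m (x + y) := by
  simp only [invFourier_apply, ← mul_assoc, ← Complex.exp_add, inner_add_left]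
  push_cast
  simp only [mul_add]

lemma laplacian_invFourier {m : R3 → ℂ} (hm : IsBddSymbol m) :
    (fun h : R3 → ℂ => -(Laplacian.laplacian h)) (invFourier m) =
      invFourier fun ξ => ((‖ξ‖ ^ 2 : ℝ) : ℂ) * m ξ := by
  funext x
  change -(Laplacian.laplacian (invFourier m) x) = _
  rw [InnerProductSpace.laplacian_eq_iteratedFDeriv_orthonormalBasis (invFourier m)
    (EuclideanSpace.basisFun (Fin 3) ℝ)]
  simp only [iteratedFDeriv_invFourier_apply hm]
  have h : ∀ i : Fin 3, IsBddSymbol fun ξ : R3 => (∏ j : Fin 2, Complex.I * ((inner ℝ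
      (![EuclideanSpace.basisFun (Fin 3) ℝ i, EuclideanSpace.basisFun (Fin 3) ℝ i] j) ξ : ℝ) : ℂ)) *
      m ξ := fun i => hm.continuous_mul (by fun_prop)
  have e := congrFun (invFourier_sum Finset.univ (fun i _ => h i)) x
  beta_reduce at e
  rw [← e]
  have e2 := congrFun (invFourier_const_mul (-1) (fun ξ : R3 => ∑ i : Fin 3,
    (∏ j : Fin 2, Complex.I * ((inner ℝ
      (![EuclideanSpace.basisFun (Fin 3) ℝ i, EuclideanSpace.basisFun (Fin 3) ℝ i] j) ξ : ℝ) : ℂ)) *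
      m ξ)) x
  rw [neg_one_mul] at e2
  rw [← e2]
  congr 1
  funext ξ
  rw [← Finset.sum_mul, ← mul_assoc]
  congr 1
  simp only [Fin.prod_univ_two, Matrix.cons_val_zero, Matrix.cons_val_one,
    EuclideanSpace.basisFun_apply, EuclideanSpace.inner_single_left]
  rw [EuclideanSpace.real_norm_sq_eq]
  push_cast
  rw [Finset.mul_sum]
  refine Finset.sum_congr rfl fun i _ => ?_
  simp
  linear_combination (-(ξ i : ℂ) ^ 2) * Complex.I_sq

lemma negLaplacianPow_invFourier (n : ℕ) : ∀ {m : R3 → ℂ}, IsBddSymbol m →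
    negLaplacianPow n (invFourier m) = invFourier fun ξ => ((‖ξ‖ ^ (2 * n) : ℝ) : ℂ) * m ξ := by
  induction n with
  | zero => intro m _; simp [negLaplacianPow]
  | succ n ih =>
    intro m hm
    have h2 := hm.continuous_mul (f := fun ξ : R3 => ((‖ξ‖ ^ 2 : ℝ) : ℂ)) (by fun_prop)
    have e := ih h2
    unfold negLaplacianPow at e ⊢
    have e3 := laplacian_invFourier hm
    beta_reduce at e3
    rw [Function.iterate_succ_apply, e3, e]
    congr 1
    funext ξ
    push_cast
    ring

/-! ### Spatial decay from derivatives of the symbol -/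

lemma integrable_one_add_norm_pow_four_inv :
    Integrable fun x : R3 => ((1 + ‖x‖) ^ 4)⁻¹ := by
  have := integrable_one_add_norm (E := R3) (μ := volume) (r := 4)
    (by rw [finrank_euclideanSpace_fin]; norm_num)
  refine this.congr (Filter.Eventually.of_forall fun x => ?_)
  simp only
  rw [Real.rpow_neg (by positivity)]
  norm_cast

/-- A smooth symbol whose derivatives up to order `4` are `O((1 + |η|)^{-4})` has an inverse
Fourier transform that is `O((1 + |x|)^{-4})`. -/
lemma norm_invFourier_le_of_decay : ∃ B : ℝ, 0 < B ∧ ∀ (C : ℝ) (V : R3 → ℂ),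
    ContDiff ℝ (⊤ : ℕ∞) V →
    (∀ n ≤ 4, ∀ η, ‖iteratedFDeriv ℝ n V η‖ ≤ C * ((1 + ‖η‖) ^ 4)⁻¹) →
    ∀ x, ‖invFourier V x‖ ≤ B * C * ((1 + ‖x‖) ^ 4)⁻¹ := by
  set J : ℝ := ∫ x : R3, ((1 + ‖x‖) ^ 4)⁻¹ with hJ
  have hJ0 : 0 ≤ J := integral_nonneg fun x => by positivity
  -- The 8 comes from (1+r)⁴ ≤ 8(1+r⁴). The factor (2π)⁴ undoes the rescaling x ↦ x/(2π), and 80 =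
  -- 2⁴ · 5 collects the constant of the derivative bound for Fourier integrals and its five terms,
  -- each at most CJ. Replacing J by J + 1 makes positivity immediate.
  refine ⟨8 * (1 + (2 * Real.pi) ^ 4 * 80) * (J + 1), by positivity, fun C V hV hb x => ?_⟩
  have hint : ∀ n ≤ 4, Integrable (fun η => ‖iteratedFDeriv ℝ n V η‖) ∧
      ∫ η, ‖iteratedFDeriv ℝ n V η‖ ≤ C * J := by
    intro n hn
    have h1 : Integrable (fun η => ‖iteratedFDeriv ℝ n V η‖) :=
      (integrable_one_add_norm_pow_four_inv.const_mul C).mono'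
        (hV.continuous_iteratedFDeriv (by exact_mod_cast le_top)).norm.aestronglyMeasurable
        (Filter.Eventually.of_forall fun η => by simpa using hb n hn η)
    refine ⟨h1, ?_⟩
    rw [hJ, ← integral_const_mul]
    exact integral_mono h1 (integrable_one_add_norm_pow_four_inv.const_mul C) (hb n hn)
  have h0 : ‖invFourier V x‖ ≤ C * J := by
    refine (norm_invFourier_le V x).trans ?_
    simpa using (hint 0 (by norm_num)).2
  have hCJ : 0 ≤ C * J := (norm_nonneg _).trans h0
  have hC : 0 ≤ C := by
    have := (norm_nonneg _).trans (hb 0 (by norm_num) 0)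
    simpa using this
  have hF : invFourier V x = (fourierConst : ℂ) *
      FourierTransform.fourier V (-((2 * Real.pi)⁻¹ • x)) := by
    rw [invFourier_apply, Real.fourier_eq']
    congr 1
    refine integral_congr_ae (Filter.Eventually.of_forall fun ξ => ?_)
    simp only [smul_eq_mul, inner_neg_right, inner_smul_right, real_inner_comm]
    congr 2
    have : (Real.pi : ℂ) ≠ 0 := by exact_mod_cast Real.pi_ne_zero
    push_cast
    field_simp
  have h4 := Real.pow_mul_norm_iteratedFDeriv_fourier_le (f := V) (K := 0) (N := 4) (k := 0) (n := 4)
    (hV.of_le (by exact_mod_cast le_top)) (fun k n hk hn => by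
      have hk' : k = 0 := by simpa using hk
      subst hk'
      simpa using (hint n (by exact_mod_cast hn)).1) le_rfl (by norm_num)
      (-((2 * Real.pi)⁻¹ • x))
  have hs : ∑ p ∈ Finset.range (0 + 1) ×ˢ Finset.range (4 + 1),
      ∫ v, ‖v‖ ^ p.1 * ‖iteratedFDeriv ℝ p.2 V v‖ ≤ 5 * (C * J) := by
    calc _ ≤ ∑ p ∈ Finset.range (0 + 1) ×ˢ Finset.range (4 + 1), C * J := by
          refine Finset.sum_le_sum fun p hp => ?_
          simp only [Finset.mem_product, Finset.mem_range] at hp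
          have : p.1 = 0 := by omega
          simp only [this, pow_zero, one_mul]
          exact (hint p.2 (by omega)).2
      _ = _ := by simp
  simp only [norm_iteratedFDeriv_zero, norm_neg, norm_smul, norm_inv] at h4
  have h5 : ‖x‖ ^ 4 * ‖invFourier V x‖ ≤ (2 * Real.pi) ^ 4 * 80 * (C * J) := by
    have hn : ‖invFourier V x‖ ≤ ‖FourierTransform.fourier V (-((2 * Real.pi)⁻¹ • x))‖ := by
      rw [hF, norm_mul, Complex.norm_real, Real.norm_of_nonneg fourierConst_nonneg]
      exact mul_le_of_le_one_left (norm_nonneg _) fourierConst_le_one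
    have hp : ‖(2 * Real.pi)‖ = 2 * Real.pi := Real.norm_of_nonneg (by positivity)
    rw [hp] at h4
    calc ‖x‖ ^ 4 * ‖invFourier V x‖
        ≤ ‖x‖ ^ 4 * ‖FourierTransform.fourier V (-((2 * Real.pi)⁻¹ • x))‖ := by gcongr
      _ = (2 * Real.pi) ^ 4 * ((((2 * Real.pi)⁻¹ * ‖x‖) ^ 4) *
          ‖FourierTransform.fourier V (-((2 * Real.pi)⁻¹ • x))‖) := by
        field_simp
      _ ≤ (2 * Real.pi) ^ 4 * (16 * (5 * (C * J))) := by
        refine mul_le_mul_of_nonneg_left (h4.trans ?_) (by positivity)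
        norm_num at hs ⊢
        linarith
      _ = _ := by ring
  rw [← div_eq_mul_inv, le_div_iff₀ (by positivity)]
  have h6 : (1 + ‖x‖) ^ 4 ≤ 8 * (1 + ‖x‖ ^ 4) := by
    nlinarith [sq_nonneg (‖x‖ - 1), sq_nonneg (‖x‖ ^ 2 - 1), norm_nonneg x,
      mul_nonneg (norm_nonneg x) (sq_nonneg (‖x‖ - 1)), sq_nonneg (‖x‖ ^ 2 - ‖x‖)]
  calc ‖invFourier V x‖ * (1 + ‖x‖) ^ 4 ≤ ‖invFourier V x‖ * (8 * (1 + ‖x‖ ^ 4)) := by gcongr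
    _ = 8 * (‖invFourier V x‖ + ‖x‖ ^ 4 * ‖invFourier V x‖) := by ring
    _ ≤ 8 * (C * J + (2 * Real.pi) ^ 4 * 80 * (C * J)) := by gcongr
    _ = 8 * (1 + (2 * Real.pi) ^ 4 * 80) * J * C := by ring
    _ ≤ 8 * (1 + (2 * Real.pi) ^ 4 * 80) * (J + 1) * C := by gcongr; linarith

/-! ### Spherical means on the unit sphere -/

/-- Cartesian coordinates of `ℝ³`, grouped as `ℝ × ℝ²`. -/
def coordEquiv : R3 ≃ᵐ ℝ × ℝ × ℝ :=
  ((MeasurableEquiv.toLp 2 (Fin 3 → ℝ)).symm.trans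
    (MeasurableEquiv.piFinSuccAbove (fun _ => ℝ) 0)).trans
    (MeasurableEquiv.prodCongr (MeasurableEquiv.refl ℝ) MeasurableEquiv.finTwoArrow)

lemma coordEquiv_apply (x : R3) : coordEquiv x = (x 0, x 1, x 2) := rfl

lemma measurePreserving_coordEquiv : MeasurePreserving coordEquiv volume volume :=
  ((EuclideanSpace.volume_preserving_symm_measurableEquiv_toLp _).trans
    (volume_preserving_piFinSuccAbove (fun _ => ℝ) 0)).trans
    ((MeasurePreserving.id volume).prod (volume_preserving_finTwoArrow ℝ))

/-- Substitution z = cos θ on [0, π]. The interval (-π, π) and the restriction to sin θ > 0 have the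
shape produced by planar polar coordinates on a half-plane. -/
lemma lintegral_Ioo_sin_mul_comp_cos (f : ℝ → ℝ≥0∞) :
    ∫⁻ θ in Ioo (-Real.pi) Real.pi, (Ioi (0 : ℝ)).indicator (fun _ => 1) (Real.sin θ) *
      (ENNReal.ofReal (Real.sin θ) * f (Real.cos θ)) = ∫⁻ z in Icc (-1 : ℝ) 1, f z := by
  have e : ∀ θ ∈ Ioo (-Real.pi) Real.pi, (Ioi (0 : ℝ)).indicator (fun _ => (1 : ℝ≥0∞)) (Real.sin θ) *
      (ENNReal.ofReal (Real.sin θ) * f (Real.cos θ)) =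
      (Icc 0 Real.pi).indicator (fun θ => ENNReal.ofReal |(-Real.sin θ)| * f (Real.cos θ)) θ := by
    intro θ hθ
    by_cases h : θ ∈ Icc 0 Real.pi
    · have hs : 0 ≤ Real.sin θ := Real.sin_nonneg_of_mem_Icc h
      rw [indicator_of_mem h, abs_neg, abs_of_nonneg hs]
      rcases hs.eq_or_lt with h0 | h0
      · simp [← h0]
      · rw [indicator_of_mem (by exact h0), one_mul]
    · rw [indicator_of_notMem h, indicator_of_notMem, zero_mul]
      have : θ < 0 := by
        by_contra h'
        exact h ⟨not_lt.1 h', hθ.2.le⟩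
      have := Real.sin_neg_of_neg_of_neg_pi_lt this hθ.1
      simp [this.le]
  rw [setLIntegral_congr_fun measurableSet_Ioo e, lintegral_indicator measurableSet_Icc,
    Measure.restrict_restrict measurableSet_Icc]
  have hr : (volume : Measure ℝ).restrict (Icc 0 Real.pi ∩ Ioo (-Real.pi) Real.pi) =
      volume.restrict (Icc 0 Real.pi) := by
    refine Measure.restrict_congr_set ?_
    have h1 : (Ioo 0 Real.pi : Set ℝ) ≤ᵐ[volume] (Icc 0 Real.pi ∩ Ioo (-Real.pi) Real.pi : Set ℝ) := by
      refine Filter.Eventually.of_forall fun x hx => ?_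
      exact ⟨Ioo_subset_Icc_self hx, by linarith [hx.1, Real.pi_pos], hx.2⟩
    exact (LE.le.eventuallyLE inter_subset_left).antisymm
      (Ioo_ae_eq_Icc.symm.le.trans h1)
  rw [hr, ← Real.bijOn_cos.image_eq,
    lintegral_image_eq_lintegral_abs_deriv_mul measurableSet_Icc
      (fun x _ => (Real.hasDerivAt_cos x).hasDerivWithinAt) Real.injOn_cos]

/-- Polar coordinates in the plane, for a function of the radius. -/
lemma lintegral_comp_sq_add_sq {G : ℝ → ℝ≥0∞} (hG : Measurable G) :
    ∫⁻ y : ℝ × ℝ, G (y.1 ^ 2 + y.2 ^ 2) =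
      ENNReal.ofReal (2 * Real.pi) * ∫⁻ r in Ioi (0 : ℝ), ENNReal.ofReal r * G (r ^ 2) := by
  rw [← lintegral_comp_polarCoord_symm]
  have e : ∀ p : ℝ × ℝ, ENNReal.ofReal p.1 • G ((polarCoord.symm p).1 ^ 2 + (polarCoord.symm p).2 ^ 2) =
      (ENNReal.ofReal p.1 * G (p.1 ^ 2)) * 1 := by
    intro p
    rw [polarCoord_symm_apply, smul_eq_mul, mul_one]
    congr 2
    simp only
    linear_combination p.1 ^ 2 * Real.cos_sq_add_sin_sq p.2
  simp only [e]
  rw [polarCoord_target, Measure.volume_eq_prod, ← Measure.prod_restrict,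
    lintegral_prod_mul (f := fun r : ℝ => ENNReal.ofReal r * G (r ^ 2)) (g := fun _ => 1)
      (by fun_prop) (by fun_prop)]
  rw [mul_comm, lintegral_one, Measure.restrict_apply_univ, Real.volume_Ioo]
  congr 2
  ring

/-- Spherical coordinates obtained from planar polar coordinates used twice: first in the last two
variables, which leaves the half-plane (z, r), r > 0, with weight r; then in that half-plane, where
z = ρ cos θ and r = ρ sin θ. The radial factor separates as c, whose value is never computed, since
f = 1 identifies it from the volume of the ball. -/
lemma lintegral_ball_coord_div_norm : ∃ c : ℝ≥0∞, ∀ f : ℝ → ℝ≥0∞, Measurable f →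
    ∫⁻ x in Metric.ball (0 : R3) 1, f (x 0 / ‖x‖) = c * ∫⁻ z in Icc (-1 : ℝ) 1, f z := by
  refine ⟨ENNReal.ofReal (2 * Real.pi) *
    ∫⁻ r in Ioi (0 : ℝ), ENNReal.ofReal r * (ENNReal.ofReal r * (Iio (1 : ℝ)).indicator 1 (r ^ 2)),
    fun f hf => ?_⟩
  set F : ℝ → ℝ → ℝ≥0∞ := fun z w =>
    (Iio (1 : ℝ)).indicator 1 (z ^ 2 + w) * f (z / √(z ^ 2 + w)) with hF
  have hFm : Measurable fun p : ℝ × ℝ => F p.1 p.2 := by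
    have : Measurable ((Iio (1 : ℝ)).indicator (1 : ℝ → ℝ≥0∞)) :=
      measurable_one.indicator measurableSet_Iio
    exact (this.comp (by fun_prop)).mul (hf.comp (by fun_prop))
  have h1 : ∫⁻ x in Metric.ball (0 : R3) 1, f (x 0 / ‖x‖) =
      ∫⁻ p : ℝ × ℝ × ℝ, F p.1 (p.2.1 ^ 2 + p.2.2 ^ 2) := by
    rw [← measurePreserving_coordEquiv.lintegral_comp_emb coordEquiv.measurableEmbedding,
      ← lintegral_indicator Metric.isOpen_ball.measurableSet]
    refine lintegral_congr fun x => ?_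
    rw [coordEquiv_apply]
    have hn : x 0 ^ 2 + (x 1 ^ 2 + x 2 ^ 2) = ‖x‖ ^ 2 := by
      rw [EuclideanSpace.real_norm_sq_eq, Fin.sum_univ_three]; ring
    simp only [hF, hn, Real.sqrt_sq (norm_nonneg x)]
    by_cases h : x ∈ Metric.ball (0 : R3) 1
    · rw [indicator_of_mem h, indicator_of_mem]
      · simp
      · simp only [Metric.mem_ball, dist_zero_right] at h
        simp only [mem_Iio]
        nlinarith [norm_nonneg x]
    · rw [indicator_of_notMem h, indicator_of_notMem]
      · simp
      · simp only [Metric.mem_ball, dist_zero_right, not_lt] at h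
        simp only [mem_Iio, not_lt]
        nlinarith [norm_nonneg x]
  have h2 : ∫⁻ p : ℝ × ℝ × ℝ, F p.1 (p.2.1 ^ 2 + p.2.2 ^ 2) =
      ∫⁻ z : ℝ, ∫⁻ y : ℝ × ℝ, F z (y.1 ^ 2 + y.2 ^ 2) := by
    rw [Measure.volume_eq_prod, lintegral_prod]
    exact (hFm.comp (f := fun p : ℝ × ℝ × ℝ => (p.1, p.2.1 ^ 2 + p.2.2 ^ 2))
      (by fun_prop)).aemeasurable
  have h3 : ∀ z : ℝ, ∫⁻ y : ℝ × ℝ, F z (y.1 ^ 2 + y.2 ^ 2) = ENNReal.ofReal (2 * Real.pi) *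
      ∫⁻ r, (Ioi (0 : ℝ)).indicator (fun _ => 1) r * (ENNReal.ofReal r * F z (r ^ 2)) := by
    intro z
    rw [lintegral_comp_sq_add_sq (G := F z) (hFm.comp (f := fun w : ℝ => (z, w)) (by fun_prop)),
      ← lintegral_indicator measurableSet_Ioi]
    congr 1
    refine lintegral_congr fun r => ?_
    by_cases hr : r ∈ Ioi (0 : ℝ)
    · simp only [indicator_of_mem hr, one_mul]
    · simp only [indicator_of_notMem hr, zero_mul]
  have hind : Measurable ((Ioi (0 : ℝ)).indicator (fun _ => (1 : ℝ≥0∞))) :=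
    measurable_const.indicator measurableSet_Ioi
  have hm : Measurable fun q : ℝ × ℝ => (Ioi (0 : ℝ)).indicator (fun _ => (1 : ℝ≥0∞)) q.2 *
      (ENNReal.ofReal q.2 * F q.1 (q.2 ^ 2)) :=
    (hind.comp measurable_snd).mul
      ((by fun_prop : Measurable fun q : ℝ × ℝ => ENNReal.ofReal q.2).mul
      (hFm.comp (f := fun q : ℝ × ℝ => (q.1, q.2 ^ 2)) (by fun_prop)))
  rw [h1, h2]
  simp only [h3]
  rw [lintegral_const_mul _ (Measurable.lintegral_prod_right' hm), mul_assoc]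
  congr 1
  have h4 := lintegral_prod (μ := (volume : Measure ℝ)) (ν := (volume : Measure ℝ)) _ hm.aemeasurable
  simp only at h4
  rw [← h4, ← Measure.volume_eq_prod, ← lintegral_comp_polarCoord_symm, polarCoord_target,
    Measure.volume_eq_prod, ← Measure.prod_restrict, ← lintegral_Ioo_sin_mul_comp_cos f,
    ← lintegral_prod_mul]
  · rw [Measure.prod_restrict]
    refine setLIntegral_congr_fun (measurableSet_Ioi.prod measurableSet_Ioo) fun p hp => ?_
    have hp1 : 0 < p.1 := hp.1
    have hsq : (p.1 * Real.cos p.2) ^ 2 + (p.1 * Real.sin p.2) ^ 2 = p.1 ^ 2 := by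
      linear_combination p.1 ^ 2 * Real.cos_sq_add_sin_sq p.2
    simp only [polarCoord_symm_apply, hF, hsq, smul_eq_mul, Real.sqrt_sq hp1.le,
      mul_div_cancel_left₀ _ hp1.ne', ENNReal.ofReal_mul hp1.le]
    have : (Ioi (0 : ℝ)).indicator (fun _ => (1 : ℝ≥0∞)) (p.1 * Real.sin p.2) =
        (Ioi (0 : ℝ)).indicator (fun _ => (1 : ℝ≥0∞)) (Real.sin p.2) := by
      simp only [indicator, mem_Ioi, mul_pos_iff_of_pos_left hp1]
    rw [this]
    ring
  · have : Measurable ((Iio (1 : ℝ)).indicator (1 : ℝ → ℝ≥0∞)) :=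
      measurable_one.indicator measurableSet_Iio
    exact (Measurable.mul (by fun_prop) (Measurable.mul (by fun_prop)
      (this.comp (by fun_prop)))).aemeasurable
  · exact ((hind.comp Real.measurable_sin).mul
      ((by fun_prop : Measurable fun θ => ENNReal.ofReal (Real.sin θ)).mul
        (hf.comp Real.measurable_cos))).aemeasurable

/-- The uniform probability measure on the unit sphere of `ℝ³`. -/
def sphereMeasure : Measure R3 :=
  ((volume (Metric.ball (0 : R3) 1))⁻¹ • volume.restrict (Metric.ball 0 1)).map
    fun x => ‖x‖⁻¹ • x

lemma measurable_normalize : Measurable fun x : R3 => ‖x‖⁻¹ • x := by fun_prop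

lemma volume_unitBall_ne_zero : volume (Metric.ball (0 : R3) 1) ≠ 0 :=
  (Metric.measure_ball_pos volume _ one_pos).ne'

lemma volume_unitBall_ne_top : volume (Metric.ball (0 : R3) 1) ≠ ∞ :=
  Metric.isBounded_ball.measure_lt_top.ne

instance : IsProbabilityMeasure sphereMeasure := by
  refine ⟨?_⟩
  rw [sphereMeasure, Measure.map_apply measurable_normalize MeasurableSet.univ]
  rw [preimage_univ, Measure.smul_apply, Measure.restrict_apply_univ, smul_eq_mul,
    ENNReal.inv_mul_cancel volume_unitBall_ne_zero volume_unitBall_ne_top]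

lemma ae_norm_eq_one_sphereMeasure : ∀ᵐ ω ∂sphereMeasure, ‖ω‖ = 1 := by
  rw [sphereMeasure, ae_map_iff measurable_normalize.aemeasurable
    (measurableSet_eq_fun measurable_norm measurable_const)]
  refine Measure.ae_smul_measure (ae_restrict_of_ae ?_) _
  filter_upwards [(measure_eq_zero_iff_ae_notMem.1 (measure_singleton (0 : R3)))] with x hx
  have : ‖x‖ ≠ 0 := by simpa using hx
  rw [norm_smul, norm_inv, norm_norm, inv_mul_cancel₀ this]

lemma lintegral_sphereMeasure_inner {v : R3} (hv : ‖v‖ = 1) {f : ℝ → ℝ≥0∞} (hf : Measurable f) :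
    ∫⁻ ω, f (inner ℝ ω v) ∂sphereMeasure = 2⁻¹ * ∫⁻ z in Icc (-1 : ℝ) 1, f z := by
  obtain ⟨c, hc⟩ := lintegral_ball_coord_div_norm
  have hc1 : volume (Metric.ball (0 : R3) 1) = c * 2 := by
    have := hc (fun _ => 1) measurable_const
    simp only [lintegral_one, Measure.restrict_apply_univ, Real.volume_Icc] at this
    rw [this]; norm_num
  rw [sphereMeasure, lintegral_map (f := fun ω : R3 => f (inner ℝ ω v)) (hf.comp (by fun_prop))
    measurable_normalize, lintegral_smul_measure]
  set e : R3 := EuclideanSpace.single 0 1 with he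
  have hen : ‖e‖ = ‖v‖ := by rw [hv, he]; simp
  -- Rotation invariance is needed only for one isometry taking e to v; the reflection exchanging
  -- the two unit vectors does it.
  set ρ : R3 ≃ₗᵢ[ℝ] R3 := (Submodule.span ℝ {e - v})ᗮ.reflection
  have hρ : ρ e = v := Submodule.reflection_sub hen
  have h1 : ∫⁻ x in Metric.ball (0 : R3) 1, f (inner ℝ (‖x‖⁻¹ • x) v) =
      ∫⁻ x in Metric.ball (0 : R3) 1, f (x 0 / ‖x‖) := by
    have hpre : ρ ⁻¹' Metric.ball 0 1 = Metric.ball 0 1 := by ext x; simp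
    rw [← ρ.measurePreserving.setLIntegral_comp_preimage_emb ρ.toHomeomorph.measurableEmbedding, hpre]
    refine lintegral_congr fun x => ?_
    rw [LinearIsometryEquiv.norm_map, ← hρ, inner_smul_left, LinearIsometryEquiv.inner_map_map]
    simp [he, EuclideanSpace.inner_single_right, div_eq_inv_mul]
  rw [h1, hc f hf, hc1, smul_eq_mul, ← mul_assoc]
  congr 1
  have hc0 : c ≠ 0 := by
    rintro rfl; exact volume_unitBall_ne_zero (by rw [hc1, zero_mul])
  have hct : c ≠ ∞ := by
    rintro rfl; exact volume_unitBall_ne_top (by rw [hc1]; simp)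
  rw [ENNReal.mul_inv (Or.inl hc0) (Or.inl hct), mul_comm c⁻¹, mul_assoc,
    ENNReal.inv_mul_cancel hc0 hct, mul_one]

lemma map_inner_sphereMeasure {v : R3} (hv : ‖v‖ = 1) :
    sphereMeasure.map (fun ω => inner ℝ ω v) = (2 : ℝ≥0∞)⁻¹ • volume.restrict (Icc (-1) 1) := by
  refine Measure.ext_of_lintegral _ fun f hf => ?_
  rw [lintegral_map hf (by fun_prop), lintegral_sphereMeasure_inner hv hf, lintegral_smul_measure,
    smul_eq_mul]

/-- **Archimedes' hat-box theorem**: a coordinate of a uniform point of the unit sphere of `ℝ³` is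
uniformly distributed on `[-1, 1]`. -/
lemma integral_sphereMeasure_inner {E : Type*} [NormedAddCommGroup E] [NormedSpace ℝ E] (v : R3)
    {F : ℝ → E} (hF : StronglyMeasurable F) :
    ∫ ω, F (inner ℝ ω v) ∂sphereMeasure = (2 : ℝ)⁻¹ • ∫ z in (-1 : ℝ)..1, F (‖v‖ * z) := by
  obtain ⟨e, he, hve⟩ : ∃ e : R3, ‖e‖ = 1 ∧ v = ‖v‖ • e := by
    by_cases h : v = 0
    · exact ⟨EuclideanSpace.single 0 1, by simp, by simp [h]⟩
    · have : ‖v‖ ≠ 0 := by simpa using h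
      exact ⟨‖v‖⁻¹ • v, by rw [norm_smul, norm_inv, norm_norm, inv_mul_cancel₀ this],
        by rw [smul_smul, mul_inv_cancel₀ this, one_smul]⟩
  have h1 : ∀ ω, F (inner ℝ ω v) = (fun z => F (‖v‖ * z)) (inner ℝ ω e) := by
    intro ω
    simp only
    rw [← inner_smul_right, ← hve]
  simp only [h1]
  rw [← integral_map (φ := fun ω : R3 => inner ℝ ω e) (f := fun z => F (‖v‖ * z)) (by fun_prop)
    ((hF.comp_measurable (by fun_prop)).aestronglyMeasurable),
    map_inner_sphereMeasure he, integral_smul_measure,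
    intervalIntegral.integral_of_le (by norm_num), integral_Icc_eq_integral_Ioc]
  congr 1
  simp

/-- The mean is ½∫e^{i|v|z}dz over [-1, 1]. -/
lemma integral_sphereMeasure_exp (v : R3) :
    ∫ ω, Complex.exp (Complex.I * ((inner ℝ ω v : ℝ) : ℂ)) ∂sphereMeasure =
      (Real.sinc ‖v‖ : ℂ) := by
  rw [integral_sphereMeasure_inner v (F := fun z : ℝ => Complex.exp (Complex.I * (z : ℂ)))
    (Continuous.stronglyMeasurable (by fun_prop))]
  by_cases h : ‖v‖ = 0
  · simp [h]; norm_num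
  · have hI : Complex.I * (‖v‖ : ℂ) ≠ 0 := by simpa using h
    have := integral_exp_mul_complex (a := -1) (b := 1) hI
    push_cast at this
    simp only [Complex.ofReal_mul, ← mul_assoc]
    rw [this, Real.sinc_of_ne_zero h, Complex.real_smul]
    push_cast
    rw [Complex.sin]
    have : (‖v‖ : ℂ) ≠ 0 := by exact_mod_cast h
    field_simp
    simp only [Complex.I_sq]
    ring_nf

/-- After the hat-box reduction the integrand is the derivative of z e^{i|v|z}, so half the sum of
the boundary exponentials remains. It reflects the identity cos r = (r sinc r)'. -/
lemma integral_sphereMeasure_one_add_mul_exp (v : R3) :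
    ∫ ω, (1 + Complex.I * ((inner ℝ ω v : ℝ) : ℂ)) *
      Complex.exp (Complex.I * ((inner ℝ ω v : ℝ) : ℂ)) ∂sphereMeasure = (Real.cos ‖v‖ : ℂ) := by
  rw [integral_sphereMeasure_inner v
    (F := fun z : ℝ => (1 + Complex.I * (z : ℂ)) * Complex.exp (Complex.I * (z : ℂ)))
    (Continuous.stronglyMeasurable (by fun_prop))]
  have hd : ∀ z : ℝ, HasDerivAt (fun z : ℝ => (z : ℂ) * Complex.exp (Complex.I * ((‖v‖ * z : ℝ) : ℂ)))
      ((1 + Complex.I * ((‖v‖ * z : ℝ) : ℂ)) * Complex.exp (Complex.I * ((‖v‖ * z : ℝ) : ℂ))) z := by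
    intro z
    have h1 : HasDerivAt (fun z : ℝ => (z : ℂ)) 1 z := Complex.ofRealCLM.hasDerivAt
    have h2 : HasDerivAt (fun z : ℝ => Complex.I * ((‖v‖ * z : ℝ) : ℂ)) (Complex.I * ‖v‖) z := by
      have := (h1.const_mul (‖v‖ : ℂ)).const_mul Complex.I
      simpa using this
    have := h1.mul h2.cexp
    refine this.congr_deriv ?_
    push_cast; ring
  rw [intervalIntegral.integral_eq_sub_of_hasDerivAt (fun z _ => hd z)
    (Continuous.intervalIntegrable (by fun_prop) _ _), Complex.real_smul]
  push_cast
  rw [Complex.cos]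
  simp only [mul_one, mul_neg]
  ring_nf

/-- The spherical mean of `(1 + |x| / √T)^{-4}` over a sphere of radius `R` is `O(T / R²)`. -/
lemma integral_sphereMeasure_decay_le {T R : ℝ} (hT : 0 < T) (hR : 0 < R) (x : R3) :
    ∫ ω, ((1 + ‖x + R • ω‖ / √T) ^ 4)⁻¹ ∂sphereMeasure ≤ 4 * T / R ^ 2 := by
  have hmeas : ∀ (g : R3 → ℝ), Continuous g → (∀ ω, 0 ≤ g ω) →
      Integrable (fun ω => ((1 + g ω) ^ 4)⁻¹) sphereMeasure := by
    intro g hg h0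
    refine Integrable.of_bound (C := 1) ?_ (Filter.Eventually.of_forall fun ω => ?_)
    · exact (Continuous.inv₀ (by fun_prop) fun ω => by
        have := h0 ω; positivity).aestronglyMeasurable
    · have := h0 ω
      rw [Real.norm_of_nonneg (by positivity)]
      exact inv_le_one_of_one_le₀ (one_le_pow₀ (by linarith))
  have hint := hmeas (fun ω => ‖x + R • ω‖ / √T) (by fun_prop) fun ω => by positivity
  -- If |x| ≤ R/2, the whole sphere stays at distance at least R/2 from the origin and the weight is
  -- small pointwise. Otherwise only a small cap comes close to the origin, and its measure must be
  -- taken into account.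
  by_cases hx : ‖x‖ ≤ R / 2
  · calc _ ≤ ∫ ω : R3, 4 * T / R ^ 2 ∂sphereMeasure := by
          refine integral_mono_ae hint (integrable_const _) ?_
          filter_upwards [ae_norm_eq_one_sphereMeasure] with ω hω
          have h1 : R / 2 ≤ ‖x + R • ω‖ := by
            have : ‖R • ω‖ = R := by rw [norm_smul, hω, Real.norm_of_nonneg hR.le, mul_one]
            have := norm_sub_le (x + R • ω) x
            simp only [add_sub_cancel_left] at this
            linarith
          have h2 : R ^ 2 / (4 * T) ≤ (1 + ‖x + R • ω‖ / √T) ^ 4 := by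
            set u := ‖x + R • ω‖ / √T
            have hu : R / 2 / √T ≤ u := div_le_div_of_nonneg_right h1 (Real.sqrt_nonneg _)
            have hu0 : 0 ≤ R / 2 / √T := by positivity
            have : (R / 2 / √T) ^ 2 = R ^ 2 / (4 * T) := by
              rw [div_pow, div_pow, Real.sq_sqrt hT.le]; field_simp; norm_num
            rw [← this]
            calc (R / 2 / √T) ^ 2 ≤ (1 + u) ^ 2 := by gcongr; linarith
              _ ≤ (1 + u) ^ 4 := pow_le_pow_right₀ (by linarith) (by norm_num)
          calc _ ≤ (R ^ 2 / (4 * T))⁻¹ := inv_anti₀ (by positivity) h2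
            _ = _ := by rw [inv_div]
      _ = _ := by simp
  · push Not at hx
    have hx0 : 0 < ‖x‖ := lt_trans (by positivity) hx
    set A : ℝ := ‖x‖ ^ 2 + R ^ 2 with hA
    -- For unit ω, q(ω·x) = 1 + |x + Rω|²/T. Being affine in ω·x, its inverse square can be
    -- integrated exactly by the hat-box theorem, and it dominates the weight because 1 + u² ≤ (1 +
    -- u)².
    set q : ℝ → ℝ := fun z => 1 + (A + 2 * R * z) / T with hq
    have hqc : Continuous q := by fun_prop
    have hq1 : ∀ z : ℝ, -1 ≤ z → 1 ≤ q (‖x‖ * z) := by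
      intro z hz
      have : 0 ≤ A + 2 * R * (‖x‖ * z) := by
        nlinarith [sq_nonneg (‖x‖ - R), mul_pos hR hx0]
      simp only [hq]
      have := div_nonneg this hT.le
      linarith
    have hSM : StronglyMeasurable fun z => ((q z) ^ 2)⁻¹ :=
      ((hqc.measurable.pow_const 2).inv).stronglyMeasurable
    calc _ ≤ ∫ ω, ((q (inner ℝ ω x)) ^ 2)⁻¹ ∂sphereMeasure := by
          refine integral_mono_ae hint ?_ ?_
          · refine Integrable.of_bound (C := 1) (hSM.comp_measurable (by fun_prop)).aestronglyMeasurable ?_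
            filter_upwards [ae_norm_eq_one_sphereMeasure] with ω hω
            have h1 := hq1 (inner ℝ ω x / ‖x‖) (by
              rw [le_div_iff₀ hx0]
              have := abs_real_inner_le_norm ω x
              rw [hω, one_mul] at this
              linarith [(abs_le.1 this).1])
            rw [mul_div_cancel₀ _ hx0.ne'] at h1
            rw [Real.norm_of_nonneg (by positivity)]
            exact inv_le_one_of_one_le₀ (one_le_pow₀ h1)
          · filter_upwards [ae_norm_eq_one_sphereMeasure] with ω hω
            have h1 : q (inner ℝ ω x) = 1 + (‖x + R • ω‖ / √T) ^ 2 := by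
              rw [div_pow, Real.sq_sqrt hT.le, norm_add_sq_real, norm_smul, hω,
                Real.norm_of_nonneg hR.le, inner_smul_right, real_inner_comm]
              simp only [hq, hA]
              ring
            rw [h1]
            set u := ‖x + R • ω‖ / √T
            have hu : 0 ≤ u := by positivity
            refine inv_anti₀ (by positivity) ?_
            calc (1 + u ^ 2) ^ 2 ≤ ((1 + u) ^ 2) ^ 2 := by gcongr; nlinarith
              _ = _ := by ring
      _ = (2 : ℝ)⁻¹ • ∫ z in (-1 : ℝ)..1, ((q (‖x‖ * z)) ^ 2)⁻¹ :=
          integral_sphereMeasure_inner x hSM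
      _ ≤ 4 * T / R ^ 2 := by
          have hd : ∀ z ∈ uIcc (-1 : ℝ) 1, HasDerivAt (fun z => -(T / (2 * R * ‖x‖)) * (q (‖x‖ * z))⁻¹)
              ((q (‖x‖ * z)) ^ 2)⁻¹ z := by
            intro z hz
            rw [uIcc_of_le (by norm_num)] at hz
            have h0 : q (‖x‖ * z) ≠ 0 := by have := hq1 z hz.1; positivity
            have h1 : HasDerivAt (fun z => q (‖x‖ * z)) (2 * R * ‖x‖ / T) z := by
              have := ((((hasDerivAt_id z).const_mul ‖x‖).const_mul (2 * R)).const_add A).div_const T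
              have := this.const_add 1
              exact this.congr_deriv (by ring)
            have := (h1.inv h0).const_mul (-(T / (2 * R * ‖x‖)))
            refine this.congr_deriv ?_
            field_simp
          rw [intervalIntegral.integral_eq_sub_of_hasDerivAt hd
            (ContinuousOn.intervalIntegrable (by
              refine ContinuousOn.inv₀ (by fun_prop) fun z hz => ?_
              rw [uIcc_of_le (by norm_num)] at hz
              have := hq1 z hz.1
              positivity))]
          have ha := hq1 (-1) le_rfl
          have hb := hq1 1 (by norm_num)
          have ha' : (q (‖x‖ * -1))⁻¹ ≤ 1 := inv_le_one_of_one_le₀ ha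
          have hb' : 0 ≤ (q (‖x‖ * 1))⁻¹ := by positivity
          -- This is where |x| > R/2 enters.
          have hc : T / (2 * R * ‖x‖) ≤ T / R ^ 2 := by
            gcongr
            nlinarith
          have hc0 : 0 ≤ T / (2 * R * ‖x‖) := by positivity
          rw [smul_eq_mul]
          have : 4 * T / R ^ 2 = 4 * (T / R ^ 2) := by ring
          rw [this]
          nlinarith

/-! ### Homogeneous polynomials -/

/-- Homogeneous polynomials of degree `n` on `ℝ³`. -/
def IsHomPoly : ℕ → (R3 → ℂ) → Prop
  | 0, P => ∃ c : ℂ, P = fun _ => c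
  | n + 1, P => ∃ Q : Fin 3 → R3 → ℂ, (∀ j, IsHomPoly n (Q j)) ∧
      P = fun ξ => ∑ j, (ξ j : ℂ) * Q j ξ

namespace IsHomPoly

lemma hasTemperateGrowth {n : ℕ} : ∀ {P : R3 → ℂ}, IsHomPoly n P →
    Function.HasTemperateGrowth P := by
  induction n with
  | zero => rintro P ⟨c, rfl⟩; exact Function.HasTemperateGrowth.const c
  | succ n ih =>
    rintro P ⟨Q, hQ, rfl⟩
    refine Function.HasTemperateGrowth.sum fun j _ => ?_
    have h1 : Function.HasTemperateGrowth fun ξ : R3 => (ξ j : ℂ) :=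
      (Complex.ofRealCLM.comp (EuclideanSpace.proj (𝕜 := ℝ) j)).hasTemperateGrowth
    exact h1.mul (ih (hQ j))

lemma continuous {n : ℕ} {P : R3 → ℂ} (hP : IsHomPoly n P) : Continuous P :=
  hP.hasTemperateGrowth.1.continuous

lemma smul_apply {n : ℕ} : ∀ {P : R3 → ℂ}, IsHomPoly n P → ∀ (a : ℝ) (ξ : R3),
    P (a • ξ) = (a : ℂ) ^ n * P ξ := by
  induction n with
  | zero => rintro P ⟨c, rfl⟩ a ξ; simp
  | succ n ih =>
    rintro P ⟨Q, hQ, rfl⟩ a ξ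
    simp only [Finset.mul_sum]
    refine Finset.sum_congr rfl fun j _ => ?_
    rw [ih (hQ j)]
    simp
    ring

lemma const_mul {n : ℕ} (c : ℂ) : ∀ {P : R3 → ℂ}, IsHomPoly n P →
    IsHomPoly n fun ξ => c * P ξ := by
  induction n with
  | zero => rintro P ⟨d, rfl⟩; exact ⟨c * d, rfl⟩
  | succ n ih =>
    rintro P ⟨Q, hQ, rfl⟩
    refine ⟨fun j ξ => c * Q j ξ, fun j => ih (hQ j), ?_⟩
    funext ξ
    rw [Finset.mul_sum]
    exact Finset.sum_congr rfl fun j _ => by ring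

lemma const (c : ℂ) : IsHomPoly 0 fun _ => c := ⟨c, rfl⟩

lemma mul {n m : ℕ} {Q : R3 → ℂ} (hQ : IsHomPoly m Q) : ∀ {P : R3 → ℂ}, IsHomPoly n P →
    IsHomPoly (n + m) fun ξ => P ξ * Q ξ := by
  induction n with
  | zero => rintro P ⟨c, rfl⟩; rw [zero_add]; exact hQ.const_mul c
  | succ n ih =>
    rintro P ⟨Q', hQ', rfl⟩
    rw [Nat.succ_add]
    refine ⟨fun j ξ => Q' j ξ * Q ξ, fun j => ih (hQ' j), ?_⟩
    funext ξ
    rw [Finset.sum_mul]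
    exact Finset.sum_congr rfl fun j _ => by ring

lemma coord (j : Fin 3) : IsHomPoly 1 fun ξ => (ξ j : ℂ) := by
  refine ⟨fun i _ => if i = j then 1 else 0, fun i => const _, ?_⟩
  funext ξ
  simp

lemma normSq : IsHomPoly 2 fun ξ => ((‖ξ‖ ^ 2 : ℝ) : ℂ) := by
  refine ⟨fun j ξ => (ξ j : ℂ), coord, ?_⟩
  funext ξ
  rw [EuclideanSpace.real_norm_sq_eq]
  push_cast
  exact Finset.sum_congr rfl fun j _ => by ring

lemma normSq_pow (j : ℕ) : IsHomPoly (2 * j) fun ξ => ((‖ξ‖ ^ 2 : ℝ) : ℂ) ^ j := by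
  induction j with
  | zero => simpa using const 1
  | succ j ih =>
    have := normSq.mul ih
    simpa only [pow_succ, Nat.mul_succ] using this

lemma derivSymbol {k : ℕ} (J : Fin k → Fin 3) : IsHomPoly k (derivSymbol J) := by
  induction k with
  | zero => exact ⟨1, by funext ξ; simp [_root_.derivSymbol]⟩
  | succ k ih =>
    have h := ((coord (J 0)).const_mul Complex.I)
    have := (ih fun i => J i.succ).mul h
    rw [Nat.add_comm] at this
    convert this using 1
    funext ξ
    simp only [_root_.derivSymbol, Fin.prod_univ_succ]

/-- One coordinate factor is peeled off at a time, the inductive form of `IsHomPoly` being made for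
this; -i compensates the i in each factor of the derivative symbol. This is what transfers k
derivatives from the kernel to g. -/
lemma exists_eq_sum_derivSymbol_mul {d : ℕ} (k : ℕ) : ∀ {P : R3 → ℂ}, IsHomPoly (k + d) P →
    ∃ R : (Fin k → Fin 3) → R3 → ℂ, (∀ J, IsHomPoly d (R J)) ∧
      P = fun ξ => ∑ J, _root_.derivSymbol J ξ * R J ξ := by
  induction k with
  | zero =>
    intro P hP
    rw [zero_add] at hP
    refine ⟨fun _ => P, fun _ => hP, ?_⟩
    funext ξ
    simp [_root_.derivSymbol]
  | succ k ih =>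
    intro P hP
    rw [Nat.succ_add] at hP
    obtain ⟨Q, hQ, rfl⟩ := hP
    choose R hR hQR using fun j => ih (hQ j)
    refine ⟨fun J ξ => -Complex.I * R (J 0) (fun i => J i.succ) ξ,
      fun J => (hR _ _).const_mul _, ?_⟩
    funext ξ
    rw [← (Fin.consEquiv fun _ => Fin 3).sum_comp, Fintype.sum_prod_type]
    refine Finset.sum_congr rfl fun j _ => ?_
    rw [hQR j, Finset.mul_sum]
    refine Finset.sum_congr rfl fun J _ => ?_
    simp only [_root_.derivSymbol, Fin.consEquiv_apply, Fin.prod_univ_succ, Fin.cons_zero,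
      Fin.cons_succ]
    linear_combination ((ξ j : ℂ) * (∏ i, Complex.I * (ξ (J i) : ℂ)) * R j J ξ) * Complex.I_sq

end IsHomPoly

/-! ### Gaussians times tempered families -/

lemma exists_exp_neg_sq_mul_pow_le {c : ℝ} (hc : 0 < c) (M : ℕ) :
    ∃ B : ℝ, 0 ≤ B ∧ ∀ r : ℝ, 0 ≤ r → Real.exp (-c * r ^ 2) * (1 + r) ^ M ≤ B := by
  refine ⟨2 ^ M * (M.factorial * (c ^ M)⁻¹ * Real.exp c), by positivity, fun r hr => ?_⟩
  have h1 : (1 + r) ^ M ≤ (2 * (1 + r ^ 2)) ^ M := by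
    gcongr
    nlinarith [sq_nonneg (r - 1), sq_nonneg r]
  have h2 := Real.pow_div_factorial_le_exp (c * (1 + r ^ 2)) (by positivity) M
  rw [div_le_iff₀ (by positivity), mul_pow] at h2
  have h3 : (1 + r ^ 2) ^ M ≤ M.factorial * (c ^ M)⁻¹ * Real.exp (c * (1 + r ^ 2)) := by
    rw [mul_assoc, mul_comm, mul_assoc, inv_mul_eq_div, le_div_iff₀ (by positivity)]
    linarith
  calc Real.exp (-c * r ^ 2) * (1 + r) ^ M
      ≤ Real.exp (-c * r ^ 2) * (2 ^ M * (M.factorial * (c ^ M)⁻¹ * Real.exp (c * (1 + r ^ 2)))) := by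
        gcongr
        refine h1.trans ?_
        rw [mul_pow]
        gcongr
    _ = 2 ^ M * (M.factorial * (c ^ M)⁻¹ * (Real.exp (-c * r ^ 2) * Real.exp (c * (1 + r ^ 2)))) := by
        ring
    _ = _ := by
        rw [← Real.exp_add]
        congr 4
        ring

lemma exists_norm_iteratedFDeriv_gaussian_le {c : ℝ} (hc : 0 < c) (n M : ℕ) :
    ∃ B : ℝ, 0 ≤ B ∧ ∀ η : R3,
      ‖iteratedFDeriv ℝ n (fun η : R3 => Real.exp (-c * ‖η‖ ^ 2)) η‖ ≤ B * ((1 + ‖η‖) ^ M)⁻¹ := by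
  have hf : Function.HasTemperateGrowth fun η : R3 => -c * ‖η‖ ^ 2 := by fun_prop
  obtain ⟨k, C, hC, hb⟩ := hf.norm_iteratedFDeriv_le_uniform n
  -- The chain rule for n derivatives of exp(-c|η|²) costs at most n polynomial factors of degree k;
  -- M is the decay to be kept.
  obtain ⟨B, hB, hB'⟩ := exists_exp_neg_sq_mul_pow_le hc (k * n + M)
  refine ⟨n.factorial * (1 + C) ^ n * B, by positivity, fun η => ?_⟩
  have h1 := norm_iteratedFDeriv_comp_le (𝕜 := ℝ) (g := Real.exp) (f := fun η : R3 => -c * ‖η‖ ^ 2)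
    (n := n) (N := (⊤ : ℕ∞)) Real.contDiff_exp hf.1 (by exact_mod_cast le_top) η
    (C := Real.exp (-c * ‖η‖ ^ 2)) (D := (1 + C) * (1 + ‖η‖) ^ k)
    (fun i _ => by
      rw [norm_iteratedFDeriv_eq_norm_iteratedDeriv, iteratedDeriv_eq_iterate, Real.iter_deriv_exp,
        Real.norm_of_nonneg (Real.exp_pos _).le])
    (fun i hi hi' => by
      calc _ ≤ C * (1 + ‖η‖) ^ k := hb i hi' η
        _ ≤ (1 + C) * (1 + ‖η‖) ^ k := by gcongr; simp
        _ ≤ _ := le_self_pow₀ (one_le_mul_of_one_le_of_one_le (by linarith)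
            (one_le_pow₀ (by linarith [norm_nonneg η]))) (by omega))
  refine (show ‖iteratedFDeriv ℝ n (fun η : R3 => Real.exp (-c * ‖η‖ ^ 2)) η‖ ≤ _ from h1).trans ?_
  rw [← div_eq_mul_inv, le_div_iff₀ (by positivity)]
  calc _ = n.factorial * (1 + C) ^ n * (Real.exp (-c * ‖η‖ ^ 2) * (1 + ‖η‖) ^ (k * n + M)) := by
        rw [mul_pow, ← pow_mul, pow_add]; ring
    _ ≤ _ := by gcongr; exact hB' _ (norm_nonneg _)

/-- Freezing the parameter is composition with the affine map η ↦ (p, η), whose linear part has norm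
at most one. Joint temperate growth thus controls η-derivatives uniformly over bounded parameters.
-/
lemma norm_iteratedFDeriv_comp_prodMk_le {P F G : Type*} [NormedAddCommGroup P] [NormedSpace ℝ P]
    [NormedAddCommGroup F] [NormedSpace ℝ F] [NormedAddCommGroup G] [NormedSpace ℝ G]
    {Ψ : P × F → G} (hΨ : ContDiff ℝ (⊤ : ℕ∞) Ψ) (p : P) (η : F) (n : ℕ) :
    ‖iteratedFDeriv ℝ n (fun η => Ψ (p, η)) η‖ ≤ ‖iteratedFDeriv ℝ n Ψ (p, η)‖ := by
  have e : (fun η => Ψ (p, η)) =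
      (fun y : P × F => Ψ ((p, 0) + y)) ∘ ContinuousLinearMap.inr ℝ P F := by
    funext η; simp
  have hc : ContDiff ℝ (⊤ : ℕ∞) (fun y : P × F => Ψ ((p, 0) + y)) :=
    hΨ.comp (contDiff_const.add contDiff_id)
  rw [e, ContinuousLinearMap.iteratedFDeriv_comp_right _ hc _ (by exact_mod_cast le_top),
    iteratedFDeriv_comp_add_left]
  refine (ContinuousMultilinearMap.norm_compContinuousLinearMap_le _ _).trans ?_
  simp only [ContinuousLinearMap.inr_apply, Prod.mk_add_mk, add_zero, zero_add]
  refine mul_le_of_le_one_right (norm_nonneg _) (Finset.prod_le_one (fun _ _ => norm_nonneg _) ?_)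
  intro _ _
  exact ContinuousLinearMap.norm_inr_le_one ℝ P F

/-- Inverse Fourier transforms of a Gaussian times a tempered family of symbols decay uniformly. -/
lemma exists_norm_invFourier_gaussian_mul_le {P : Type*} [NormedAddCommGroup P] [NormedSpace ℝ P]
    {Ψ : P × R3 → ℂ} (hΨ : Function.HasTemperateGrowth Ψ) {c : ℝ} (hc : 0 < c) :
    ∃ C : ℝ, 0 < C ∧ ∀ p : P, ‖p‖ ≤ 1 → ∀ x : R3,
      ‖invFourier (fun η => (Real.exp (-c * ‖η‖ ^ 2) : ℂ) * Ψ (p, η)) x‖ ≤ C * ((1 + ‖x‖) ^ 4)⁻¹ := by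
  obtain ⟨B, hB, hdecay⟩ := norm_invFourier_le_of_decay
  obtain ⟨k, D, hD, hΨb⟩ := hΨ.norm_iteratedFDeriv_le_uniform 4
  -- Of the decay order k + 4, k absorbs the growth of Ψ and its derivatives and 4 is left, the
  -- first integer above the dimension.
  choose A hA hAb using fun n => exists_norm_iteratedFDeriv_gaussian_le hc n (k + 4)
  set K : ℝ := ∑ n ∈ Finset.range 5, ∑ i ∈ Finset.range (n + 1), (n.choose i : ℝ) * A i * (D * 2 ^ k)
    with hK
  have hK0 : 0 ≤ K := Finset.sum_nonneg fun n _ => Finset.sum_nonneg fun i _ => by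
    have := hA i; positivity
  refine ⟨B * (K + 1), by positivity, fun p hp x => hdecay (K + 1) _ ?_ ?_ x⟩
  · have : ContDiff ℝ (⊤ : ℕ∞) fun η : R3 => Real.exp (-c * ‖η‖ ^ 2) :=
      Real.contDiff_exp.comp (contDiff_const.mul (contDiff_norm_sq ℝ))
    exact (Complex.ofRealCLM.contDiff.comp this).mul (hΨ.1.comp (contDiff_const.prodMk contDiff_id))
  · intro n hn η
    have e : (fun η : R3 => (Real.exp (-c * ‖η‖ ^ 2) : ℂ) * Ψ (p, η)) =
        fun η : R3 => (Real.exp (-c * ‖η‖ ^ 2)) • Ψ (p, η) := by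
      funext η; rw [Complex.real_smul]
    rw [e]
    have hg : ContDiff ℝ (⊤ : ℕ∞) fun η : R3 => Real.exp (-c * ‖η‖ ^ 2) :=
      Real.contDiff_exp.comp (contDiff_const.mul (contDiff_norm_sq ℝ))
    have hΨp : ContDiff ℝ (⊤ : ℕ∞) fun η : R3 => Ψ (p, η) :=
      hΨ.1.comp (contDiff_const.prodMk contDiff_id)
    refine (norm_iteratedFDeriv_smul_le hg hΨp η (n := n) (by exact_mod_cast le_top)).trans ?_
    have hterm : ∀ i ∈ Finset.range (n + 1), (n.choose i : ℝ) *
        ‖iteratedFDeriv ℝ i (fun η : R3 => Real.exp (-c * ‖η‖ ^ 2)) η‖ *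
        ‖iteratedFDeriv ℝ (n - i) (fun η : R3 => Ψ (p, η)) η‖ ≤
        ((n.choose i : ℝ) * A i * (D * 2 ^ k)) * ((1 + ‖η‖) ^ 4)⁻¹ := by
      intro i hi
      have h1 : ‖iteratedFDeriv ℝ (n - i) (fun η : R3 => Ψ (p, η)) η‖ ≤
          D * (2 ^ k * (1 + ‖η‖) ^ k) := by
        refine (norm_iteratedFDeriv_comp_prodMk_le hΨ.1 p η _).trans
          ((hΨb _ (by omega) _).trans ?_)
        rw [← mul_pow]
        gcongr
        rw [Prod.norm_mk]
        rcases max_cases ‖p‖ ‖η‖ with h | h <;> linarith [norm_nonneg η, h.1]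
      calc _ ≤ (n.choose i : ℝ) * (A i * ((1 + ‖η‖) ^ (k + 4))⁻¹) *
            (D * (2 ^ k * (1 + ‖η‖) ^ k)) := by
            have := hA i
            gcongr
            exact hAb i η
        _ = _ := by
            rw [pow_add]
            field_simp
    refine (Finset.sum_le_sum hterm).trans ?_
    rw [← Finset.sum_mul]
    gcongr
    refine le_trans ?_ (le_add_of_nonneg_right zero_le_one)
    exact Finset.single_le_sum (f := fun n => ∑ i ∈ Finset.range (n + 1),
      (n.choose i : ℝ) * A i * (D * 2 ^ k)) (fun n _ => Finset.sum_nonneg fun i _ => by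
        have := hA i; positivity) (by simp; omega)

/-! ### Wave symbols and the size of their kernels -/

/-- Parameters `(1 + t)^{-1/2}`, `t / (1 + t)`, `z ∈ [0, 1]` and `ω` in the unit sphere of a
superposition of plane waves. -/
abbrev WaveParam : Type := ℝ × ℝ × ℝ × R3

/-- The parameter at time `t` of the point `(ω, z)`. -/
def waveParam (t : ℝ) (q : R3 × ℝ) : WaveParam := ((√(1 + t))⁻¹, t / (1 + t), q.2, q.1)

/-- The uniform probability measure on the product of the unit sphere and `[0, 1]`. -/
def waveMeasure : Measure (R3 × ℝ) := sphereMeasure.prod (volume.restrict (Icc 0 1))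

instance : IsProbabilityMeasure (volume.restrict (Icc (0 : ℝ) 1)) := ⟨by simp⟩

instance : IsProbabilityMeasure waveMeasure := by unfold waveMeasure; infer_instance

lemma ae_waveMeasure : ∀ᵐ q ∂waveMeasure, ‖q.1‖ = 1 ∧ q.2 ∈ Icc (0 : ℝ) 1 := by
  have h1 : ∀ᵐ q ∂waveMeasure, ‖q.1‖ = 1 :=
    Measure.quasiMeasurePreserving_fst.ae ae_norm_eq_one_sphereMeasure
  have h2 : ∀ᵐ q ∂waveMeasure, q.2 ∈ Icc (0 : ℝ) 1 :=
    Measure.quasiMeasurePreserving_snd.ae (ae_restrict_mem measurableSet_Icc)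
  filter_upwards [h1, h2] with q h1 h2 using ⟨h1, h2⟩

lemma integral_waveMeasure_fst (f : R3 → ℝ) :
    ∫ q, f q.1 ∂waveMeasure = ∫ ω, f ω ∂sphereMeasure := by
  rw [waveMeasure, integral_fun_fst, probReal_univ, one_smul]

/-- The source of uniformity in time: t enters the amplitude only through parameters confined to the
unit ball. -/
lemma norm_waveParam_le {t : ℝ} (ht : 0 ≤ t) {q : R3 × ℝ} (h1 : ‖q.1‖ = 1)
    (h2 : q.2 ∈ Icc (0 : ℝ) 1) : ‖waveParam t q‖ ≤ 1 := by
  have h3 : 1 ≤ √(1 + t) := by rw [Real.one_le_sqrt]; linarith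
  simp only [waveParam, Prod.norm_def, Real.norm_eq_abs, sup_le_iff]
  refine ⟨?_, ?_, ?_, h1.le⟩
  · rw [abs_of_nonneg (by positivity)]; exact inv_le_one_of_one_le₀ h3
  · rw [abs_of_nonneg (by positivity), div_le_one (by linarith)]; linarith
  · rw [abs_of_nonneg h2.1]; exact h2.2

lemma continuous_waveParam (t : ℝ) : Continuous (waveParam t) := by unfold waveParam; fun_prop

/-- A family of symbols that are superpositions of plane waves with speed `β`, of order
`(1 + t)^e` and with parabolic scaling. -/
structure IsWaveSymbol (ν β c₀ e : ℝ) (S : ℝ → R3 → ℂ) : Prop where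
  aesm : ∀ t, AEStronglyMeasurable (S t) volume
  exists_rep : ∃ Ψ : WaveParam × R3 → ℂ, Function.HasTemperateGrowth Ψ ∧
    ∀ t, 0 ≤ t → ∀ ξ : R3, ξ ≠ 0 → ‖ξ‖ < c₀ → S t ξ = (((1 + t) ^ e : ℝ) : ℂ) *
      (Real.exp (-(ν * ‖ξ‖ ^ 2 / 2) * t) : ℂ) *
      ∫ q, Complex.exp (Complex.I * ((inner ℝ ((β * t) • q.1) ξ : ℝ) : ℂ)) *
        Ψ (waveParam t q, √(1 + t) • ξ) ∂waveMeasure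

/-- Smooth complex-valued functions that vanish for `|ξ| ≥ c₀`. -/
structure IsCutSymbol (c₀ : ℝ) (η : R3 → ℂ) : Prop where
  smooth : ContDiff ℝ (⊤ : ℕ∞) η
  eq_zero : ∀ ξ, c₀ ≤ ‖ξ‖ → η ξ = 0

lemma IsCutSymbol.hasCompactSupport {c₀ : ℝ} {η : R3 → ℂ} (h : IsCutSymbol c₀ η) :
    HasCompactSupport η := by
  refine HasCompactSupport.intro (isCompact_closedBall (0 : R3) c₀) fun ξ hξ => h.eq_zero ξ ?_
  simp only [Metric.mem_closedBall, dist_zero_right, not_le] at hξ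
  exact hξ.le

lemma IsCutSymbol.smooth_mul {c₀ : ℝ} {η f : R3 → ℂ} (h : IsCutSymbol c₀ η)
    (hf : ContDiff ℝ (⊤ : ℕ∞) f) : IsCutSymbol c₀ fun ξ => f ξ * η ξ :=
  ⟨hf.mul h.smooth, fun ξ hξ => by simp [h.eq_zero ξ hξ]⟩

/-- The spherical mean of the parabolically scaled weight `(1 + |x|)^{-4}`. -/
def waveProfile (β t : ℝ) (x : R3) : ℝ :=
  ∫ ω, ((1 + ‖x + (β * t) • ω‖ / √(1 + t)) ^ 4)⁻¹ ∂sphereMeasure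

lemma continuous_weight (β t : ℝ) :
    Continuous fun y : R3 × R3 => ((1 + ‖y.1 + (β * t) • y.2‖ / √(1 + t)) ^ 4)⁻¹ :=
  Continuous.inv₀ (by fun_prop) fun y => by positivity

/-- The dispersive gain. For t ≥ 1 it is the T/R² bound with T = 1 + t and R = βt; for t < 1 the
sphere may be too small to help, and the trivial bound by one suffices. -/
lemma exists_waveProfile_le {β : ℝ} (hβ : 0 < β) : ∃ C : ℝ, 0 < C ∧ ∀ t, 0 ≤ t → ∀ x,
    waveProfile β t x ≤ C * (1 + t)⁻¹ := by
  refine ⟨2 + 16 / β ^ 2, by positivity, fun t ht x => ?_⟩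
  by_cases h : t < 1
  · calc waveProfile β t x ≤ ∫ _ω, 1 ∂sphereMeasure := by
          refine integral_mono_of_nonneg (Filter.Eventually.of_forall fun ω => by positivity)
            (integrable_const _) (Filter.Eventually.of_forall fun ω => ?_)
          exact inv_le_one_of_one_le₀ (one_le_pow₀ (by
            have : 0 ≤ ‖x + (β * t) • ω‖ / √(1 + t) := by positivity
            linarith))
      _ = 2 * 2⁻¹ := by simp
      _ ≤ (2 + 16 / β ^ 2) * (1 + t)⁻¹ := by
          gcongr
          · have : 0 ≤ 16 / β ^ 2 := by positivity
            linarith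
          · linarith
  · push Not at h
    have ht0 : 0 < t := by linarith
    refine (integral_sphereMeasure_decay_le (T := 1 + t) (R := β * t) (by linarith) (by positivity)
      x).trans ?_
    have h1 : 4 * (1 + t) / (β * t) ^ 2 ≤ 16 / β ^ 2 * (1 + t)⁻¹ := by
      rw [← div_eq_mul_inv, div_div, div_le_div_iff₀ (by positivity) (by positivity)]
      have : (1 + t) ^ 2 ≤ 4 * t ^ 2 := by nlinarith
      nlinarith [mul_le_mul_of_nonneg_left this (sq_nonneg β)]
    refine h1.trans ?_
    gcongr
    linarith

lemma integral_scaled_weight {t : ℝ} (ht : 0 ≤ t) (y : R3) :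
    Integrable (fun x : R3 => ((1 + ‖x + y‖ / √(1 + t)) ^ 4)⁻¹) ∧
    ∫ x : R3, ((1 + ‖x + y‖ / √(1 + t)) ^ 4)⁻¹ =
      (1 + t) ^ (3 / 2 : ℝ) * ∫ x : R3, ((1 + ‖x‖) ^ 4)⁻¹ := by
  have hT : 0 < √(1 + t) := Real.sqrt_pos.2 (by linarith)
  have e : ∀ x : R3, ((1 + ‖x‖ / √(1 + t)) ^ 4)⁻¹ =
      (fun z : R3 => ((1 + ‖z‖) ^ 4)⁻¹) ((√(1 + t))⁻¹ • x) := by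
    intro x
    simp only [norm_smul, norm_inv, Real.norm_of_nonneg hT.le]
    rw [div_eq_inv_mul]
  have h1 : Integrable (fun x : R3 => ((1 + ‖x‖ / √(1 + t)) ^ 4)⁻¹) := by
    simp only [e]
    exact integrable_one_add_norm_pow_four_inv.comp_smul (inv_ne_zero hT.ne')
  refine ⟨h1.comp_add_right y, ?_⟩
  rw [integral_add_right_eq_self (fun x : R3 => ((1 + ‖x‖ / √(1 + t)) ^ 4)⁻¹) y]
  simp only [e]
  rw [Measure.integral_comp_smul volume (fun z : R3 => ((1 + ‖z‖) ^ 4)⁻¹),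
    finrank_euclideanSpace_fin, smul_eq_mul]
  congr 1
  rw [inv_pow, inv_inv, abs_of_pos (by positivity), Real.sqrt_eq_rpow, ← Real.rpow_natCast,
    ← Real.rpow_mul (by linarith)]
  norm_num

/-- By Fubini and translation invariance, averaging over the sphere does not change the mass of the
scaled weight. -/
lemma integral_waveProfile (β : ℝ) {t : ℝ} (ht : 0 ≤ t) : Integrable (waveProfile β t) ∧
    ∫ x, waveProfile β t x = (1 + t) ^ (3 / 2 : ℝ) * ∫ x : R3, ((1 + ‖x‖) ^ 4)⁻¹ := by
  have hi : Integrable (fun y : R3 × R3 => ((1 + ‖y.1 + (β * t) • y.2‖ / √(1 + t)) ^ 4)⁻¹)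
      (volume.prod sphereMeasure) := by
    rw [integrable_prod_iff' (continuous_weight β t).aestronglyMeasurable]
    refine ⟨Filter.Eventually.of_forall fun ω => (integral_scaled_weight ht ((β * t) • ω)).1, ?_⟩
    have : ∀ ω : R3, ∫ x : R3, ‖((1 + ‖x + (β * t) • ω‖ / √(1 + t)) ^ 4)⁻¹‖ =
        (1 + t) ^ (3 / 2 : ℝ) * ∫ x : R3, ((1 + ‖x‖) ^ 4)⁻¹ := by
      intro ω
      rw [← (integral_scaled_weight ht ((β * t) • ω)).2]
      refine integral_congr_ae (Filter.Eventually.of_forall fun x => ?_)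
      exact Real.norm_of_nonneg (by positivity)
    simp only [this]
    exact integrable_const _
  refine ⟨hi.integral_prod_left, ?_⟩
  unfold waveProfile
  rw [integral_integral_swap hi]
  simp only [(integral_scaled_weight ht _).2]
  simp

/-- The kernels obey the `L¹` bound `(1 + t)^γ` and the sup bound `(1 + t)^{γ - 5/2}`. -/
def HasKernelBound (γ : ℝ) (M : ℝ → R3 → ℂ) : Prop :=
  ∃ C : ℝ, 0 < C ∧ ∀ t, 0 ≤ t → Integrable (M t) ∧ ∫ x, ‖M t x‖ ≤ C * (1 + t) ^ γ ∧
    ∀ x, ‖M t x‖ ≤ C * (1 + t) ^ (γ - 5 / 2)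

/-- A parabolically scaled symbol, the amplitude of a plane wave. -/
def wavePacket (ν e : ℝ) (R η : R3 → ℂ) (Ψ : WaveParam × R3 → ℂ) (t : ℝ) (q : R3 × ℝ) (ξ : R3) : ℂ :=
  R ξ * (η ξ * ((((1 + t) ^ e : ℝ) : ℂ) * (Real.exp (-(ν * ‖ξ‖ ^ 2 / 2) * t) : ℂ) *
    Ψ (waveParam t q, √(1 + t) • ξ)))

lemma continuous_wavePacket {ν e c₀ : ℝ} {R η : R3 → ℂ} {Ψ : WaveParam × R3 → ℂ}
    (hΨ : Function.HasTemperateGrowth Ψ) (hη : IsCutSymbol c₀ η) {d : ℕ} (hR : IsHomPoly d R)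
    (t : ℝ) : Continuous fun y : R3 × (R3 × ℝ) => wavePacket ν e R η Ψ t y.2 y.1 := by
  have h1 := hη.smooth.continuous
  have h2 := hR.continuous
  have h3 := hΨ.1.continuous
  have h4 := continuous_waveParam t
  unfold wavePacket
  fun_prop

/-- A majorant independent of the sphere and interval variables, for Fubini. It may depend on t, so
the Gaussian is simply discarded. -/
lemma exists_norm_wavePacket_le {ν e c₀ : ℝ} (hν : 0 < ν) {R η : R3 → ℂ} {Ψ : WaveParam × R3 → ℂ}
    (hΨ : Function.HasTemperateGrowth Ψ) (hη : IsCutSymbol c₀ η) {d : ℕ} (hR : IsHomPoly d R) {t : ℝ}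
    (ht : 0 ≤ t) : ∃ g : R3 → ℝ, Continuous g ∧ HasCompactSupport g ∧ ∀ ξ : R3, ∀ q : R3 × ℝ,
      ‖q.1‖ = 1 → q.2 ∈ Icc (0 : ℝ) 1 → ‖wavePacket ν e R η Ψ t q ξ‖ ≤ g ξ := by
  obtain ⟨k, A, hA, hΨb⟩ := hΨ.norm_iteratedFDeriv_le_uniform 0
  have hΨb' : ∀ y, ‖Ψ y‖ ≤ A * (1 + ‖y‖) ^ k := fun y => by simpa using hΨb 0 le_rfl y
  refine ⟨fun ξ => ‖R ξ‖ * (‖η ξ‖ * ((1 + t) ^ e * (A * (2 + √(1 + t) * ‖ξ‖) ^ k))), ?_, ?_, ?_⟩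
  · have := hη.smooth.continuous
    have := hR.continuous
    fun_prop
  · exact HasCompactSupport.mul_left (HasCompactSupport.mul_right hη.hasCompactSupport.norm)
  intro ξ q h1 h2
  have h3 : (0 : ℝ) ≤ (1 + t) ^ e := by positivity
  have hΓ : Real.exp (-(ν * ‖ξ‖ ^ 2 / 2) * t) ≤ 1 :=
    Real.exp_le_one_iff.2 (by
      have : 0 ≤ ν * ‖ξ‖ ^ 2 / 2 * t := by positivity
      linarith)
  have hΨq : ‖Ψ (waveParam t q, √(1 + t) • ξ)‖ ≤ A * (2 + √(1 + t) * ‖ξ‖) ^ k := by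
    refine (hΨb' _).trans ?_
    refine mul_le_mul_of_nonneg_left (pow_le_pow_left₀ (by positivity) ?_ k) hA
    rw [Prod.norm_mk, norm_smul, Real.norm_of_nonneg (Real.sqrt_nonneg _)]
    have h3 := norm_waveParam_le ht h1 h2
    have h4 : 0 ≤ √(1 + t) * ‖ξ‖ := by positivity
    rcases max_cases ‖waveParam t q‖ (√(1 + t) * ‖ξ‖) with h | h <;> linarith [h.1]
  simp only [wavePacket, norm_mul, Complex.norm_real, Real.norm_of_nonneg h3,
    Real.norm_of_nonneg (Real.exp_pos _).le]
  gcongr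
  exact mul_le_of_le_one_right h3 hΓ

/-- With ξ = (1+t)^{-1/2}η the packet becomes a fixed Gaussian in η times a tempered family with
bounded parameters, so its transform decays uniformly. Undoing the scaling produces the power of 1 +
t. -/
lemma exists_norm_invFourier_wavePacket_le {ν e c₀ : ℝ} (hν : 0 < ν) {R η : R3 → ℂ}
    {Ψ : WaveParam × R3 → ℂ} (hΨ : Function.HasTemperateGrowth Ψ) (hη : IsCutSymbol c₀ η) {d : ℕ}
    (hR : IsHomPoly d R) : ∃ C : ℝ, 0 < C ∧ ∀ t, 0 ≤ t → ∀ q : R3 × ℝ, ‖q.1‖ = 1 →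
      q.2 ∈ Icc (0 : ℝ) 1 → ∀ y : R3, ‖invFourier (wavePacket ν e R η Ψ t q) y‖ ≤
        C * (1 + t) ^ (e - d / 2 - 3 / 2) * ((1 + ‖y‖ / √(1 + t)) ^ 4)⁻¹ := by
  -- The scaled Gaussian e^{-ν|η|²/2} equals e^{-ν|ξ|²(1+t)/2}, one unit of time too many. The
  -- excess e^{ν|ξ|²/2} is put into the compactly supported cut-off, where it is harmless; this also
  -- avoids any degeneration at t = 0.
  set ηe : R3 → ℂ := fun ξ => η ξ * (Real.exp (ν / 2 * ‖ξ‖ ^ 2) : ℂ) with hηe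
  have hηet : Function.HasTemperateGrowth ηe := by
    refine HasCompactSupport.hasTemperateGrowth hη.hasCompactSupport.mul_right ?_
    have : ContDiff ℝ (⊤ : ℕ∞) fun η : R3 => Real.exp (ν / 2 * ‖η‖ ^ 2) :=
      Real.contDiff_exp.comp (contDiff_const.mul (contDiff_norm_sq ℝ))
    exact hη.smooth.mul (Complex.ofRealCLM.contDiff.comp this)
  have hΨ' : Function.HasTemperateGrowth fun y : WaveParam × R3 =>
      R y.2 * (ηe (y.1.1 • y.2) * Ψ y) := by
    have h1 : Function.HasTemperateGrowth fun y : WaveParam × R3 => y.1.1 :=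
      ((ContinuousLinearMap.fst ℝ ℝ _).comp (ContinuousLinearMap.fst ℝ WaveParam R3)).hasTemperateGrowth
    have h2 : Function.HasTemperateGrowth fun y : WaveParam × R3 => y.2 :=
      (ContinuousLinearMap.snd ℝ WaveParam R3).hasTemperateGrowth
    exact (hR.hasTemperateGrowth.comp h2).mul ((hηet.comp (h1.smul h2)).mul hΨ)
  obtain ⟨C, hC, hdecay⟩ := exists_norm_invFourier_gaussian_mul_le hΨ' (c := ν / 2) (by positivity)
  refine ⟨C, hC, fun t ht q h1 h2 y => ?_⟩
  have hT : 0 < 1 + t := by linarith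
  have hsT : 0 < √(1 + t) := Real.sqrt_pos.2 hT
  obtain ⟨ε, hε⟩ : ∃ ε, ε = (√(1 + t))⁻¹ := ⟨_, rfl⟩
  have hε0 : 0 < ε := hε ▸ inv_pos.2 hsT
  have hε2 : ε ^ 2 * (1 + t) = 1 := by
    rw [hε, inv_pow, Real.sq_sqrt hT.le, inv_mul_cancel₀ hT.ne']
  have hp1 : (waveParam t q).1 = ε := hε.symm
  have e1 : (fun η' : R3 => wavePacket ν e R η Ψ t q (ε • η')) =
      fun η' => (((ε ^ d * (1 + t) ^ e : ℝ)) : ℂ) *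
      ((Real.exp (-(ν / 2) * ‖η'‖ ^ 2) : ℂ) * (R η' * (ηe ((waveParam t q).1 • η') *
        Ψ (waveParam t q, η')))) := by
    funext η'
    have e2 : √(1 + t) • ε • η' = η' := by
      rw [smul_smul, hε, mul_inv_cancel₀ hsT.ne', one_smul]
    have e3 : Real.exp (-(ν / 2) * ‖η'‖ ^ 2) * Real.exp (ν / 2 * ‖ε • η'‖ ^ 2) =
        Real.exp (-(ν * ‖ε • η'‖ ^ 2 / 2) * t) := by
      rw [← Real.exp_add]
      congr 1
      rw [norm_smul, Real.norm_of_nonneg hε0.le]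
      linear_combination (ν / 2 * ‖η'‖ ^ 2) * hε2
    have e3' : (Real.exp (-(ν / 2) * ‖η'‖ ^ 2) : ℂ) * (Real.exp (ν / 2 * ‖ε • η'‖ ^ 2) : ℂ) =
        (Real.exp (-(ν * ‖ε • η'‖ ^ 2 / 2) * t) : ℂ) := by exact_mod_cast e3
    simp only [wavePacket, hηe, hR.smul_apply, e2, hp1]
    rw [← e3']
    push_cast
    ring
  rw [invFourier_scale hε0, e1, invFourier_const_mul, norm_mul, norm_mul, Complex.norm_real,
    Complex.norm_real, Real.norm_of_nonneg (by positivity), Real.norm_of_nonneg (by positivity)]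
  have h3 := hdecay (waveParam t q) (norm_waveParam_le ht h1 h2) (ε • y)
  rw [norm_smul, Real.norm_of_nonneg hε0.le] at h3
  have h4 : ε * ‖y‖ = ‖y‖ / √(1 + t) := by rw [hε, div_eq_inv_mul]
  rw [h4] at h3
  -- One factor ε³ is the Jacobian, ε^d is the homogeneity of R.
  have e5 : ε ^ 3 * (ε ^ d * (1 + t) ^ e) = (1 + t) ^ (e - d / 2 - 3 / 2) := by
    have : ε = (1 + t) ^ (-(1 / 2) : ℝ) := by
      rw [hε, Real.sqrt_eq_rpow, Real.rpow_neg hT.le]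
    rw [this, ← Real.rpow_natCast, ← Real.rpow_natCast, ← Real.rpow_mul hT.le,
      ← Real.rpow_mul hT.le, ← Real.rpow_add hT, ← Real.rpow_add hT]
    congr 1
    push_cast
    ring
  rw [← mul_assoc, e5, mul_comm C, mul_assoc]
  exact mul_le_mul_of_nonneg_left h3 (by positivity)

section

variable {ν β c₀ e : ℝ} {S : ℝ → R3 → ℂ} {R η : R3 → ℂ} {Ψ : WaveParam × R3 → ℂ} {d : ℕ}

lemma mul_waveSymbol_eq (hη : IsCutSymbol c₀ η) {t : ℝ} {ξ : R3}
    (h : ‖ξ‖ < c₀ → S t ξ = (((1 + t) ^ e : ℝ) : ℂ) * (Real.exp (-(ν * ‖ξ‖ ^ 2 / 2) * t) : ℂ) *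
      ∫ q, Complex.exp (Complex.I * ((inner ℝ ((β * t) • q.1) ξ : ℝ) : ℂ)) *
        Ψ (waveParam t q, √(1 + t) • ξ) ∂waveMeasure) :
    R ξ * (η ξ * S t ξ) = ∫ q, Complex.exp (Complex.I * ((inner ℝ ((β * t) • q.1) ξ : ℝ) : ℂ)) *
      wavePacket ν e R η Ψ t q ξ ∂waveMeasure := by
  by_cases hξ : ‖ξ‖ < c₀
  · rw [h hξ, ← mul_assoc, ← mul_assoc, ← integral_const_mul]
    refine integral_congr_ae (Filter.Eventually.of_forall fun q => ?_)
    simp only [wavePacket]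
    ring
  · simp [wavePacket, hη.eq_zero ξ (not_lt.1 hξ)]

lemma isBddSymbol_mul_waveSymbol (hν : 0 < ν) (hS : IsWaveSymbol ν β c₀ e S)
    (hη : IsCutSymbol c₀ η) (hR : IsHomPoly d R) {t : ℝ} (ht : 0 ≤ t) :
    IsBddSymbol fun ξ => R ξ * (η ξ * S t ξ) := by
  obtain ⟨Ψ, hΨ, hrep⟩ := hS.exists_rep
  obtain ⟨g, hgc, hgs, hg⟩ := exists_norm_wavePacket_le (e := e) hν hΨ hη hR ht
  refine ⟨hR.continuous.aestronglyMeasurable.mul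
    (hη.smooth.continuous.aestronglyMeasurable.mul (hS.aesm t)), ?_, c₀, fun ξ hξ => by
      simp [hη.eq_zero ξ hξ]⟩
  obtain ⟨D, hD⟩ := hgc.bounded_above_of_compact_support hgs
  -- The plane wave representation is only available for ξ ≠ 0, so the value at the origin is
  -- included by hand.
  refine ⟨max D ‖R 0 * (η 0 * S t 0)‖, fun ξ => ?_⟩
  by_cases hξ : ξ = 0
  · rw [hξ]; exact le_max_right _ _
  · refine le_trans ?_ (le_max_left _ _)
    rw [mul_waveSymbol_eq hη (hrep t ht ξ hξ)]
    have := norm_integral_le_of_norm_le_const (μ := waveMeasure) (C := g ξ) (f := fun q =>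
      Complex.exp (Complex.I * ((inner ℝ ((β * t) • q.1) ξ : ℝ) : ℂ)) *
        wavePacket ν e R η Ψ t q ξ) (by
        filter_upwards [ae_waveMeasure] with q hq
        rw [norm_mul, norm_exp_I_mul_ofReal_eq_one, one_mul]
        exact hg ξ q hq.1 hq.2)
    rw [probReal_univ, mul_one] at this
    exact this.trans ((le_abs_self _).trans (hD ξ))

/-- Fubini exchanges the frequency integral with the superposition, and the modulation e^{iβtω·ξ}
becomes a translation by βtω. The excluded point ξ = 0 is a null set. -/
lemma invFourier_mul_waveSymbol_eq (hν : 0 < ν) (hη : IsCutSymbol c₀ η) (hR : IsHomPoly d R)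
    (hΨ : Function.HasTemperateGrowth Ψ) {t : ℝ} (ht : 0 ≤ t)
    (h : ∀ ξ : R3, ξ ≠ 0 → ‖ξ‖ < c₀ → S t ξ = (((1 + t) ^ e : ℝ) : ℂ) *
      (Real.exp (-(ν * ‖ξ‖ ^ 2 / 2) * t) : ℂ) *
      ∫ q, Complex.exp (Complex.I * ((inner ℝ ((β * t) • q.1) ξ : ℝ) : ℂ)) *
        Ψ (waveParam t q, √(1 + t) • ξ) ∂waveMeasure) (x : R3) :
    invFourier (fun ξ => R ξ * (η ξ * S t ξ)) x =
      ∫ q, invFourier (wavePacket ν e R η Ψ t q) (x + (β * t) • q.1) ∂waveMeasure := by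
  obtain ⟨g, hgc, hgs, hg⟩ := exists_norm_wavePacket_le (e := e) hν hΨ hη hR ht
  have hint : Integrable (fun y : R3 × (R3 × ℝ) =>
      Complex.exp (Complex.I * ((inner ℝ x y.1 : ℝ) : ℂ)) *
      (Complex.exp (Complex.I * ((inner ℝ ((β * t) • y.2.1) y.1 : ℝ) : ℂ)) *
        wavePacket ν e R η Ψ t y.2 y.1)) (volume.prod waveMeasure) := by
    refine ((hgc.integrable_of_hasCompactSupport hgs).comp_fst waveMeasure).mono' ?_ ?_
    · have := continuous_wavePacket (ν := ν) (e := e) hΨ hη hR t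
      exact Continuous.aestronglyMeasurable (by fun_prop)
    · have : ∀ᵐ y ∂((volume : Measure R3).prod waveMeasure), ‖y.2.1‖ = 1 ∧ y.2.2 ∈ Icc (0 : ℝ) 1 :=
        Measure.quasiMeasurePreserving_snd.ae ae_waveMeasure
      filter_upwards [this] with y hy
      rw [norm_mul, norm_mul, norm_exp_I_mul_ofReal_eq_one, norm_exp_I_mul_ofReal_eq_one, one_mul,
        one_mul]
      exact hg y.1 y.2 hy.1 hy.2
  have hne : ∀ᵐ ξ : R3, ξ ≠ 0 := by
    simpa using measure_eq_zero_iff_ae_notMem.1 (measure_singleton (0 : R3))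
  rw [invFourier_congr_ae (n := fun ξ => ∫ q, Complex.exp (Complex.I *
    ((inner ℝ ((β * t) • q.1) ξ : ℝ) : ℂ)) * wavePacket ν e R η Ψ t q ξ ∂waveMeasure)
    (hne.mono fun ξ hξ => mul_waveSymbol_eq hη (h ξ hξ))]
  simp only [← invFourier_translate]
  simp only [invFourier_apply]
  rw [integral_const_mul, ← integral_integral_swap hint]
  congr 1
  refine integral_congr_ae (Filter.Eventually.of_forall fun ξ => ?_)
  simp only
  rw [integral_const_mul]

end

lemma norm_integral_waveMeasure_le {F : R3 × ℝ → ℂ} {β t K : ℝ} {x : R3} 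
    (h : ∀ q : R3 × ℝ, ‖q.1‖ = 1 → q.2 ∈ Icc (0 : ℝ) 1 →
      ‖F q‖ ≤ K * ((1 + ‖x + (β * t) • q.1‖ / √(1 + t)) ^ 4)⁻¹) :
    ‖∫ q, F q ∂waveMeasure‖ ≤ K * waveProfile β t x := by
  have hcw : Continuous fun q : R3 × ℝ => ((1 + ‖x + (β * t) • q.1‖ / √(1 + t)) ^ 4)⁻¹ :=
    Continuous.inv₀ (by fun_prop) fun q => by positivity
  have e1 : ∫ q, K * ((1 + ‖x + (β * t) • q.1‖ / √(1 + t)) ^ 4)⁻¹ ∂waveMeasure =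
      K * waveProfile β t x := by
    rw [integral_const_mul, waveProfile]
    exact congrArg _ (integral_waveMeasure_fst fun ω : R3 =>
      ((1 + ‖x + (β * t) • ω‖ / √(1 + t)) ^ 4)⁻¹)
  rw [← e1]
  refine norm_integral_le_of_norm_le ?_ ?_
  · refine Integrable.const_mul ?_ _
    refine Integrable.of_bound (C := 1)
      hcw.aestronglyMeasurable (Filter.Eventually.of_forall fun q => ?_)
    have : 0 ≤ ‖x + (β * t) • q.1‖ / √(1 + t) := by positivity
    rw [Real.norm_of_nonneg (by positivity)]
    exact inv_le_one_of_one_le₀ (one_le_pow₀ (by linarith))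
  · filter_upwards [ae_waveMeasure] with q hq
    exact h q hq.1 hq.2

lemma exists_norm_invFourier_waveSymbol_le {ν β c₀ e : ℝ} {S : ℝ → R3 → ℂ} {R η : R3 → ℂ} {d : ℕ}
    (hν : 0 < ν) (hS : IsWaveSymbol ν β c₀ e S)
    (hη : IsCutSymbol c₀ η) (hR : IsHomPoly d R) :
    ∃ C : ℝ, 0 < C ∧ ∀ t, 0 ≤ t → ∀ x, ‖invFourier (fun ξ => R ξ * (η ξ * S t ξ)) x‖ ≤
      C * (1 + t) ^ (e - d / 2 - 3 / 2) * waveProfile β t x := by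
  obtain ⟨Ψ, hΨ, hrep⟩ := hS.exists_rep
  obtain ⟨C, hC, hscale⟩ := exists_norm_invFourier_wavePacket_le (e := e) hν hΨ hη hR
  refine ⟨C, hC, fun t ht x => ?_⟩
  have h1 := invFourier_mul_waveSymbol_eq (S := S) (e := e) hν hη hR hΨ ht (hrep t ht) x
  rw [h1]
  exact norm_integral_waveMeasure_le fun q h1 h2 => hscale t ht q h1 h2 _

/-- The pointwise bound carries (1+t)^{e-d/2-3/2}. The mass (1+t)^{3/2} of the profile restores e -
d/2 in L¹, and its supremum (1+t)^{-1} gives e - d/2 - 5/2. -/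
lemma hasKernelBound_invFourier {ν β c₀ e : ℝ} (hν : 0 < ν) (hβ : 0 < β) {S : ℝ → R3 → ℂ}
    (hS : IsWaveSymbol ν β c₀ e S) {η : R3 → ℂ} (hη : IsCutSymbol c₀ η) {d : ℕ} {R : R3 → ℂ}
    (hR : IsHomPoly d R) :
    HasKernelBound (e - d / 2) fun t => invFourier fun ξ => R ξ * (η ξ * S t ξ) := by
  have hb := fun t ht => isBddSymbol_mul_waveSymbol hν hS hη hR (t := t) ht
  obtain ⟨C, hC, h⟩ := exists_norm_invFourier_waveSymbol_le hν hS hη hR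
  obtain ⟨D, hD, hprof⟩ := exists_waveProfile_le hβ
  set J : ℝ := ∫ x : R3, ((1 + ‖x‖) ^ 4)⁻¹
  have hJ0 : 0 ≤ J := integral_nonneg fun x => by positivity
  refine ⟨C * (D + J), by positivity, fun t ht => ?_⟩
  have hT : 0 < 1 + t := by linarith
  have hp := integral_waveProfile β ht
  have hi := hp.1.const_mul (C * (1 + t) ^ (e - d / 2 - 3 / 2))
  have hI : Integrable (invFourier fun ξ => R ξ * (η ξ * S t ξ)) :=
    hi.mono' (continuous_invFourier (hb t ht)).aestronglyMeasurable
      (Filter.Eventually.of_forall (h t ht))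
  refine ⟨hI, ?_, fun x => ?_⟩
  · calc _ ≤ ∫ x, C * (1 + t) ^ (e - d / 2 - 3 / 2) * waveProfile β t x :=
          integral_mono hI.norm hi (h t ht)
      _ = C * J * ((1 + t) ^ (e - d / 2 - 3 / 2) * (1 + t) ^ (3 / 2 : ℝ)) := by
          rw [integral_const_mul, hp.2]; ring
      _ = C * J * (1 + t) ^ (e - d / 2) := by
          rw [← Real.rpow_add hT]; congr 2; ring
      _ ≤ _ := by gcongr; linarith
  · calc _ ≤ C * (1 + t) ^ (e - d / 2 - 3 / 2) * (D * (1 + t)⁻¹) := by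
          refine (h t ht x).trans ?_
          gcongr
          exact hprof t ht x
      _ = C * D * ((1 + t) ^ (e - d / 2 - 3 / 2) * (1 + t) ^ (-1 : ℝ)) := by
          rw [Real.rpow_neg_one]; ring
      _ = C * D * (1 + t) ^ (e - d / 2 - 5 / 2) := by
          rw [← Real.rpow_add hT]; congr 2; ring
      _ ≤ _ := by gcongr; linarith

/-! ### The phase correction φ = 1 + |ξ|²h -/

section PhaseCorrection

variable {ν β c₀ : ℝ}

lemma phi_arg_pos (hν : 0 < ν) (hβ : 0 < β) {ξ : R3} (h : ‖ξ‖ < 2 * β / ν) :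
    0 < 1 - ν ^ 2 * ‖ξ‖ ^ 2 / (4 * β ^ 2) := by
  rw [lt_div_iff₀ hν] at h
  rw [sub_pos, div_lt_one (by positivity)]
  have : 0 ≤ ‖ξ‖ * ν := by positivity
  nlinarith

lemma phi_pos (hν : 0 < ν) (hβ : 0 < β) {ξ : R3} (h : ‖ξ‖ < 2 * β / ν) : 0 < phi ν β ξ :=
  Real.sqrt_pos.2 (phi_arg_pos hν hβ h)

lemma sq_phi (hν : 0 < ν) (hβ : 0 < β) {ξ : R3} (h : ‖ξ‖ < 2 * β / ν) :
    phi ν β ξ ^ 2 = 1 - ν ^ 2 * ‖ξ‖ ^ 2 / (4 * β ^ 2) :=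
  Real.sq_sqrt (phi_arg_pos hν hβ h).le

lemma contDiffAt_phi (hν : 0 < ν) (hβ : 0 < β) {ξ : R3} (h : ‖ξ‖ < 2 * β / ν) :
    ContDiffAt ℝ (⊤ : ℕ∞) (phi ν β) ξ := by
  refine ContDiffAt.sqrt ?_ (phi_arg_pos hν hβ h).ne'
  have : ContDiff ℝ (⊤ : ℕ∞) fun ξ : R3 => ‖ξ‖ ^ 2 := contDiff_norm_sq ℝ
  exact (contDiff_const.sub ((contDiff_const.mul this).div_const _)).contDiffAt

/-- Rationalizing, φ - 1 = (φ² - 1)/(φ + 1) and φ² - 1 = -ν²|ξ|²/(4β²). The quotient is smooth while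
φ > 0, that is below the threshold. -/
lemma exists_phi_eq (hν : 0 < ν) (hβ : 0 < β) (hc₀ : 0 < c₀) (hc : c₀ < 2 * β / ν) :
    ∃ h : R3 → ℝ, Function.HasTemperateGrowth h ∧
      ∀ ξ, ‖ξ‖ < c₀ → phi ν β ξ = 1 + ‖ξ‖ ^ 2 * h ξ := by
  obtain ⟨c₁, h1, h2⟩ := exists_between hc
  -- The bump is one on the ball of radius c₀ and supported in radius c₁ < 2β/ν, so the cut-off h is
  -- smooth with compact support on all of space, hence tempered.
  let bump : ContDiffBump (0 : R3) := ⟨c₀, c₁, hc₀, h1⟩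
  refine ⟨fun ξ => bump ξ * (-(ν ^ 2 / (4 * β ^ 2)) / (1 + phi ν β ξ)), ?_, ?_⟩
  · refine HasCompactSupport.hasTemperateGrowth bump.hasCompactSupport.mul_right ?_
    rw [contDiff_iff_contDiffAt]
    intro ξ
    by_cases hξ : ‖ξ‖ < 2 * β / ν
    · exact bump.contDiff.contDiffAt.mul (contDiffAt_const.div
        (contDiffAt_const.add (contDiffAt_phi hν hβ hξ))
        (by have := phi_pos hν hβ hξ; positivity))
    · have h3 : ξ ∉ tsupport bump := by
        rw [bump.tsupport_eq]
        simp only [Metric.mem_closedBall, dist_zero_right]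
        change ¬ ‖ξ‖ ≤ c₁
        linarith
      have h4 := notMem_tsupport_iff_eventuallyEq.1 h3
      refine (contDiffAt_const (c := (0 : ℝ))).congr_of_eventuallyEq ?_
      filter_upwards [h4] with η hη
      simp [hη]
  · intro ξ hξ
    have hp := phi_pos hν hβ (hξ.trans hc)
    have hs := sq_phi hν hβ (hξ.trans hc)
    have hb : bump ξ = 1 := bump.one_of_mem_closedBall (by
      simp only [Metric.mem_closedBall, dist_zero_right]; exact hξ.le)
    simp only [hb, one_mul]
    have h0 : 1 + phi ν β ξ ≠ 0 := by positivity
    rw [← mul_div_assoc, ← sub_eq_iff_eq_add', eq_div_iff h0]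
    linear_combination hs

end PhaseCorrection

/-! ### Superpositions of exponentials and scaled coordinates -/

lemma integrable_waveMeasure_of_continuous {F : R3 × ℝ → ℂ} (hF : Continuous F) :
    Integrable F waveMeasure := by
  obtain ⟨C, hC⟩ := ((isCompact_sphere (0 : R3) 1).prod (isCompact_Icc (a := (0 : ℝ)) (b := 1))).exists_bound_of_continuousOn
    hF.continuousOn
  refine Integrable.of_bound (C := C) hF.aestronglyMeasurable ?_
  filter_upwards [ae_waveMeasure] with q hq
  exact hC q ⟨by simpa using hq.1, hq.2⟩

lemma integral_waveMeasure_of_fst (F : R3 → ℂ) :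
    ∫ q, F q.1 ∂waveMeasure = ∫ ω, F ω ∂sphereMeasure := by
  rw [waveMeasure, integral_fun_fst, probReal_univ, one_smul]

/-- The fundamental theorem of calculus in z. It extracts the factor iy, which carries |ξ|², and
leaves a superposition of exponentials without singularity. -/
lemma integral_Icc_mul_exp (y : ℝ) :
    ∫ z in Icc (0 : ℝ) 1, Complex.I * y * Complex.exp (Complex.I * ((z * y : ℝ) : ℂ)) =
      Complex.exp (Complex.I * y) - 1 := by
  rw [integral_Icc_eq_integral_Ioc, ← intervalIntegral.integral_of_le zero_le_one]
  have h : ∀ z ∈ uIcc (0 : ℝ) 1, HasDerivAt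
      (fun z : ℝ => Complex.exp (Complex.I * ((z * y : ℝ) : ℂ)))
      (Complex.I * y * Complex.exp (Complex.I * ((z * y : ℝ) : ℂ))) z := by
    intro z _
    have h1 : HasDerivAt (fun z : ℝ => ((z * y : ℝ) : ℂ)) ((1 * y : ℝ) : ℂ) z :=
      ((hasDerivAt_id z).mul_const y).ofReal_comp
    exact ((h1.const_mul Complex.I).cexp).congr_deriv (by push_cast; ring)
  rw [intervalIntegral.integral_eq_sub_of_hasDerivAt h
    (Continuous.intervalIntegrable (by fun_prop) _ _)]
  simp

/-- Integration over `z` undoes the factorization `e^{iy} - 1 = iy ∫ e^{izy} dz`. -/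
lemma integral_waveMeasure_mul_exp {F : R3 → ℂ} (hF : Continuous F) {y : R3 → ℝ}
    (hy : Continuous y) :
    ∫ q, F q.1 * (Complex.I * y q.1 * Complex.exp (Complex.I * ((q.2 * y q.1 : ℝ) : ℂ)))
      ∂waveMeasure = ∫ ω, F ω * (Complex.exp (Complex.I * y ω) - 1) ∂sphereMeasure := by
  have hi := integrable_waveMeasure_of_continuous (F := fun q : R3 × ℝ => F q.1 *
    (Complex.I * y q.1 * Complex.exp (Complex.I * ((q.2 * y q.1 : ℝ) : ℂ)))) (by fun_prop)
  unfold waveMeasure at hi ⊢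
  rw [integral_prod _ hi]
  simp only [integral_const_mul _, ← integral_Icc_mul_exp]

/-- Every derivative of e^{ix} has modulus one on the real line. -/
lemma hasTemperateGrowth_exp_I :
    Function.HasTemperateGrowth fun x : ℝ => Complex.exp (Complex.I * x) := by
  have h : ∀ n : ℕ, iteratedDeriv n (fun x : ℝ => Complex.exp (Complex.I * x)) =
      fun x : ℝ => Complex.I ^ n * Complex.exp (Complex.I * x) := by
    intro n
    induction n with
    | zero => simp
    | succ n ih =>
      rw [iteratedDeriv_succ, ih]
      funext x
      have h1 : HasDerivAt (fun x : ℝ => ((x : ℝ) : ℂ)) ((1 : ℝ) : ℂ) x :=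
        (hasDerivAt_id x).ofReal_comp
      refine HasDerivAt.deriv (((h1.const_mul Complex.I).cexp.const_mul (Complex.I ^ n)).congr_deriv ?_)
      push_cast; ring
  refine ⟨Complex.contDiff_exp.comp (contDiff_const.mul Complex.ofRealCLM.contDiff), fun n =>
    ⟨0, 1, fun x => ?_⟩⟩
  rw [norm_iteratedFDeriv_eq_norm_iteratedDeriv, h]
  simp [mul_comm Complex.I, Complex.norm_exp_ofReal_mul_I]


section WaveParam

/-- The coordinates `ε = (1 + t)^{-1/2}` and `a = t / (1 + t)`, `z`, the phase `ω ⋅ η`, `|η|²` and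
`h(ε η)`, have temperate growth in the wave parameters and the scaled frequency `η`. -/
lemma hasTemperateGrowth_coords {h : R3 → ℝ} (hh : Function.HasTemperateGrowth h) :
    Function.HasTemperateGrowth (fun y : WaveParam × R3 => y.1.1) ∧
    Function.HasTemperateGrowth (fun y : WaveParam × R3 => y.1.2.1) ∧
    Function.HasTemperateGrowth (fun y : WaveParam × R3 => y.1.2.2.1) ∧
    Function.HasTemperateGrowth (fun y : WaveParam × R3 => (inner ℝ y.1.2.2.2 y.2 : ℝ)) ∧
    Function.HasTemperateGrowth (fun y : WaveParam × R3 => ‖y.2‖ ^ 2) ∧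
    Function.HasTemperateGrowth (fun y : WaveParam × R3 => h (y.1.1 • y.2)) := by
  have h1 : Function.HasTemperateGrowth (fun y : WaveParam × R3 => y.1) :=
    (ContinuousLinearMap.fst ℝ WaveParam R3).hasTemperateGrowth
  have h2 : Function.HasTemperateGrowth (fun y : WaveParam × R3 => y.2) :=
    (ContinuousLinearMap.snd ℝ WaveParam R3).hasTemperateGrowth
  have h3 : Function.HasTemperateGrowth (fun y : WaveParam × R3 => y.1.1) :=
    (ContinuousLinearMap.fst ℝ ℝ (ℝ × ℝ × R3)).hasTemperateGrowth.comp h1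
  have h4 : Function.HasTemperateGrowth (fun y : WaveParam × R3 => y.1.2) :=
    (ContinuousLinearMap.snd ℝ ℝ (ℝ × ℝ × R3)).hasTemperateGrowth.comp h1
  have h5 : Function.HasTemperateGrowth (fun y : WaveParam × R3 => y.1.2.2) :=
    (ContinuousLinearMap.snd ℝ ℝ (ℝ × R3)).hasTemperateGrowth.comp h4
  refine ⟨h3, (ContinuousLinearMap.fst ℝ ℝ (ℝ × R3)).hasTemperateGrowth.comp h4,
    (ContinuousLinearMap.fst ℝ ℝ R3).hasTemperateGrowth.comp h5, ?_,
    (Function.hasTemperateGrowth_norm_sq R3).comp h2, hh.comp (h3.smul h2)⟩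
  exact (innerSL ℝ (E := R3)).bilinear_hasTemperateGrowth
    ((ContinuousLinearMap.snd ℝ ℝ R3).hasTemperateGrowth.comp h5) h2

/-- The phase correction `y = β t |ξ|² h(ξ) ω ⋅ ξ` in scaled variables. -/
def wavePhase (β : ℝ) (h : R3 → ℝ) (y : WaveParam × R3) : ℝ :=
  β * (y.1.2.1 * (y.1.1 * (‖y.2‖ ^ 2 * (h (y.1.1 • y.2) * inner ℝ y.1.2.2.2 y.2))))

lemma hasTemperateGrowth_wavePhase (β : ℝ) {h : R3 → ℝ} (hh : Function.HasTemperateGrowth h) :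
    Function.HasTemperateGrowth (wavePhase β h) := by
  obtain ⟨hε, ha, -, hw, hn, hH⟩ := hasTemperateGrowth_coords hh
  exact (Function.HasTemperateGrowth.const β).mul (ha.mul (hε.mul (hn.mul (hH.mul hw))))

variable {t : ℝ} (q : R3 × ℝ) (ξ : R3)

lemma inv_sqrt_smul_sqrt_smul (ht : 0 ≤ t) : (√(1 + t))⁻¹ • √(1 + t) • ξ = ξ := by
  have : √(1 + t) ≠ 0 := (Real.sqrt_pos.2 (by linarith)).ne'
  rw [smul_smul, inv_mul_cancel₀ this, one_smul]

/-- The powers of 1 + t match: t/(1+t) and (1+t)^{-1/2} from the parameters, 1 + t from |η|² and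
(1+t)^{1/2} from ω·η multiply to t. -/
lemma wavePhase_waveParam (β : ℝ) (h : R3 → ℝ) (ht : 0 ≤ t) :
    wavePhase β h (waveParam t q, √(1 + t) • ξ) =
      β * t * (‖ξ‖ ^ 2 * h ξ) * inner ℝ q.1 ξ := by
  have h0 : 0 < √(1 + t) := Real.sqrt_pos.2 (by linarith)
  have h1 : √(1 + t) ^ 2 = 1 + t := Real.sq_sqrt (by linarith)
  have h2 : 1 + t ≠ 0 := by linarith
  simp only [wavePhase, waveParam, inv_sqrt_smul_sqrt_smul ξ ht, norm_smul,
    Real.norm_of_nonneg h0.le, inner_smul_right]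
  rw [mul_pow, h1]
  field_simp

end WaveParam

/-! ### Plane wave representations of the symbols -/

/-- Spherical means with corrected phase. -/
lemma cexp_add_phase (β t h : ℝ) (ω ξ : R3) :
    Complex.exp (Complex.I * ((inner ℝ ω ((β * t * (1 + h)) • ξ) : ℝ) : ℂ)) =
    Complex.exp (Complex.I * ((inner ℝ ((β * t) • ω) ξ : ℝ) : ℂ)) *
      Complex.exp (Complex.I * ((β * t * h * inner ℝ ω ξ : ℝ) : ℂ)) := by
  rw [← Complex.exp_add, inner_smul_right, inner_smul_left]
  congr 1
  simp only [conj_trivial]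
  push_cast
  ring

/-- `e^{-ν|ξ|²t/2} t sinc(β|ξ|φ(ξ)t)`, which equals `𝒦₁` where `0 < |ξ| < 2β/ν`. -/
def waveSin (ν β t : ℝ) (ξ : R3) : ℂ :=
  ((Real.exp (-(ν * ‖ξ‖ ^ 2 / 2) * t) * (t * Real.sinc (t * β * ‖ξ‖ * phi ν β ξ)) : ℝ) : ℂ)

lemma mul_sinc_eq_div (t w : ℝ) (hw : w ≠ 0) : t * Real.sinc (t * w) = Real.sin (w * t) / w := by
  by_cases ht : t = 0
  · simp [ht]
  · rw [Real.sinc_of_ne_zero (mul_ne_zero ht hw), mul_comm w t]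
    field_simp

lemma symbolG1_eq {ν β : ℝ} (hβ : 0 < β) (t : ℝ) {ξ : R3} (hξ : ξ ≠ 0) : symbolG1 ν β t ξ =
    ((Real.exp (-(ν * ‖ξ‖ ^ 2 / 2) * t) * (t * Real.sinc (t * (β * ‖ξ‖))) : ℝ) : ℂ) := by
  rw [symbolG1, mul_sinc_eq_div _ _ (mul_ne_zero hβ.ne' (norm_ne_zero_iff.2 hξ))]

/-- Below the threshold the discriminant is -(2β|ξ|φ)², a negative real, and its principal root lies
on the positive imaginary axis. -/
lemma rootDisc_eq {ν β : ℝ} (hν : 0 < ν) (hβ : 0 < β) {ξ : R3} (h : ‖ξ‖ < 2 * β / ν) (h0 : ξ ≠ 0) :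
    rootDisc ν β ξ = Complex.I * ((2 * (β * ‖ξ‖ * phi ν β ξ) : ℝ) : ℂ) := by
  have hp := phi_pos hν hβ h
  have hn : 0 < ‖ξ‖ := norm_pos_iff.2 h0
  have hw : 0 < 2 * (β * ‖ξ‖ * phi ν β ξ) := by positivity
  have harg : (Complex.I * ((2 * (β * ‖ξ‖ * phi ν β ξ) : ℝ) : ℂ)).arg = Real.pi / 2 := by
    rw [mul_comm, Complex.arg_real_mul _ hw, Complex.arg_I]
  have h2 : (((ν ^ 2 * ‖ξ‖ ^ 4 - 4 * β ^ 2 * ‖ξ‖ ^ 2 : ℝ)) : ℂ) =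
      (Complex.I * ((2 * (β * ‖ξ‖ * phi ν β ξ) : ℝ) : ℂ)) ^ 2 := by
    rw [mul_pow, Complex.I_sq]
    have h3 : (2 * (β * ‖ξ‖ * phi ν β ξ)) ^ 2 = 4 * β ^ 2 * ‖ξ‖ ^ 2 - ν ^ 2 * ‖ξ‖ ^ 4 := by
      have := sq_phi hν hβ h
      rw [mul_pow, mul_pow, this]
      field_simp
      ring
    rw [← Complex.ofReal_pow, h3]
    push_cast
    ring
  -- The principal square root inverts squaring for arguments in (-π/2, π/2]; here the argument is
  -- the included endpoint.
  have h4 := Complex.pow_cpow_nat_inv (x := Complex.I * ((2 * (β * ‖ξ‖ * phi ν β ξ) : ℝ) : ℂ))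
    (n := 2) two_ne_zero (by rw [harg]; push_cast; linarith [Real.pi_pos]) (by rw [harg]; norm_num)
  rw [rootDisc, h2]
  rw [one_div]
  exact_mod_cast h4

lemma symbolK1_eq {ν β : ℝ} (hν : 0 < ν) (hβ : 0 < β) (t : ℝ) {ξ : R3} (h : ‖ξ‖ < 2 * β / ν)
    (h0 : ξ ≠ 0) : symbolK1 ν β t ξ = waveSin ν β t ξ := by
  have hp := phi_pos hν hβ h
  have hn : 0 < ‖ξ‖ := norm_pos_iff.2 h0
  obtain ⟨w, hw⟩ : ∃ w, w = β * ‖ξ‖ * phi ν β ξ := ⟨_, rfl⟩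
  have hw0 : 0 < w := by rw [hw]; positivity
  have e1 : t * β * ‖ξ‖ * phi ν β ξ = t * w := by rw [hw]; ring
  rw [waveSin, e1, mul_sinc_eq_div _ _ hw0.ne', symbolK1, sigmaPlus, sigmaMinus,
    rootDisc_eq hν hβ h h0, ← hw]
  have e2 : (-((ν * ‖ξ‖ ^ 2 : ℝ) : ℂ) + Complex.I * ((2 * w : ℝ) : ℂ)) / 2 * t =
      ((-(ν * ‖ξ‖ ^ 2 / 2) * t : ℝ) : ℂ) + ((w * t : ℝ) : ℂ) * Complex.I := by push_cast; ring
  have e3 : (-((ν * ‖ξ‖ ^ 2 : ℝ) : ℂ) - Complex.I * ((2 * w : ℝ) : ℂ)) / 2 * t =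
      ((-(ν * ‖ξ‖ ^ 2 / 2) * t : ℝ) : ℂ) + -((w * t : ℝ) : ℂ) * Complex.I := by push_cast; ring
  have e4 : (-((ν * ‖ξ‖ ^ 2 : ℝ) : ℂ) + Complex.I * ((2 * w : ℝ) : ℂ)) / 2 -
      (-((ν * ‖ξ‖ ^ 2 : ℝ) : ℂ) - Complex.I * ((2 * w : ℝ) : ℂ)) / 2 = 2 * w * Complex.I := by
    push_cast; ring
  rw [e2, e3, e4, Complex.exp_add, Complex.exp_add, Complex.exp_mul_I, Complex.exp_mul_I,
    Complex.cos_neg, Complex.sin_neg]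
  have hw1 : (w : ℂ) ≠ 0 := by exact_mod_cast hw0.ne'
  push_cast
  field_simp
  ring

lemma continuous_phi (ν β : ℝ) : Continuous (phi ν β) := by
  unfold phi
  fun_prop

lemma continuous_waveSin (ν β : ℝ) : Continuous fun y : ℝ × R3 => waveSin ν β y.1 y.2 := by
  have h1 := continuous_phi ν β
  have h2 := Real.continuous_sinc
  unfold waveSin
  fun_prop

lemma continuous_symbolK00 (ν β : ℝ) : Continuous fun y : ℝ × R3 => symbolK00 ν β y.1 y.2 := by
  have h1 := continuous_phi ν β
  unfold symbolK00
  fun_prop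

section SphericalMeans

variable {ν β c₀ t : ℝ} {h : R3 → ℝ} {ξ : R3}

lemma ofReal_sinc_eq_integral (hβ : 0 < β) (ht : 0 ≤ t) (ξ : R3) :
    (Real.sinc (t * (β * ‖ξ‖)) : ℂ) =
      ∫ ω, Complex.exp (Complex.I * ((inner ℝ ((β * t) • ω) ξ : ℝ) : ℂ)) ∂sphereMeasure := by
  have := integral_sphereMeasure_exp ((β * t) • ξ)
  rw [norm_smul, Real.norm_of_nonneg (by positivity)] at this
  rw [show t * (β * ‖ξ‖) = β * t * ‖ξ‖ by ring, ← this]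
  simp only [inner_smul_left, inner_smul_right, conj_trivial]

lemma ofReal_cos_eq_integral (hβ : 0 < β) (ht : 0 ≤ t) (ξ : R3) :
    (Real.cos (β * ‖ξ‖ * t) : ℂ) =
      ∫ ω, (1 + Complex.I * ((inner ℝ ((β * t) • ω) ξ : ℝ) : ℂ)) *
        Complex.exp (Complex.I * ((inner ℝ ((β * t) • ω) ξ : ℝ) : ℂ)) ∂sphereMeasure := by
  have := integral_sphereMeasure_one_add_mul_exp ((β * t) • ξ)
  rw [norm_smul, Real.norm_of_nonneg (by positivity)] at this
  rw [show β * ‖ξ‖ * t = β * t * ‖ξ‖ by ring, ← this]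
  simp only [inner_smul_left, inner_smul_right, conj_trivial]

lemma ofReal_sinc_phi_eq_integral (hβ : 0 < β) (ht : 0 ≤ t) (hp : 0 ≤ phi ν β ξ)
    (hh : phi ν β ξ = 1 + ‖ξ‖ ^ 2 * h ξ) :
    (Real.sinc (t * β * ‖ξ‖ * phi ν β ξ) : ℂ) =
      ∫ ω, Complex.exp (Complex.I * ((inner ℝ ((β * t) • ω) ξ : ℝ) : ℂ)) *
        Complex.exp (Complex.I * ((β * t * (‖ξ‖ ^ 2 * h ξ) * inner ℝ ω ξ : ℝ) : ℂ))
          ∂sphereMeasure := by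
  have := integral_sphereMeasure_exp ((β * t * phi ν β ξ) • ξ)
  rw [norm_smul, Real.norm_of_nonneg (by positivity)] at this
  rw [show t * β * ‖ξ‖ * phi ν β ξ = β * t * phi ν β ξ * ‖ξ‖ by ring, ← this]
  simp only [hh, cexp_add_phase]

/-- The mean formula at v = βtφξ. Writing φ = 1 + |ξ|²h splits both the amplitude 1 + iω·v and the
exponential into the free part and the phase correction. -/
lemma ofReal_cos_phi_eq_integral (hβ : 0 < β) (ht : 0 ≤ t) (hp : 0 ≤ phi ν β ξ)
    (hh : phi ν β ξ = 1 + ‖ξ‖ ^ 2 * h ξ) :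
    (Real.cos (t * β * ‖ξ‖ * phi ν β ξ) : ℂ) =
      ∫ ω, (1 + Complex.I * ((inner ℝ ((β * t) • ω) ξ : ℝ) : ℂ) +
        Complex.I * ((β * t * (‖ξ‖ ^ 2 * h ξ) * inner ℝ ω ξ : ℝ) : ℂ)) *
        (Complex.exp (Complex.I * ((inner ℝ ((β * t) • ω) ξ : ℝ) : ℂ)) *
        Complex.exp (Complex.I * ((β * t * (‖ξ‖ ^ 2 * h ξ) * inner ℝ ω ξ : ℝ) : ℂ)))
          ∂sphereMeasure := by
  have := integral_sphereMeasure_one_add_mul_exp ((β * t * phi ν β ξ) • ξ)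
  rw [norm_smul, Real.norm_of_nonneg (by positivity)] at this
  rw [show t * β * ‖ξ‖ * phi ν β ξ = β * t * phi ν β ξ * ‖ξ‖ by ring, ← this]
  simp only [hh, cexp_add_phase]
  refine integral_congr_ae (Filter.Eventually.of_forall fun ω => ?_)
  simp only [inner_smul_left, inner_smul_right, conj_trivial]
  push_cast
  ring

end SphericalMeans

/-- Order 1, because the prefactor t equals (1+t) times the bounded parameter t/(1+t). -/
lemma isWaveSymbol_waveSin {ν β c₀ : ℝ} (hν : 0 < ν) (hβ : 0 < β) (hc₀ : 0 < c₀)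
    (hc : c₀ < 2 * β / ν) : IsWaveSymbol ν β c₀ 1 (waveSin ν β) := by
  obtain ⟨h, hh, hphi⟩ := exists_phi_eq hν hβ hc₀ hc
  refine ⟨fun t => ((continuous_waveSin ν β).comp (Continuous.prodMk_right t)).aestronglyMeasurable,
    fun y => (y.1.2.1 : ℂ) * Complex.exp (Complex.I * (wavePhase β h y : ℂ)), ?_, ?_⟩
  · have h1 := hasTemperateGrowth_exp_I.comp (hasTemperateGrowth_wavePhase β hh)
    exact (Function.Complex.hasTemperateGrowth_ofReal.comp (hasTemperateGrowth_coords hh).2.1).mul h1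
  intro t ht ξ hξ0 hξ
  have hT : (1 + t : ℝ) ≠ 0 := by linarith
  simp only [wavePhase_waveParam _ _ _ _ ht]
  rw [waveSin, Complex.ofReal_mul, Complex.ofReal_mul, ofReal_sinc_phi_eq_integral hβ ht
    (phi_pos hν hβ (hξ.trans hc)).le (hphi ξ hξ), ← integral_waveMeasure_of_fst,
    ← integral_const_mul, ← integral_const_mul, ← integral_const_mul, Real.rpow_one]
  refine integral_congr_ae (Filter.Eventually.of_forall fun q => ?_)
  have e : ((1 + t : ℝ) : ℂ) * ((t / (1 + t) : ℝ) : ℂ) = t := by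
    rw [← Complex.ofReal_mul, mul_div_cancel₀ _ hT]
  simp only [waveParam]
  linear_combination (-(Real.exp (-(ν * ‖ξ‖ ^ 2 / 2) * t) : ℂ) *
    Complex.exp (Complex.I * ((inner ℝ ((β * t) • q.1) ξ : ℝ) : ℂ)) *
    Complex.exp (Complex.I * ((β * t * (‖ξ‖ ^ 2 * h ξ) * inner ℝ q.1 ξ : ℝ) : ℂ))) * e

/-- Order 1/2, forced by the amplitude: βt ω·ξ = √(1+t) β (t/(1+t)) ω·η. The remaining terms 1 and
iy are smaller and are written as √(1+t) times (1+t)^{-1/2} times themselves. -/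
lemma isWaveSymbol_symbolK00 {ν β c₀ : ℝ} (hν : 0 < ν) (hβ : 0 < β) (hc₀ : 0 < c₀)
    (hc : c₀ < 2 * β / ν) : IsWaveSymbol ν β c₀ (1 / 2) (symbolK00 ν β) := by
  obtain ⟨h, hh, hphi⟩ := exists_phi_eq hν hβ hc₀ hc
  refine ⟨fun t => ((continuous_symbolK00 ν β).comp
    (Continuous.prodMk_right t)).aestronglyMeasurable,
    fun y => ((y.1.1 : ℂ) + Complex.I * ((β * (y.1.2.1 * inner ℝ y.1.2.2.2 y.2) : ℝ) : ℂ) +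
      Complex.I * ((y.1.1 * wavePhase β h y : ℝ) : ℂ)) *
      Complex.exp (Complex.I * (wavePhase β h y : ℂ)), ?_, ?_⟩
  · have h1 := hasTemperateGrowth_exp_I.comp (hasTemperateGrowth_wavePhase β hh)
    obtain ⟨hε, ha, -, hw, -, -⟩ := hasTemperateGrowth_coords hh
    refine Function.HasTemperateGrowth.mul ?_ h1
    refine (((Function.Complex.hasTemperateGrowth_ofReal.comp hε).add ?_).add ?_)
    · exact (Function.HasTemperateGrowth.const Complex.I).mul (Function.Complex.hasTemperateGrowth_ofReal.comp
        ((Function.HasTemperateGrowth.const β).mul (ha.mul hw)))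
    · exact (Function.HasTemperateGrowth.const Complex.I).mul (Function.Complex.hasTemperateGrowth_ofReal.comp
        (hε.mul (hasTemperateGrowth_wavePhase β hh)))
  intro t ht ξ hξ0 hξ
  have hT : 0 < 1 + t := by linarith
  have hT' : 0 < √(1 + t) := Real.sqrt_pos.2 hT
  simp only [wavePhase_waveParam _ _ _ _ ht]
  rw [symbolK00, Complex.ofReal_mul, ofReal_cos_phi_eq_integral hβ ht
    (phi_pos hν hβ (hξ.trans hc)).le (hphi ξ hξ), ← integral_waveMeasure_of_fst,
    ← integral_const_mul, ← integral_const_mul, ← Real.sqrt_eq_rpow]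
  refine integral_congr_ae (Filter.Eventually.of_forall fun q => ?_)
  have e : (√(1 + t) : ℂ) * (((√(1 + t))⁻¹ : ℝ) : ℂ) = 1 := by
    rw [← Complex.ofReal_mul, mul_inv_cancel₀ hT'.ne', Complex.ofReal_one]
  have e' : (√(1 + t) : ℂ) * ((β * (t / (1 + t) * inner ℝ q.1 (√(1 + t) • ξ)) : ℝ) : ℂ) =
      ((inner ℝ ((β * t) • q.1) ξ : ℝ) : ℂ) := by
    rw [← Complex.ofReal_mul, inner_smul_left, inner_smul_right]
    congr 1
    have := Real.sq_sqrt hT.le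
    simp only [conj_trivial]
    field_simp
    rw [this]
  simp only [waveParam]
  rw [← e']
  push_cast at e ⊢
  linear_combination (-(Complex.exp (-(ν * ‖ξ‖ ^ 2 / 2) * t) : ℂ) *
    Complex.exp (Complex.I * ((√(1 + t) : ℂ) * (β * (t / (1 + t) * ((inner ℝ q.1 (√(1 + t) • ξ) : ℝ) : ℂ))))) *
    Complex.exp (Complex.I * (β * t * (‖ξ‖ ^ 2 * h ξ) * ((inner ℝ q.1 ξ : ℝ) : ℂ))) * (1 + Complex.I * (β * t * (‖ξ‖ ^ 2 * h ξ) * ((inner ℝ q.1 ξ : ℝ) : ℂ)))) * e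


lemma integrable_sphereMeasure_of_continuous {F : R3 → ℂ} (hF : Continuous F) :
    Integrable F sphereMeasure := by
  obtain ⟨C, hC⟩ := (isCompact_sphere (0 : R3) 1).exists_bound_of_continuousOn hF.continuousOn
  refine Integrable.of_bound (C := C) hF.aestronglyMeasurable ?_
  filter_upwards [ae_norm_eq_one_sphereMeasure] with q hq
  exact hC q (by simpa using hq)

/-- `(e^{-ν|ξ|²t/2} t sinc(β|ξ|φ(ξ)t) - 𝒢₁) / |ξ|²`. -/
def waveSinDiff (ν β t : ℝ) (ξ : R3) : ℂ :=
  (waveSin ν β t ξ - symbolG1 ν β t ξ) / ((‖ξ‖ ^ 2 : ℝ) : ℂ)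

/-- `(𝒦₀₀ - 𝒢₀) / |ξ|²`. -/
def waveCosDiff (ν β t : ℝ) (ξ : R3) : ℂ :=
  (symbolK00 ν β t ξ - symbolG0 ν β t ξ) / ((‖ξ‖ ^ 2 : ℝ) : ℂ)

lemma measurable_symbolG1 (ν β t : ℝ) : Measurable (symbolG1 ν β t) := by
  unfold symbolG1
  fun_prop

lemma continuous_symbolG0 (ν β t : ℝ) : Continuous (symbolG0 ν β t) := by
  unfold symbolG0
  fun_prop

lemma measurable_waveSinDiff (ν β t : ℝ) : Measurable (waveSinDiff ν β t) := by
  have h1 := measurable_symbolG1 ν β t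
  have h2 : Measurable (waveSin ν β t) :=
    ((continuous_waveSin ν β).comp (Continuous.prodMk_right t)).measurable
  unfold waveSinDiff
  fun_prop

lemma measurable_waveCosDiff (ν β t : ℝ) : Measurable (waveCosDiff ν β t) := by
  have h1 := (continuous_symbolG0 ν β t).measurable
  have h2 : Measurable (symbolK00 ν β t) :=
    ((continuous_symbolK00 ν β).comp (Continuous.prodMk_right t)).measurable
  unfold waveCosDiff
  fun_prop

lemma ofReal_rpow_three_halves_mul {t : ℝ} (ht : 0 ≤ t) :
    (1 + t) ^ (3 / 2 : ℝ) * ((t / (1 + t)) ^ 2 * √(1 + t)) = t ^ 2 := by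
  have hT : 0 < 1 + t := by linarith
  rw [Real.sqrt_eq_rpow, mul_left_comm, ← Real.rpow_add hT]
  norm_num
  field_simp

/-- In t(e^{iy} - 1)/|ξ|² the factor |ξ|² of y cancels and leaves t · βt h ω·ξ, which is (1+t)^{3/2}
β (t/(1+t))² h ω·η. Hence order 3/2. -/
lemma isWaveSymbol_waveSinDiff {ν β c₀ : ℝ} (hν : 0 < ν) (hβ : 0 < β) (hc₀ : 0 < c₀)
    (hc : c₀ < 2 * β / ν) : IsWaveSymbol ν β c₀ (3 / 2) (waveSinDiff ν β) := by
  obtain ⟨h, hh, hphi⟩ := exists_phi_eq hν hβ hc₀ hc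
  refine ⟨fun t => (measurable_waveSinDiff ν β t).aestronglyMeasurable,
    fun y => Complex.I *
      ((β * (y.1.2.1 ^ 2 * (h (y.1.1 • y.2) * inner ℝ y.1.2.2.2 y.2)) : ℝ) : ℂ) *
      Complex.exp (Complex.I * ((y.1.2.2.1 * wavePhase β h y : ℝ) : ℂ)), ?_, ?_⟩
  · obtain ⟨-, ha, hz, hw, -, hH⟩ := hasTemperateGrowth_coords hh
    have h1 := hasTemperateGrowth_exp_I.comp (hz.mul (hasTemperateGrowth_wavePhase β hh))
    exact ((Function.HasTemperateGrowth.const Complex.I).mul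
      (Function.Complex.hasTemperateGrowth_ofReal.comp
      ((Function.HasTemperateGrowth.const β).mul ((ha.pow 2).mul (hH.mul hw))))).mul h1
  intro t ht ξ hξ0 hξ
  have hs : ‖ξ‖ ≠ 0 := norm_ne_zero_iff.2 hξ0
  have hsC : (((‖ξ‖ ^ 2 : ℝ)) : ℂ) ≠ 0 := by exact_mod_cast pow_ne_zero 2 hs
  have hE : Continuous fun ω : R3 =>
    Complex.exp (Complex.I * ((inner ℝ ((β * t) • ω) ξ : ℝ) : ℂ)) := by fun_prop
  have hY : Continuous fun ω : R3 => β * t * (‖ξ‖ ^ 2 * h ξ) * inner ℝ ω ξ := by fun_prop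
  have key := integral_waveMeasure_mul_exp hE hY
  simp only [mul_sub, mul_one] at key
  rw [integral_sub (integrable_sphereMeasure_of_continuous (by fun_prop))
    (integrable_sphereMeasure_of_continuous hE), ← ofReal_sinc_phi_eq_integral hβ ht
    (phi_pos hν hβ (hξ.trans hc)).le (hphi ξ hξ), ← ofReal_sinc_eq_integral hβ ht] at key
  simp only [wavePhase_waveParam _ _ _ _ ht]
  have e1 : ((1 + t) ^ (3 / 2 : ℝ) : ℝ) * (β * ((t / (1 + t)) ^ 2 * (h ξ *
      (√(1 + t) * 1)))) * ‖ξ‖ ^ 2 = t * (β * t * (‖ξ‖ ^ 2 * h ξ)) := by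
    linear_combination (β * h ξ * ‖ξ‖ ^ 2) * ofReal_rpow_three_halves_mul ht
  have e2 : (((1 + t) ^ (3 / 2 : ℝ) : ℝ) : ℂ) * ∫ q, Complex.exp (Complex.I *
      ((inner ℝ ((β * t) • q.1) ξ : ℝ) : ℂ)) * (Complex.I *
      ((β * ((waveParam t q).2.1 ^ 2 * (h ((waveParam t q).1 • √(1 + t) • ξ) *
        inner ℝ (waveParam t q).2.2.2 (√(1 + t) • ξ))) : ℝ) : ℂ) *
      Complex.exp (Complex.I * (((waveParam t q).2.2.1 *
        (β * t * (‖ξ‖ ^ 2 * h ξ) * inner ℝ q.1 ξ) : ℝ) : ℂ))) ∂waveMeasure =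
      t / ((‖ξ‖ ^ 2 : ℝ) : ℂ) * ((Real.sinc (t * β * ‖ξ‖ * phi ν β ξ) : ℂ) -
        Real.sinc (t * (β * ‖ξ‖))) := by
    rw [← key, ← integral_const_mul, ← integral_const_mul]
    refine integral_congr_ae (Filter.Eventually.of_forall fun q => ?_)
    simp only [waveParam, inv_sqrt_smul_sqrt_smul ξ ht]
    rw [inner_smul_right q.1 ξ (√(1 + t))]
    have e1' := congrArg (fun x : ℝ => (x : ℂ)) e1
    rw [div_mul_eq_mul_div, eq_div_iff hsC]
    push_cast at e1' ⊢
    linear_combination (Complex.I * ((inner ℝ q.1 ξ : ℝ) : ℂ) *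
      Complex.exp (Complex.I * ((inner ℝ ((β * t) • q.1) ξ : ℝ) : ℂ)) *
      Complex.exp (Complex.I * (q.2 * (β * t * (‖ξ‖ ^ 2 * h ξ) * ((inner ℝ q.1 ξ : ℝ) : ℂ))))) * e1'
  rw [mul_right_comm, e2, waveSinDiff, symbolG1_eq hβ t hξ0, waveSin]
  push_cast
  ring

/-- Order 1 is two half powers: one from y/|ξ|² = √(1+t) β (t/(1+t)) h ω·η and one from the
amplitude of the cosine mean. -/
lemma isWaveSymbol_waveCosDiff {ν β c₀ : ℝ} (hν : 0 < ν) (hβ : 0 < β) (hc₀ : 0 < c₀)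
    (hc : c₀ < 2 * β / ν) : IsWaveSymbol ν β c₀ 1 (waveCosDiff ν β) := by
  obtain ⟨h, hh, hphi⟩ := exists_phi_eq hν hβ hc₀ hc
  refine ⟨fun t => (measurable_waveCosDiff ν β t).aestronglyMeasurable,
    fun y => Complex.I *
      ((β * (y.1.2.1 * (h (y.1.1 • y.2) * inner ℝ y.1.2.2.2 y.2)) : ℝ) : ℂ) *
      (((y.1.1 : ℂ) + Complex.I * ((β * (y.1.2.1 * inner ℝ y.1.2.2.2 y.2) : ℝ) : ℂ)) *
        Complex.exp (Complex.I * ((y.1.2.2.1 * wavePhase β h y : ℝ) : ℂ)) +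
        (y.1.1 : ℂ) * Complex.exp (Complex.I * (wavePhase β h y : ℂ))), ?_, ?_⟩
  · obtain ⟨hε, ha, hz, hw, -, hH⟩ := hasTemperateGrowth_coords hh
    have hY := hasTemperateGrowth_wavePhase β hh
    have h1 := hasTemperateGrowth_exp_I.comp (hz.mul hY)
    have h2 := hasTemperateGrowth_exp_I.comp hY
    have hI := Function.HasTemperateGrowth.const (E := WaveParam × R3) Complex.I
    have hB := Function.HasTemperateGrowth.const (E := WaveParam × R3) β
    have hC := Function.Complex.hasTemperateGrowth_ofReal
    exact (hI.mul (hC.comp (hB.mul (ha.mul (hH.mul hw))))).mul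
      ((((hC.comp hε).add (hI.mul (hC.comp (hB.mul (ha.mul hw))))).mul h1).add
        ((hC.comp hε).mul h2))
  intro t ht ξ hξ0 hξ
  have hT : 0 < 1 + t := by linarith
  have hT' : 0 < √(1 + t) := Real.sqrt_pos.2 hT
  have hTs := Real.sq_sqrt hT.le
  have hs : ‖ξ‖ ≠ 0 := norm_ne_zero_iff.2 hξ0
  have hsC : (((‖ξ‖ ^ 2 : ℝ)) : ℂ) ≠ 0 := by exact_mod_cast pow_ne_zero 2 hs
  have hE : Continuous fun ω : R3 => (1 + Complex.I * ((inner ℝ ((β * t) • ω) ξ : ℝ) : ℂ)) *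
    Complex.exp (Complex.I * ((inner ℝ ((β * t) • ω) ξ : ℝ) : ℂ)) := by fun_prop
  have hY : Continuous fun ω : R3 => β * t * (‖ξ‖ ^ 2 * h ξ) * inner ℝ ω ξ := by fun_prop
  have key := integral_waveMeasure_mul_exp hE hY
  -- With u = βt ω·ξ, the integrands differ by (1+iu)e^{iu}(e^{iy} - 1) + iy e^{iu}e^{iy}. Both
  -- pieces contain the factor y, the first one after the z-integral is introduced.
  have key2 : (Real.cos (t * β * ‖ξ‖ * phi ν β ξ) : ℂ) - Real.cos (β * ‖ξ‖ * t) =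
      ∫ q, ((1 + Complex.I * ((inner ℝ ((β * t) • q.1) ξ : ℝ) : ℂ)) *
        Complex.exp (Complex.I * ((inner ℝ ((β * t) • q.1) ξ : ℝ) : ℂ)) *
        (Complex.I * ((β * t * (‖ξ‖ ^ 2 * h ξ) * inner ℝ q.1 ξ : ℝ) : ℂ) * Complex.exp (Complex.I *
          ((q.2 * (β * t * (‖ξ‖ ^ 2 * h ξ) * inner ℝ q.1 ξ) : ℝ) : ℂ))) +
        Complex.I * ((β * t * (‖ξ‖ ^ 2 * h ξ) * inner ℝ q.1 ξ : ℝ) : ℂ) *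
        (Complex.exp (Complex.I * ((inner ℝ ((β * t) • q.1) ξ : ℝ) : ℂ)) *
        Complex.exp (Complex.I * ((β * t * (‖ξ‖ ^ 2 * h ξ) * inner ℝ q.1 ξ : ℝ) : ℂ))))
        ∂waveMeasure := by
    rw [integral_add (integrable_waveMeasure_of_continuous (by fun_prop))
      (integrable_waveMeasure_of_continuous (by fun_prop)), key,
      integral_waveMeasure_of_fst (fun ω => Complex.I *
        ((β * t * (‖ξ‖ ^ 2 * h ξ) * inner ℝ ω ξ : ℝ) : ℂ) *
        (Complex.exp (Complex.I * ((inner ℝ ((β * t) • ω) ξ : ℝ) : ℂ)) *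
        Complex.exp (Complex.I * ((β * t * (‖ξ‖ ^ 2 * h ξ) * inner ℝ ω ξ : ℝ) : ℂ)))),
      ofReal_cos_phi_eq_integral hβ ht (phi_pos hν hβ (hξ.trans hc)).le (hphi ξ hξ),
      ofReal_cos_eq_integral hβ ht,
      ← integral_sub (integrable_sphereMeasure_of_continuous (by fun_prop))
        (integrable_sphereMeasure_of_continuous (by fun_prop)),
      ← integral_add (integrable_sphereMeasure_of_continuous (by fun_prop))
        (integrable_sphereMeasure_of_continuous (by fun_prop))]
    refine integral_congr_ae (Filter.Eventually.of_forall fun ω => ?_)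
    ring
  simp only [wavePhase_waveParam _ _ _ _ ht]
  have e3 : (√(1 + t) : ℂ) * (((√(1 + t))⁻¹ : ℝ) : ℂ) = 1 := by
    rw [← Complex.ofReal_mul, mul_inv_cancel₀ hT'.ne', Complex.ofReal_one]
  have e4 : (√(1 + t) : ℂ) * (√(1 + t) : ℂ) = 1 + t := by
    rw [← Complex.ofReal_mul, ← sq, hTs]; push_cast; ring
  have hTC : (1 + t : ℂ) ≠ 0 := by exact_mod_cast hT.ne'
  have e5 : (1 + t : ℂ) * (t / (1 + t)) = t := mul_div_cancel₀ _ hTC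
  rw [waveCosDiff, symbolK00, symbolG0, Complex.ofReal_mul, Complex.ofReal_mul, ← mul_sub, key2,
    Real.rpow_one, mul_div_assoc, mul_comm ((1 + t : ℝ) : ℂ) _,
    mul_assoc (Real.exp (-(ν * ‖ξ‖ ^ 2 / 2) * t) : ℂ) ((1 + t : ℝ) : ℂ) _]
  congr 1
  rw [div_eq_iff hsC, ← integral_const_mul, ← integral_mul_const]
  refine integral_congr_ae (Filter.Eventually.of_forall fun q => ?_)
  simp only [waveParam, inv_sqrt_smul_sqrt_smul ξ ht]
  rw [inner_smul_right q.1 ξ (√(1 + t)), inner_smul_left]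
  simp only [conj_trivial]
  push_cast at e3 ⊢
  -- Once the exponentials are opaque, the claim is a polynomial identity modulo `e3`, `e4`, `e5`,
  -- the scaling relations among √(1+t), its inverse and t/(1+t).
  generalize (inner ℝ q.1 ξ : ℝ) = r at *
  generalize (t / (1 + t) : ℂ) = a at *
  generalize ((√(1 + t) : ℝ) : ℂ) = S at *
  generalize Complex.exp (Complex.I * (β * t * r)) = E
  generalize Complex.exp (Complex.I * (q.2 * (β * t * (‖ξ‖ ^ 2 * h ξ) * r))) = ez
  generalize Complex.exp (Complex.I * (β * t * (‖ξ‖ ^ 2 * h ξ) * r)) = ey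
  linear_combination -(E * Complex.I * β * h ξ * r * ‖ξ‖ ^ 2) *
    (((1 + t) * a * e3 + e5) * (ez + ey) +
      ((1 + t) * a ^ 2 * e4 + ((1 + t) * a + t) * e5) * (Complex.I * β * r * ez))

/-! ### Low-frequency kernels and differentiation in time -/

lemma IsLowCutoff.continuous {c₀ : ℝ} {χ : R3 → ℝ} (hχ : IsLowCutoff c₀ χ) : Continuous χ :=
  hχ.smooth.continuous

lemma IsLowCutoff.isCutSymbol {c₀ : ℝ} {χ : R3 → ℝ} (hχ : IsLowCutoff c₀ χ) :
    IsCutSymbol c₀ fun ξ => (χ ξ : ℂ) :=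
  ⟨Complex.ofRealCLM.contDiff.comp hχ.smooth, fun ξ hξ => by simp [hχ.eq_zero ξ hξ]⟩

lemma measurable_rieszSymbol (a : Fin 3) : Measurable (rieszSymbol a) := by
  unfold rieszSymbol
  fun_prop

lemma norm_rieszSymbol_le_one (a : Fin 3) (ξ : R3) : ‖rieszSymbol a ξ‖ ≤ 1 := by
  rw [rieszSymbol, Complex.norm_real, norm_div, norm_norm]
  exact div_le_one_of_le₀ (EuclideanSpace.norm_eq ξ ▸ PiLp.norm_apply_le ξ a) (norm_nonneg ξ)

/-- The symbol of `ℛ_a ℛ_b ℱ⁻¹[f χ]`. -/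
def lowSymbol (f : R3 → ℂ) (χ : R3 → ℝ) (a b : Fin 3) (ξ : R3) : ℂ :=
  rieszSymbol a ξ * rieszSymbol b ξ * (f ξ * (χ ξ : ℂ))

lemma lowKernel_eq (s : ℝ → R3 → ℂ) (χ : R3 → ℝ) (a b : Fin 3) (t : ℝ) :
    lowKernel s χ a b t = invFourier (lowSymbol (s t) χ a b) := rfl

lemma norm_lowSymbol_le (f : R3 → ℂ) (χ : R3 → ℝ) (a b : Fin 3) (ξ : R3) :
    ‖lowSymbol f χ a b ξ‖ ≤ ‖f ξ * (χ ξ : ℂ)‖ := by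
  rw [lowSymbol, norm_mul, norm_mul]
  exact mul_le_of_le_one_left (norm_nonneg _)
    (mul_le_one₀ (norm_rieszSymbol_le_one a ξ) (norm_nonneg _) (norm_rieszSymbol_le_one b ξ))

lemma isBddSymbol_lowSymbol {c₀ : ℝ} {χ : R3 → ℝ} (hχ : IsLowCutoff c₀ χ) (a b : Fin 3)
    {f : R3 → ℂ} (hf : Continuous f) : IsBddSymbol (lowSymbol f χ a b) := by
  have hc : Continuous fun ξ => f ξ * (χ ξ : ℂ) :=
    hf.mul (Complex.continuous_ofReal.comp hχ.continuous)
  obtain ⟨C, hC⟩ := hc.bounded_above_of_compact_support hχ.isCutSymbol.hasCompactSupport.mul_left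
  exact ⟨((measurable_rieszSymbol a).mul (measurable_rieszSymbol b)).aestronglyMeasurable.mul
    hc.aestronglyMeasurable, ⟨C, fun ξ => (norm_lowSymbol_le f χ a b ξ).trans (hC ξ)⟩, c₀,
    fun ξ hξ => by simp [lowSymbol, hχ.eq_zero ξ hξ]⟩

/-- Differentiation in time under the Fourier integral. -/
lemma hasDerivAt_lowKernel {c₀ : ℝ} {χ : R3 → ℝ} (hχ : IsLowCutoff c₀ χ) (a b : Fin 3)
    {F F' : ℝ → R3 → ℂ} (hF : Continuous fun y : ℝ × R3 => F y.1 y.2)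
    (hF' : Continuous fun y : ℝ × R3 => F' y.1 y.2)
    (hd : ∀ ξ, ‖ξ‖ < c₀ → ∀ t, HasDerivAt (fun t => F t ξ) (F' t ξ) t) (t : ℝ) (x : R3) :
    HasDerivAt (fun t => lowKernel F χ a b t x) (lowKernel F' χ a b t x) t := by
  have hb := fun t => isBddSymbol_lowSymbol hχ a b (hF.comp (Continuous.prodMk_right t))
  have hb' := fun t => isBddSymbol_lowSymbol hχ a b (hF'.comp (Continuous.prodMk_right t))
  have hcx : Continuous fun ξ : R3 => Complex.exp (Complex.I * ((inner ℝ x ξ : ℝ) : ℂ)) := by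
    fun_prop
  have hcont : Continuous fun y : ℝ × R3 => F' y.1 y.2 * (χ y.2 : ℂ) :=
    hF'.mul (Complex.continuous_ofReal.comp (hχ.continuous.comp continuous_snd))
  -- Domination has to be uniform for times near t; compactness of this product gives it, the
  -- cut-off handling large frequencies.
  obtain ⟨C, hC⟩ := ((isCompact_closedBall t 1).prod
    (isCompact_closedBall (0 : R3) c₀)).exists_bound_of_continuousOn hcont.continuousOn
  have hbound : ∀ ξ, ∀ τ ∈ Metric.closedBall t 1,
      ‖Complex.exp (Complex.I * ((inner ℝ x ξ : ℝ) : ℂ)) * lowSymbol (F' τ) χ a b ξ‖ ≤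
        (Metric.closedBall (0 : R3) c₀).indicator (fun _ => C) ξ := by
    intro ξ τ hτ
    rw [norm_mul, norm_exp_I_mul_ofReal_eq_one, one_mul]
    by_cases hξ : ξ ∈ Metric.closedBall (0 : R3) c₀
    · rw [indicator_of_mem hξ]
      exact (norm_lowSymbol_le _ _ _ _ _).trans (hC (τ, ξ) ⟨hτ, hξ⟩)
    · rw [indicator_of_notMem hξ]
      simp only [Metric.mem_closedBall, dist_zero_right, not_le] at hξ
      simp [lowSymbol, hχ.eq_zero ξ hξ.le]
  have h := hasDerivAt_integral_of_dominated_loc_of_deriv_le (μ := (volume : Measure R3))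
    (F := fun t ξ => Complex.exp (Complex.I * ((inner ℝ x ξ : ℝ) : ℂ)) * lowSymbol (F t) χ a b ξ)
    (F' := fun t ξ => Complex.exp (Complex.I * ((inner ℝ x ξ : ℝ) : ℂ)) * lowSymbol (F' t) χ a b ξ)
    (x₀ := t) (Metric.closedBall_mem_nhds t zero_lt_one)
    (Filter.Eventually.of_forall fun τ => ((hb τ).continuous_mul hcx).aesm)
    ((hb t).continuous_mul hcx).integrable ((hb' t).continuous_mul hcx).aesm
    (Filter.Eventually.of_forall hbound)
    ((integrable_indicator_iff measurableSet_closedBall).2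
      (integrableOn_const (isCompact_closedBall _ _).measure_lt_top.ne))
    (Filter.Eventually.of_forall fun ξ τ _ => ?_)
  · simp only [lowKernel_eq, invFourier_apply]
    exact h.2.const_mul _
  · refine HasDerivAt.const_mul _ ?_
    by_cases hξ : ‖ξ‖ < c₀
    · exact ((hd ξ hξ τ).mul_const _).const_mul _
    · simp only [lowSymbol, hχ.eq_zero ξ (not_lt.1 hξ), Complex.ofReal_zero, mul_zero]
      exact hasDerivAt_const _ _

/-! ### Time derivatives as a recursion on polynomials in |ξ|² -/

section TimeDerivative

open Polynomial

/-- The time derivative of `p 𝒦₀₀ + q 𝒦₁`, for polynomials `p`, `q` in `|ξ|²`. -/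
def timeStep (ν β : ℝ) (w : ℝ[X] × ℝ[X]) : ℝ[X] × ℝ[X] :=
  (w.2 - C (ν / 2) * X * w.1, -(C (β ^ 2) * X - C (ν / 2) ^ 2 * X ^ 2) * w.1 - C (ν / 2) * X * w.2)

/-- The symbol `p 𝒦₀₀ + q 𝒦₁`, for polynomials `p`, `q` in `|ξ|²`. -/
def waveComb (ν β : ℝ) (w : ℝ[X] × ℝ[X]) (t : ℝ) (ξ : R3) : ℂ :=
  ((w.1.eval (‖ξ‖ ^ 2) : ℝ) : ℂ) * symbolK00 ν β t ξ +
    ((w.2.eval (‖ξ‖ ^ 2) : ℝ) : ℂ) * waveSin ν β t ξ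

lemma continuous_waveComb (ν β : ℝ) (w : ℝ[X] × ℝ[X]) :
    Continuous fun y : ℝ × R3 => waveComb ν β w y.1 y.2 := by
  have h1 := continuous_symbolK00 ν β
  have h2 := continuous_waveSin ν β
  have h3 := w.1.continuous
  have h4 := w.2.continuous
  unfold waveComb
  fun_prop

lemma hasDerivAt_mul_sinc (w t : ℝ) :
    HasDerivAt (fun t => t * Real.sinc (t * w)) (Real.cos (t * w)) t := by
  by_cases hw : w = 0
  · simpa [hw] using hasDerivAt_id' t
  · simp only [mul_sinc_eq_div _ _ hw]
    have h1 : HasDerivAt (fun t => w * t) (w * 1) t := (hasDerivAt_id t).const_mul w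
    exact (h1.sin.div_const w).congr_deriv (by field_simp)

/-- The frequency Ω = β|ξ|φ enters the derivatives only through Ω² = β²|ξ|² - ν²|ξ|⁴/4, a polynomial
in |ξ|². This keeps the combinations closed under differentiation. -/
lemma hasDerivAt_waveComb {ν β : ℝ} (hν : 0 < ν) (hβ : 0 < β) (w : ℝ[X] × ℝ[X]) {ξ : R3}
    (hξ : ‖ξ‖ < 2 * β / ν) (t : ℝ) :
    HasDerivAt (fun t => waveComb ν β w t ξ) (waveComb ν β (timeStep ν β w) t ξ) t := by
  obtain ⟨Ω, hΩ⟩ : ∃ Ω, Ω = β * ‖ξ‖ * phi ν β ξ := ⟨_, rfl⟩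
  have hΩ2 : Ω ^ 2 = β ^ 2 * ‖ξ‖ ^ 2 - (ν / 2) ^ 2 * (‖ξ‖ ^ 2) ^ 2 := by
    rw [hΩ, mul_pow, sq_phi hν hβ hξ]
    field_simp
    ring
  have harg : ∀ t, t * β * ‖ξ‖ * phi ν β ξ = t * Ω := fun t => by rw [hΩ]; ring
  have hE : HasDerivAt (fun t => Real.exp (-(ν * ‖ξ‖ ^ 2 / 2) * t))
      (Real.exp (-(ν * ‖ξ‖ ^ 2 / 2) * t) * (-(ν * ‖ξ‖ ^ 2 / 2) * 1)) t :=
    ((hasDerivAt_id t).const_mul _).exp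
  have hc : HasDerivAt (fun t => Real.cos (t * Ω)) (-(Ω ^ 2 * (t * Real.sinc (t * Ω)))) t := by
    have h1 : HasDerivAt (fun t => t * Ω) (1 * Ω) t := (hasDerivAt_id t).mul_const Ω
    refine h1.cos.congr_deriv ?_
    by_cases h0 : Ω = 0
    · simp [h0]
    · rw [mul_sinc_eq_div _ _ h0, mul_comm t Ω]
      field_simp
  have hs := hasDerivAt_mul_sinc Ω t
  have h00 := (hE.mul hc).ofReal_comp.const_mul ((w.1.eval (‖ξ‖ ^ 2) : ℝ) : ℂ)
  have h11 := (hE.mul hs).ofReal_comp.const_mul ((w.2.eval (‖ξ‖ ^ 2) : ℝ) : ℂ)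
  simp only [waveComb, symbolK00, waveSin, harg]
  refine (h00.add h11).congr_deriv ?_
  have hΩ2' := congrArg (fun x : ℝ => (x : ℂ)) hΩ2
  simp only [timeStep, eval_sub, eval_mul, eval_neg, eval_C, eval_X, eval_pow]
  push_cast at hΩ2' ⊢
  linear_combination (-((w.1.eval (‖ξ‖ ^ 2) : ℝ) : ℂ) * Complex.exp (-(ν * ‖ξ‖ ^ 2 / 2) * t) *
    (t * Real.sinc (t * Ω))) * hΩ2'

lemma timeDeriv_lowKernel_waveComb {ν β c₀ : ℝ} (hν : 0 < ν) (hβ : 0 < β)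
    (hc : c₀ < 2 * β / ν) {χ : R3 → ℝ} (hχ : IsLowCutoff c₀ χ) (a b : Fin 3) (w : ℝ[X] × ℝ[X])
    (l : ℕ) : timeDeriv l (lowKernel (waveComb ν β w) χ a b) =
      lowKernel (waveComb ν β ((timeStep ν β)^[l] w)) χ a b := by
  induction l with
  | zero => funext t x; simp [timeDeriv]
  | succ l ih =>
    funext t x
    have h1 : iteratedDeriv l (fun s => lowKernel (waveComb ν β w) χ a b s x) =
        fun s => lowKernel (waveComb ν β ((timeStep ν β)^[l] w)) χ a b s x := by
      funext s
      exact congrFun (congrFun ih s) x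
    rw [timeDeriv, iteratedDeriv_succ, h1, Function.iterate_succ_apply']
    exact (hasDerivAt_lowKernel hχ a b (continuous_waveComb _ _ _) (continuous_waveComb _ _ _)
      (fun ξ hξ t => hasDerivAt_waveComb hν hβ _ (hξ.trans hc) t) t x).deriv

lemma kernelK00_eq (ν β : ℝ) (χ : R3 → ℝ) (a b : Fin 3) :
    kernelK00 ν β χ a b = lowKernel (waveComb ν β (1, 0)) χ a b := by
  have : symbolK00 ν β = waveComb ν β (1, 0) := by
    funext t ξ
    simp [waveComb]
  rw [kernelK00, this]

/-- The symbols may disagree at ξ = 0 and above the threshold; the Riesz symbols, with 0/0 = 0, hide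
the first and the cut-off hides the second. -/
lemma kernelK1_eq {ν β c₀ : ℝ} (hν : 0 < ν) (hβ : 0 < β) (hc : c₀ < 2 * β / ν) {χ : R3 → ℝ}
    (hχ : IsLowCutoff c₀ χ) (a b : Fin 3) :
    kernelK1 ν β χ a b = lowKernel (waveComb ν β (0, 1)) χ a b := by
  funext t
  rw [kernelK1, lowKernel_eq, lowKernel_eq]
  congr 1
  funext ξ
  by_cases h0 : ξ = 0
  · simp [lowSymbol, rieszSymbol, h0]
  by_cases hξ : ‖ξ‖ < c₀
  · simp [lowSymbol, waveComb, symbolK1_eq hν hβ t (hξ.trans hc) h0]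
  · simp [lowSymbol, hχ.eq_zero ξ (not_lt.1 hξ)]

variable (ν β : ℝ)

/-- Two time derivatives multiply by -β²|ξ|² up to higher powers of |ξ|². Only the order of
vanishing of the errors matters: each has at least one power of X beyond what the Riesz denominator
consumes, so P and Q stay unspecified. -/
lemma timeStep_iterate_cos (m : ℕ) :
    (∃ P Q, (timeStep ν β)^[2 * m] (1, 0) =
      ((-C (β ^ 2)) ^ m * X ^ m + X ^ (m + 1) * P, X ^ (m + 1) * Q)) ∧
    ∃ P Q, (timeStep ν β)^[2 * m + 1] (1, 0) =
      (X ^ (m + 1) * P, (-C (β ^ 2)) ^ (m + 1) * X ^ (m + 1) + X ^ (m + 2) * Q) := by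
  have step : ∀ m, (∃ P Q, (timeStep ν β)^[2 * m] (1, 0) =
      ((-C (β ^ 2)) ^ m * X ^ m + X ^ (m + 1) * P, X ^ (m + 1) * Q)) →
      ∃ P Q, (timeStep ν β)^[2 * m + 1] (1, 0) =
      (X ^ (m + 1) * P, (-C (β ^ 2)) ^ (m + 1) * X ^ (m + 1) + X ^ (m + 2) * Q) := by
    rintro m ⟨P, Q, h⟩
    refine ⟨Q - C (ν / 2) * ((-C (β ^ 2)) ^ m + X * P), -C (β ^ 2) * P + C (ν / 2) ^ 2 *
      ((-C (β ^ 2)) ^ m + X * P) - C (ν / 2) * Q, ?_⟩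
    rw [Function.iterate_succ_apply', h, timeStep]
    ext1 <;> ring
  induction m with
  | zero => exact ⟨⟨0, 0, by simp⟩, step 0 ⟨0, 0, by simp⟩⟩
  | succ m ih =>
    have h0 : ∃ P Q, (timeStep ν β)^[2 * (m + 1)] (1, 0) =
        ((-C (β ^ 2)) ^ (m + 1) * X ^ (m + 1) + X ^ (m + 1 + 1) * P, X ^ (m + 1 + 1) * Q) := by
      obtain ⟨P, Q, h⟩ := ih.2
      refine ⟨Q - C (ν / 2) * P, -(C (β ^ 2) - C (ν / 2) ^ 2 * X) * P -
        C (ν / 2) * ((-C (β ^ 2)) ^ (m + 1) + X * Q), ?_⟩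
      rw [show 2 * (m + 1) = 2 * m + 1 + 1 by ring, Function.iterate_succ_apply', h, timeStep]
      ext1 <;> ring
    exact ⟨h0, step _ h0⟩

/-- The same recursion from 𝒦₁. In the even case the 𝒦₀₀ coefficient is only divisible by X^m, which
for m = 0 would leave the Riesz denominator uncancelled; the clause that P vanishes then covers
this. -/
lemma timeStep_iterate_sin (m : ℕ) :
    (∃ P Q, (m = 0 → P = 0) ∧ (timeStep ν β)^[2 * m] (0, 1) =
      (X ^ m * P, (-C (β ^ 2)) ^ m * X ^ m + X ^ (m + 1) * Q)) ∧
    ∃ P Q, (timeStep ν β)^[2 * m + 1] (0, 1) =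
      ((-C (β ^ 2)) ^ m * X ^ m + X ^ (m + 1) * P, X ^ (m + 1) * Q) := by
  have step : ∀ m, (∃ P Q, (m = 0 → P = 0) ∧ (timeStep ν β)^[2 * m] (0, 1) =
      (X ^ m * P, (-C (β ^ 2)) ^ m * X ^ m + X ^ (m + 1) * Q)) →
      ∃ P Q, (timeStep ν β)^[2 * m + 1] (0, 1) =
      ((-C (β ^ 2)) ^ m * X ^ m + X ^ (m + 1) * P, X ^ (m + 1) * Q) := by
    rintro m ⟨P, Q, -, h⟩
    refine ⟨Q - C (ν / 2) * P, -(C (β ^ 2) - C (ν / 2) ^ 2 * X) * P -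
        C (ν / 2) * ((-C (β ^ 2)) ^ m + X * Q), ?_⟩
    rw [Function.iterate_succ_apply', h, timeStep]
    ext1 <;> ring
  induction m with
  | zero => exact ⟨⟨0, 0, by simp⟩, step 0 ⟨0, 0, by simp⟩⟩
  | succ m ih =>
    have h0 : ∃ P Q, (m + 1 = 0 → P = 0) ∧ (timeStep ν β)^[2 * (m + 1)] (0, 1) =
        (X ^ (m + 1) * P, (-C (β ^ 2)) ^ (m + 1) * X ^ (m + 1) + X ^ (m + 1 + 1) * Q) := by
      obtain ⟨P, Q, h⟩ := ih.2
      refine ⟨Q - C (ν / 2) * ((-C (β ^ 2)) ^ m + X * P), -C (β ^ 2) * P + C (ν / 2) ^ 2 *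
        ((-C (β ^ 2)) ^ m + X * P) - C (ν / 2) * Q, by simp, ?_⟩
      rw [show 2 * (m + 1) = 2 * m + 1 + 1 by ring, Function.iterate_succ_apply', h, timeStep]
      ext1 <;> ring
    exact ⟨h0, step _ h0⟩

end TimeDerivative

/-! ### Admissible symbols -/

lemma HasKernelBound.mono {γ γ' : ℝ} (h : γ ≤ γ') {M : ℝ → R3 → ℂ} (hM : HasKernelBound γ M) :
    HasKernelBound γ' M := by
  obtain ⟨C, hC, hb⟩ := hM
  refine ⟨C, hC, fun t ht => ⟨(hb t ht).1, (hb t ht).2.1.trans ?_,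
    fun x => ((hb t ht).2.2 x).trans ?_⟩⟩
  · have : 1 ≤ 1 + t := by linarith
    gcongr
  · have : 1 ≤ 1 + t := by linarith
    gcongr

lemma HasKernelBound.add {γ : ℝ} {M N : ℝ → R3 → ℂ} (hM : HasKernelBound γ M)
    (hN : HasKernelBound γ N) : HasKernelBound γ fun t => M t + N t := by
  obtain ⟨C, hC, hb⟩ := hM
  obtain ⟨D, hD, hc⟩ := hN
  refine ⟨C + D, by positivity, fun t ht => ⟨(hb t ht).1.add (hc t ht).1, ?_, fun x => ?_⟩⟩
  · calc _ ≤ ∫ x, (‖M t x‖ + ‖N t x‖) := integral_mono ((hb t ht).1.add (hc t ht).1).norm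
          ((hb t ht).1.norm.add (hc t ht).1.norm) fun x => norm_add_le _ _
      _ = _ := integral_add (hb t ht).1.norm (hc t ht).1.norm
      _ ≤ _ := add_le_add (hb t ht).2.1 (hc t ht).2.1
      _ = _ := by ring
  · calc _ ≤ ‖M t x‖ + ‖N t x‖ := norm_add_le _ _
      _ ≤ _ := add_le_add ((hb t ht).2.2 x) ((hc t ht).2.2 x)
      _ = _ := by ring

lemma HasKernelBound.congr {γ : ℝ} {M N : ℝ → R3 → ℂ} (hM : HasKernelBound γ M)
    (h : ∀ t, 0 ≤ t → N t = M t) : HasKernelBound γ N := by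
  obtain ⟨C, hC, hb⟩ := hM
  exact ⟨C, hC, fun t ht => by rw [h t ht]; exact hb t ht⟩

/-- Symbols `m` whose kernels obey some decay bound and whose derivatives `∂_A` of order `α`
factor through all derivatives `∂_I` of order `k`, with kernels of decay `γ`. -/
structure IsAdmissible (α k : ℕ) (γ : ℝ) (m : ℝ → R3 → ℂ) : Prop where
  isBddSymbol : ∀ t, 0 ≤ t → IsBddSymbol (m t)
  hasKernelBound : ∃ γ', HasKernelBound γ' fun t => invFourier (m t)
  factor : ∀ A : Fin α → Fin 3, ∃ n : (Fin k → Fin 3) → ℝ → R3 → ℂ,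
    (∀ I, (∀ t, 0 ≤ t → IsBddSymbol (n I t)) ∧ HasKernelBound γ fun t => invFourier (n I t)) ∧
    ∀ t, 0 ≤ t → ∀ ξ, derivSymbol A ξ * m t ξ = ∑ I, derivSymbol I ξ * n I t ξ

lemma IsAdmissible.add {α k : ℕ} {γ : ℝ} {m n : ℝ → R3 → ℂ} (hm : IsAdmissible α k γ m)
    (hn : IsAdmissible α k γ n) : IsAdmissible α k γ fun t ξ => m t ξ + n t ξ := by
  refine ⟨fun t ht => (hm.isBddSymbol t ht).add (hn.isBddSymbol t ht), ?_, fun A => ?_⟩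
  · obtain ⟨γ₁, h1⟩ := hm.hasKernelBound
    obtain ⟨γ₂, h2⟩ := hn.hasKernelBound
    refine ⟨max γ₁ γ₂, ((h1.mono (le_max_left _ _)).add (h2.mono (le_max_right _ _))).congr
      fun t ht => invFourier_add (hm.isBddSymbol t ht) (hn.isBddSymbol t ht)⟩
  · obtain ⟨u, hu, hu'⟩ := hm.factor A
    obtain ⟨v, hv, hv'⟩ := hn.factor A
    refine ⟨fun I t ξ => u I t ξ + v I t ξ, fun I =>
      ⟨fun t ht => ((hu I).1 t ht).add ((hv I).1 t ht), ((hu I).2.add (hv I).2).congr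
        fun t ht => invFourier_add ((hu I).1 t ht) ((hv I).1 t ht)⟩, fun t ht ξ => ?_⟩
    simp only [mul_add, Finset.sum_add_distrib, hu' t ht ξ, hv' t ht ξ]

lemma IsAdmissible.congr {α k : ℕ} {γ : ℝ} {m n : ℝ → R3 → ℂ} (hm : IsAdmissible α k γ m)
    (h : ∀ t ξ, n t ξ = m t ξ) : IsAdmissible α k γ n := by
  have : n = m := by
    funext t ξ
    exact h t ξ
  rwa [this]

/-- Homogeneous multiples of localized wave symbols are admissible. -/
lemma isAdmissible_mul_waveSymbol {ν β c₀ e γ : ℝ} (hν : 0 < ν) (hβ : 0 < β) {S : ℝ → R3 → ℂ}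
    (hS : IsWaveSymbol ν β c₀ e S) {η : R3 → ℂ} (hη : IsCutSymbol c₀ η) {α k d : ℕ} {R : R3 → ℂ}
    (hR : IsHomPoly d R) (hk : k ≤ α + d) (hγ : e - ((α + d : ℕ) - k : ℝ) / 2 ≤ γ) :
    IsAdmissible α k γ fun t ξ => R ξ * (η ξ * S t ξ) := by
  refine ⟨fun t ht => isBddSymbol_mul_waveSymbol hν hS hη hR ht,
    ⟨_, hasKernelBound_invFourier hν hβ hS hη hR⟩, fun A => ?_⟩
  -- Of the total degree α + d, k factors go to g and d' = α + d - k remain in the kernel and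
  -- produce decay.
  obtain ⟨d', hd'⟩ := Nat.exists_eq_add_of_le hk
  have hAR := hR.mul (IsHomPoly.derivSymbol A)
  rw [hd'] at hAR
  obtain ⟨Q, hQ, hQe⟩ := IsHomPoly.exists_eq_sum_derivSymbol_mul k hAR
  refine ⟨fun I t ξ => Q I ξ * (η ξ * S t ξ), fun I =>
    ⟨fun t ht => isBddSymbol_mul_waveSymbol hν hS hη (hQ I) ht,
      (hasKernelBound_invFourier hν hβ hS hη (hQ I)).mono ?_⟩, fun t _ ξ => ?_⟩
  · rw [hd'] at hγ
    push_cast at hγ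
    linarith
  · have := congrFun hQe ξ
    rw [← mul_assoc, this, Finset.sum_mul]
    exact Finset.sum_congr rfl fun I _ => by ring

lemma isCutSymbol_polynomial {c₀ : ℝ} {χ : R3 → ℝ} (hχ : IsLowCutoff c₀ χ) (P : Polynomial ℝ) :
    IsCutSymbol c₀ fun ξ => ((P.eval (‖ξ‖ ^ 2) : ℝ) : ℂ) * (χ ξ : ℂ) := by
  refine hχ.isCutSymbol.smooth_mul (Complex.ofRealCLM.contDiff.comp ?_)
  have h1 : ContDiff ℝ (⊤ : ℕ∞) fun x : ℝ => P.eval x := by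
    simpa using P.contDiff_aeval (𝕜 := ℝ) (⊤ : ℕ∞)
  exact h1.comp (contDiff_norm_sq ℝ)

/-- `ξ_a ξ_b |ξ|^{2j}`. -/
def quadMonomial (a b : Fin 3) (j : ℕ) (ξ : R3) : ℂ :=
  (ξ a : ℂ) * (ξ b : ℂ) * ((‖ξ‖ ^ 2 : ℝ) : ℂ) ^ j

lemma isHomPoly_quadMonomial (a b : Fin 3) (j : ℕ) :
    IsHomPoly (2 + 2 * j) (quadMonomial a b j) :=
  (IsHomPoly.normSq_pow j).mul ((IsHomPoly.coord b).mul (IsHomPoly.coord a))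

lemma rieszSymbol_mul (a b : Fin 3) (ξ : R3) :
    rieszSymbol a ξ * rieszSymbol b ξ = (ξ a : ℂ) * (ξ b : ℂ) / ((‖ξ‖ ^ 2 : ℝ) : ℂ) := by
  simp only [rieszSymbol]
  push_cast
  rw [div_mul_div_comm, sq]

/-- The continuous version of `𝒢₁`. -/
def freeWaveSin (ν β t : ℝ) (ξ : R3) : ℂ :=
  ((Real.exp (-(ν * ‖ξ‖ ^ 2 / 2) * t) * (t * Real.sinc (t * (β * ‖ξ‖))) : ℝ) : ℂ)

lemma lowSymbol_zero (f : R3 → ℂ) (χ : R3 → ℝ) (a b : Fin 3) : lowSymbol f χ a b 0 = 0 := by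
  simp [lowSymbol, rieszSymbol]

/-- Division by zero makes 𝒢₁ vanish at ξ = 0 instead of taking its limit; the Riesz symbols vanish
there, so the continuous version can be used. -/
lemma lowSymbol_symbolG1 {ν β : ℝ} (hβ : 0 < β) (χ : R3 → ℝ) (a b : Fin 3) (t : ℝ) :
    lowSymbol (symbolG1 ν β t) χ a b = lowSymbol (freeWaveSin ν β t) χ a b := by
  funext ξ
  by_cases h0 : ξ = 0
  · rw [h0, lowSymbol_zero, lowSymbol_zero]
  · rw [lowSymbol, lowSymbol, symbolG1_eq hβ t h0, freeWaveSin]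

lemma spaceDeriv_lowKernel {β : ℝ} {χ : R3 → ℝ} (a b : Fin 3) (n : ℕ)
    {f : ℝ → R3 → ℂ} {t : ℝ} (hf : IsBddSymbol (lowSymbol (f t) χ a b)) :
    spaceDeriv β n (lowKernel f χ a b) t = invFourier fun ξ =>
      (-1) ^ n * (β : ℂ) ^ (2 * n) * (((‖ξ‖ ^ (2 * n) : ℝ) : ℂ) * lowSymbol (f t) χ a b ξ) := by
  rw [invFourier_const_mul, ← negLaplacianPow_invFourier n hf]
  rfl

lemma C_neg_sq_pow (β : ℝ) (n : ℕ) (x : ℝ) :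
    ((((-Polynomial.C (β ^ 2)) ^ n).eval x : ℝ) : ℂ) = (-1) ^ n * (β : ℂ) ^ (2 * n) := by
  simp only [Polynomial.eval_pow, Polynomial.eval_neg, Polynomial.eval_C]
  push_cast
  rw [neg_pow, pow_mul]

/-- Three wave terms make an admissible symbol. -/
lemma isAdmissible_three {ν β c₀ : ℝ} (hν : 0 < ν) (hβ : 0 < β) {χ : R3 → ℝ}
    (hχ : IsLowCutoff c₀ χ) (a b : Fin 3) {α k : ℕ} {γ : ℝ} {m : ℝ → R3 → ℂ}
    {S : Fin 3 → ℝ → R3 → ℂ} {e : Fin 3 → ℝ} (hS : ∀ i, IsWaveSymbol ν β c₀ (e i) (S i))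
    {P : Fin 3 → Polynomial ℝ} {j : Fin 3 → ℕ} (hk : ∀ i, k ≤ α + (2 + 2 * j i))
    (hγ : ∀ i, e i - ((α : ℝ) + (2 + 2 * j i) - k : ℝ) / 2 ≤ γ)
    (hm : ∀ t ξ, m t ξ = ∑ i, quadMonomial a b (j i) ξ *
      ((((P i).eval (‖ξ‖ ^ 2) : ℝ) : ℂ) * (χ ξ : ℂ) * S i t ξ)) : IsAdmissible α k γ m := by
  have h := fun i => isAdmissible_mul_waveSymbol (α := α) (k := k) (γ := γ) hν hβ (hS i)
    (isCutSymbol_polynomial hχ (P i)) (isHomPoly_quadMonomial a b (j i)) (hk i)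
    (by have := hγ i; push_cast; exact this)
  refine (((h 0).add (h 1)).add (h 2)).congr fun t ξ => ?_
  rw [hm, Fin.sum_univ_three]

/-! ### The four expansions -/

section Expansion

open Polynomial

variable {ν β c₀ : ℝ} {χ : R3 → ℝ} {α k m : ℕ} {γ : ℝ}

/-- All three terms have degree 2 + 2m after one |ξ|² cancels the Riesz denominator. The orders 1,
1/2, 1 then give exponents at most -m before α and k are counted, attained by the cosine difference
and the 𝒦₁ term. -/
lemma isAdmissible_cos_even (hν : 0 < ν) (hβ : 0 < β) (hc₀ : 0 < c₀) (hc : c₀ < 2 * β / ν)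
    (hχ : IsLowCutoff c₀ χ) (a b : Fin 3) (hk : k ≤ α + 2 * m)
    (hγ : -((α : ℝ) + 2 * m - k) / 2 ≤ γ) : IsAdmissible α k γ fun t ξ =>
      lowSymbol (waveComb ν β ((timeStep ν β)^[2 * m] (1, 0)) t) χ a b ξ -
      (-1) ^ m * (β : ℂ) ^ (2 * m) *
        (((‖ξ‖ ^ (2 * m) : ℝ) : ℂ) * lowSymbol (symbolG0 ν β t) χ a b ξ) := by
  obtain ⟨P, Q, hPQ⟩ := (timeStep_iterate_cos ν β m).1
  rw [hPQ]
  refine isAdmissible_three hν hβ hχ a b (S := ![waveCosDiff ν β, symbolK00 ν β, waveSin ν β])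
    (e := ![1, 1 / 2, 1]) (P := ![(-C (β ^ 2)) ^ m, P, Q]) (j := ![m, m, m]) ?_ ?_ ?_ ?_
  · intro i
    fin_cases i
    · exact isWaveSymbol_waveCosDiff hν hβ hc₀ hc
    · exact isWaveSymbol_symbolK00 hν hβ hc₀ hc
    · exact isWaveSymbol_waveSin hν hβ hc₀ hc
  · intro i
    fin_cases i <;> simp <;> omega
  · intro i
    fin_cases i <;> simp <;> linarith
  · intro t ξ
    rw [Fin.sum_univ_three]
    by_cases h0 : ξ = 0
    · simp [h0, lowSymbol_zero, quadMonomial]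
    have hs : (‖ξ‖ : ℂ) ≠ 0 := by exact_mod_cast norm_ne_zero_iff.2 h0
    simp [lowSymbol, rieszSymbol_mul, waveComb, waveCosDiff, quadMonomial,
      ← C_neg_sq_pow β m (‖ξ‖ ^ 2)]
    field_simp
    ring

/-- Here 𝒦₁ leads: the sine difference gives 3/2 - (m + 2) and the 𝒦₀₀ remainder gives 1/2 - (m +
1), both equal to -(2m+1)/2. -/
lemma isAdmissible_cos_odd (hν : 0 < ν) (hβ : 0 < β) (hc₀ : 0 < c₀) (hc : c₀ < 2 * β / ν)
    (hχ : IsLowCutoff c₀ χ) (a b : Fin 3) (hk : k ≤ α + (2 * m + 1))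
    (hγ : -((α : ℝ) + (2 * m + 1) - k) / 2 ≤ γ) : IsAdmissible α k γ fun t ξ =>
      lowSymbol (waveComb ν β ((timeStep ν β)^[2 * m + 1] (1, 0)) t) χ a b ξ -
      (-1) ^ (m + 1) * (β : ℂ) ^ (2 * (m + 1)) *
        (((‖ξ‖ ^ (2 * (m + 1)) : ℝ) : ℂ) * lowSymbol (symbolG1 ν β t) χ a b ξ) := by
  obtain ⟨P, Q, hPQ⟩ := (timeStep_iterate_cos ν β m).2
  rw [hPQ]
  refine isAdmissible_three hν hβ hχ a b (S := ![waveSinDiff ν β, symbolK00 ν β, waveSin ν β])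
    (e := ![3 / 2, 1 / 2, 1]) (P := ![(-C (β ^ 2)) ^ (m + 1), P, Q]) (j := ![m + 1, m, m + 1]) ?_ ?_ ?_ ?_
  · intro i
    fin_cases i
    · exact isWaveSymbol_waveSinDiff hν hβ hc₀ hc
    · exact isWaveSymbol_symbolK00 hν hβ hc₀ hc
    · exact isWaveSymbol_waveSin hν hβ hc₀ hc
  · intro i
    fin_cases i <;> simp <;> omega
  · intro i
    fin_cases i <;> simp <;> linarith
  · intro t ξ
    rw [Fin.sum_univ_three]
    by_cases h0 : ξ = 0
    · simp [h0, lowSymbol_zero, quadMonomial]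
    have hs : (‖ξ‖ : ℂ) ≠ 0 := by exact_mod_cast norm_ne_zero_iff.2 h0
    simp [lowSymbol, rieszSymbol_mul, waveComb, waveSinDiff, quadMonomial,
      ← C_neg_sq_pow β (m + 1) (‖ξ‖ ^ 2)]
    field_simp
    ring

lemma isAdmissible_sin_odd (hν : 0 < ν) (hβ : 0 < β) (hc₀ : 0 < c₀) (hc : c₀ < 2 * β / ν)
    (hχ : IsLowCutoff c₀ χ) (a b : Fin 3) (hk : k ≤ α + (2 * m + 1))
    (hγ : -((α : ℝ) + (2 * m + 1) - k) / 2 + 1 / 2 ≤ γ) : IsAdmissible α k γ fun t ξ =>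
      lowSymbol (waveComb ν β ((timeStep ν β)^[2 * m + 1] (0, 1)) t) χ a b ξ -
      (-1) ^ m * (β : ℂ) ^ (2 * m) *
        (((‖ξ‖ ^ (2 * m) : ℝ) : ℂ) * lowSymbol (symbolG0 ν β t) χ a b ξ) := by
  obtain ⟨P, Q, hPQ⟩ := (timeStep_iterate_sin ν β m).2
  rw [hPQ]
  refine isAdmissible_three hν hβ hχ a b (S := ![waveCosDiff ν β, symbolK00 ν β, waveSin ν β])
    (e := ![1, 1 / 2, 1]) (P := ![(-C (β ^ 2)) ^ m, P, Q]) (j := ![m, m, m]) ?_ ?_ ?_ ?_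
  · intro i
    fin_cases i
    · exact isWaveSymbol_waveCosDiff hν hβ hc₀ hc
    · exact isWaveSymbol_symbolK00 hν hβ hc₀ hc
    · exact isWaveSymbol_waveSin hν hβ hc₀ hc
  · intro i
    fin_cases i <;> simp <;> omega
  · intro i
    fin_cases i <;> simp <;> linarith
  · intro t ξ
    rw [Fin.sum_univ_three]
    by_cases h0 : ξ = 0
    · simp [h0, lowSymbol_zero, quadMonomial]
    have hs : (‖ξ‖ : ℂ) ≠ 0 := by exact_mod_cast norm_ne_zero_iff.2 h0
    simp [lowSymbol, rieszSymbol_mul, waveComb, waveCosDiff, quadMonomial,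
      ← C_neg_sq_pow β m (‖ξ‖ ^ 2)]
    field_simp
    ring

/-- The sine difference gives 3/2 - (m + 1) = 1/2 - m. The 𝒦₀₀ remainder has one power of |ξ|² less,
hence degree index m - 1, and for m ≥ 1 reaches the same exponent since its order is only 1/2. -/
lemma isAdmissible_sin_even (hν : 0 < ν) (hβ : 0 < β) (hc₀ : 0 < c₀) (hc : c₀ < 2 * β / ν)
    (hχ : IsLowCutoff c₀ χ) (a b : Fin 3) (hk : k ≤ α + 2 * m)
    (hγ : -((α : ℝ) + 2 * m - k) / 2 + 1 / 2 ≤ γ) : IsAdmissible α k γ fun t ξ =>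
      lowSymbol (waveComb ν β ((timeStep ν β)^[2 * m] (0, 1)) t) χ a b ξ -
      (-1) ^ m * (β : ℂ) ^ (2 * m) *
        (((‖ξ‖ ^ (2 * m) : ℝ) : ℂ) * lowSymbol (symbolG1 ν β t) χ a b ξ) := by
  obtain ⟨P, Q, hP, hPQ⟩ := (timeStep_iterate_sin ν β m).1
  rw [hPQ]
  refine isAdmissible_three hν hβ hχ a b (S := ![waveSinDiff ν β, symbolK00 ν β, waveSin ν β])
    (e := ![3 / 2, 1 / 2, 1]) (P := ![(-C (β ^ 2)) ^ m, P, Q]) (j := ![m, m - 1, m]) ?_ ?_ ?_ ?_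
  · intro i
    fin_cases i
    · exact isWaveSymbol_waveSinDiff hν hβ hc₀ hc
    · exact isWaveSymbol_symbolK00 hν hβ hc₀ hc
    · exact isWaveSymbol_waveSin hν hβ hc₀ hc
  · intro i
    fin_cases i <;> simp <;> omega
  · intro i
    -- Truncated subtraction can only raise the degree, which is harmless for the exponent.
    have hm : (m : ℝ) - 1 ≤ ((m - 1 : ℕ) : ℝ) := by
      rcases m with - | m <;> simp
    fin_cases i <;> simp <;> linarith
  · intro t ξ
    rw [Fin.sum_univ_three]
    by_cases h0 : ξ = 0
    · simp [h0, lowSymbol_zero, quadMonomial]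
    have hs : (‖ξ‖ : ℂ) ≠ 0 := by exact_mod_cast norm_ne_zero_iff.2 h0
    -- For m = 0 the powers do not match, and the identity holds because P = 0.
    have hm : ((P.eval (‖ξ‖ ^ 2) : ℝ) : ℂ) * (‖ξ‖ ^ 2) ^ m =
        ((P.eval (‖ξ‖ ^ 2) : ℝ) : ℂ) * ((‖ξ‖ ^ 2) ^ (m - 1) * ‖ξ‖ ^ 2) := by
      rcases m with - | m
      · simp [hP rfl]
      · rw [Nat.add_sub_cancel, pow_succ _ m]
    simp [lowSymbol, rieszSymbol_mul, waveComb, waveSinDiff, quadMonomial,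
      ← C_neg_sq_pow β m (‖ξ‖ ^ 2)]
    field_simp
    linear_combination (((ξ a : ℝ) : ℂ) * ((ξ b : ℝ) : ℂ) * (χ ξ : ℂ) * symbolK00 ν β t ξ) * hm

end Expansion

/-! ### Young's inequality from L¹ and sup bounds -/

section Young

variable {K F : R3 → ℝ≥0∞}

/-- Comparison of the L¹ and L^q norms of F for the measure K dt, whose total mass is ∫K. -/
lemma rpow_lintegral_mul_le (hK : Measurable K) (hF : Measurable F) {q : ℝ} (hq : 1 ≤ q) :
    (∫⁻ t, K t * F t) ^ q ≤ (∫⁻ t, K t) ^ (q - 1) * ∫⁻ t, K t * F t ^ q := by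
  have hq0 : 0 < q := by linarith
  have h := eLpNorm'_le_eLpNorm'_mul_rpow_measure_univ (μ := volume.withDensity K) zero_lt_one hq
    hF.aestronglyMeasurable
  simp only [eLpNorm', enorm_eq_self, ENNReal.rpow_one, div_one] at h
  rw [lintegral_withDensity_eq_lintegral_mul _ hK hF,
    lintegral_withDensity_eq_lintegral_mul _ hK (hF.pow_const q), withDensity_apply _ MeasurableSet.univ,
    Measure.restrict_univ] at h
  simp only [Pi.mul_apply] at h
  have h2 := ENNReal.rpow_le_rpow h hq0.le
  rw [ENNReal.mul_rpow_of_nonneg _ _ hq0.le, ← ENNReal.rpow_mul, ← ENNReal.rpow_mul,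
    one_div_mul_cancel hq0.ne', ENNReal.rpow_one, sub_mul, one_mul, one_div_mul_cancel hq0.ne'] at h2
  rwa [mul_comm]

/-- The convolution of nonnegative functions. -/
def posConv (K F : R3 → ℝ≥0∞) (x : R3) : ℝ≥0∞ := ∫⁻ t, K t * F (x - t)

lemma measurable_posConv (hK : Measurable K) (hF : Measurable F) : Measurable (posConv K F) := by
  unfold posConv
  exact Measurable.lintegral_prod_right' (f := fun y : R3 × R3 => K y.2 * F (y.1 - y.2))
    (by fun_prop)

lemma lintegral_posConv (hK : Measurable K) (hF : Measurable F) :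
    ∫⁻ x, posConv K F x = (∫⁻ t, K t) * ∫⁻ t, F t := by
  unfold posConv
  rw [lintegral_lintegral_swap (f := fun x t => K t * F (x - t))
    (by fun_prop)]
  have : ∀ t, ∫⁻ x, K t * F (x - t) = K t * ∫⁻ x, F x := fun t => by
    rw [lintegral_const_mul _ (by fun_prop), lintegral_sub_right_eq_self F t]
  simp only [this]
  exact lintegral_mul_const _ hK

lemma posConv_le_of_le {κ : ℝ≥0∞} (hb : ∀ x, K x ≤ κ) (hF : Measurable F) (x : R3) :
    posConv K F x ≤ κ * ∫⁻ t, F t := by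
  unfold posConv
  rw [← lintegral_sub_left_eq_self F x, ← lintegral_const_mul _ (by fun_prop)]
  exact lintegral_mono fun t => by gcongr; exact hb t

lemma rpow_posConv_le (hK : Measurable K) (hF : Measurable F) {q : ℝ} (hq : 1 ≤ q) (x : R3) :
    posConv K F x ^ q ≤ (∫⁻ t, K t) ^ (q - 1) * posConv K (fun y => F y ^ q) x :=
  rpow_lintegral_mul_le hK (F := fun t => F (x - t)) (by fun_prop) hq

/-- Young's inequality in `L^p`, in terms of an `L¹` bound and a sup bound of the kernel. -/
lemma lintegral_rpow_posConv_le (hK : Measurable K) (hF : Measurable F) {κ₁ κ : ℝ≥0∞}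
    (h1 : ∫⁻ t, K t ≤ κ₁) (hb : ∀ x, K x ≤ κ) {p q : ℝ} (hq : 1 ≤ q) (hqp : q ≤ p) :
    (∫⁻ x, posConv K F x ^ p) ^ (1 / p) ≤
      κ₁ ^ (1 - (1 / q - 1 / p)) * κ ^ (1 / q - 1 / p) * (∫⁻ x, F x ^ q) ^ (1 / q) := by
  have hq0 : 0 < q := by linarith
  have hp0 : 0 < p := by linarith
  set I := ∫⁻ x, F x ^ q
  have hFq := hF.pow_const q
  have hpq : 0 ≤ p / q - 1 := by rw [sub_nonneg, one_le_div hq0]; exact hqp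
  -- After (K ∗ F)^q ≤ κ₁^{q-1} K ∗ F^q is raised to p/q, the power p/q - 1 of K ∗ F^q is bounded by
  -- its supremum and a single power is kept for integration.
  have hpt : ∀ x, posConv K F x ^ p ≤ κ₁ ^ ((q - 1) * (p / q)) * (κ * I) ^ (p / q - 1) *
      posConv K (fun y => F y ^ q) x := by
    intro x
    calc posConv K F x ^ p = (posConv K F x ^ q) ^ (p / q) := by
          rw [← ENNReal.rpow_mul]; congr 1; field_simp
      _ ≤ (κ₁ ^ (q - 1) * posConv K (fun y => F y ^ q) x) ^ (p / q) := by
          refine ENNReal.rpow_le_rpow ((rpow_posConv_le hK hF hq x).trans ?_) (by positivity)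
          gcongr
      _ = κ₁ ^ ((q - 1) * (p / q)) * (posConv K (fun y => F y ^ q) x ^ (p / q - 1) *
          posConv K (fun y => F y ^ q) x) := by
          rw [ENNReal.mul_rpow_of_nonneg _ _ (by positivity), ← ENNReal.rpow_mul]
          congr 1
          nth_rewrite 3 [← ENNReal.rpow_one (posConv K (fun y => F y ^ q) x)]
          rw [← ENNReal.rpow_add_of_nonneg _ _ hpq zero_le_one, sub_add_cancel]
      _ ≤ _ := by
          rw [← mul_assoc]
          gcongr
          exact posConv_le_of_le hb hFq x
  calc (∫⁻ x, posConv K F x ^ p) ^ (1 / p) ≤ (κ₁ ^ ((q - 1) * (p / q)) * (κ * I) ^ (p / q - 1) *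
        (κ₁ * I)) ^ (1 / p) := by
        refine ENNReal.rpow_le_rpow ((lintegral_mono hpt).trans ?_) (by positivity)
        rw [lintegral_const_mul _ (measurable_posConv hK hFq), lintegral_posConv hK hFq]
        gcongr
    _ = _ := by
        have e1 : 0 ≤ 1 / p := by positivity
        have e2 : 0 ≤ (q - 1) * (p / q) * (1 / p) := by
          have : 0 ≤ q - 1 := by linarith
          positivity
        have e3 : 0 ≤ (p / q - 1) * (1 / p) := by positivity
        rw [ENNReal.mul_rpow_of_nonneg _ _ hpq, ENNReal.mul_rpow_of_nonneg _ _ e1,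
          ENNReal.mul_rpow_of_nonneg _ _ e1, ENNReal.mul_rpow_of_nonneg _ _ e1,
          ENNReal.mul_rpow_of_nonneg _ _ e1, ← ENNReal.rpow_mul, ← ENNReal.rpow_mul,
          ← ENNReal.rpow_mul]
        have e4 : 1 - (1 / q - 1 / p) = (q - 1) * (p / q) * (1 / p) + 1 / p := by
          field_simp; ring
        have e5 : 1 / q = (p / q - 1) * (1 / p) + 1 / p := by field_simp; ring
        have e6 : 1 / q - 1 / p = (p / q - 1) * (1 / p) := by field_simp
        rw [e4, e6, ENNReal.rpow_add_of_nonneg _ _ e2 e1, e5, ENNReal.rpow_add_of_nonneg _ _ e3 e1]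
        ring

/-- The endpoint p = ∞, where the sup bound is applied to K ∗ F^q and no integration in x is left.
-/
lemma posConv_le_rpow (hK : Measurable K) (hF : Measurable F) {κ₁ κ : ℝ≥0∞}
    (h1 : ∫⁻ t, K t ≤ κ₁) (hb : ∀ x, K x ≤ κ) {q : ℝ} (hq : 1 ≤ q) (x : R3) :
    posConv K F x ≤ κ₁ ^ (1 - 1 / q) * κ ^ (1 / q) * (∫⁻ x, F x ^ q) ^ (1 / q) := by
  have hq0 : 0 < q := by linarith
  have h := ENNReal.rpow_le_rpow ((rpow_posConv_le hK hF hq x).trans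
    (mul_le_mul' (ENNReal.rpow_le_rpow h1 (by linarith)) (posConv_le_of_le hb (hF.pow_const q) x)))
    (z := 1 / q) (by positivity)
  rw [← ENNReal.rpow_mul, mul_one_div_cancel hq0.ne', ENNReal.rpow_one,
    ENNReal.mul_rpow_of_nonneg _ _ (by positivity), ENNReal.mul_rpow_of_nonneg _ _ (by positivity),
    ← ENNReal.rpow_mul, ← mul_assoc] at h
  refine h.trans_eq ?_
  congr 3
  field_simp

end Young

lemma posConv_enorm_le {M f : R3 → ℂ} (hM : Continuous M) (hf : Measurable f) {κ₁ κ : ℝ≥0∞}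
    (h1 : ∫⁻ t, ‖M t‖ₑ ≤ κ₁) (hb : ∀ x, ‖M x‖ₑ ≤ κ) {q : ℝ≥0∞} (hq : 1 ≤ q) (x : R3) :
    posConv (fun t => ‖M t‖ₑ) (fun t => ‖f t‖ₑ) x ≤
      κ₁ ^ (1 - (q⁻¹).toReal) * κ ^ (q⁻¹).toReal * eLpNorm f q volume := by
  have hMm : Measurable fun t => ‖M t‖ₑ := hM.measurable.enorm
  by_cases hqt : q = ∞
  · subst hqt
    simp only [ENNReal.inv_top, ENNReal.toReal_zero, sub_zero, ENNReal.rpow_one, ENNReal.rpow_zero,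
      mul_one, eLpNorm_exponent_top]
    have hess : ∀ᵐ t : R3, ‖f (x - t)‖ₑ ≤ eLpNormEssSup f volume :=
      (quasiMeasurePreserving_sub_left volume x).ae (enorm_ae_le_eLpNormEssSup f volume)
    calc posConv (fun t => ‖M t‖ₑ) (fun t => ‖f t‖ₑ) x ≤
          ∫⁻ t, ‖M t‖ₑ * eLpNormEssSup f volume := by
          refine lintegral_mono_ae ?_
          filter_upwards [hess] with t ht
          gcongr
      _ ≤ _ := by
          rw [lintegral_mul_const _ hMm]
          gcongr
  · have hq1 : 1 ≤ q.toReal := by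
      rw [← ENNReal.toReal_one]; exact ENNReal.toReal_mono hqt hq
    rw [eLpNorm_eq_lintegral_rpow_enorm_toReal (zero_lt_one.trans_le hq).ne' hqt,
      ENNReal.toReal_inv, ← one_div]
    exact posConv_le_rpow hMm hf.enorm h1 hb hq1 x

/-- Young's inequality, in terms of an `L¹` bound and a sup bound of the kernel. -/
lemma eLpNorm_posConv_le {M f : R3 → ℂ} (hM : Continuous M) (hf : Measurable f) {κ₁ κ : ℝ≥0∞}
    (h1 : ∫⁻ t, ‖M t‖ₑ ≤ κ₁) (hb : ∀ x, ‖M x‖ₑ ≤ κ) {p q : ℝ≥0∞} (hq : 1 ≤ q) (hqp : q ≤ p) :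
    eLpNorm (posConv (fun t => ‖M t‖ₑ) fun t => ‖f t‖ₑ) p volume ≤
      κ₁ ^ (1 - ((q⁻¹).toReal - (p⁻¹).toReal)) * κ ^ ((q⁻¹).toReal - (p⁻¹).toReal) *
        eLpNorm f q volume := by
  by_cases hpt : p = ∞
  · subst hpt
    simp only [ENNReal.inv_top, ENNReal.toReal_zero, sub_zero, eLpNorm_exponent_top]
    exact eLpNormEssSup_le_of_ae_enorm_bound (Filter.Eventually.of_forall
      (posConv_enorm_le hM hf h1 hb hq))
  · have hqt : q ≠ ∞ := (hqp.trans_lt (lt_top_iff_ne_top.2 hpt)).ne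
    have hq1 : 1 ≤ q.toReal := by
      rw [← ENNReal.toReal_one]; exact ENNReal.toReal_mono hqt hq
    rw [eLpNorm_eq_lintegral_rpow_enorm_toReal (zero_lt_one.trans_le hq).ne' hqt,
      eLpNorm_eq_lintegral_rpow_enorm_toReal (zero_lt_one.trans_le (hq.trans hqp)).ne' hpt,
      ENNReal.toReal_inv, ENNReal.toReal_inv, ← one_div, ← one_div]
    simp only [enorm_eq_self]
    exact lintegral_rpow_posConv_le hM.measurable.enorm hf.enorm h1 hb hq1
      (ENNReal.toReal_mono hpt hqp)

lemma conv_congr_ae_right {M f g : R3 → ℂ} (h : f =ᵐ[volume] g) : conv M f = conv M g := by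
  funext x
  simp only [conv, convolution_def]
  refine integral_congr_ae ?_
  filter_upwards [(quasiMeasurePreserving_sub_left volume x).ae h] with t ht
  rw [ht]

lemma aestronglyMeasurable_conv {M f : R3 → ℂ} (hM : Continuous M)
    (hf : AEStronglyMeasurable f volume) : AEStronglyMeasurable (conv M f) volume :=
  (hM.aestronglyMeasurable.convolution_integrand (ContinuousLinearMap.mul ℂ ℂ)
    hf (μ := volume) (ν := volume)).integral_prod_right'

/-- Young's inequality for kernels in `L¹ ∩ L^∞`. -/
lemma eLpNorm_conv_le {M f : R3 → ℂ} (hM : Continuous M) (hf : AEStronglyMeasurable f volume)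
    {κ₁ κ : ℝ≥0∞} (h1 : ∫⁻ t, ‖M t‖ₑ ≤ κ₁) (hb : ∀ x, ‖M x‖ₑ ≤ κ) {p q : ℝ≥0∞} (hq : 1 ≤ q)
    (hqp : q ≤ p) : eLpNorm (conv M f) p volume ≤
      κ₁ ^ (1 - ((q⁻¹).toReal - (p⁻¹).toReal)) * κ ^ ((q⁻¹).toReal - (p⁻¹).toReal) *
        eLpNorm f q volume := by
  rw [conv_congr_ae_right hf.ae_eq_mk, eLpNorm_congr_ae hf.ae_eq_mk]
  refine le_trans (eLpNorm_mono_enorm fun x => ?_)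
    (eLpNorm_posConv_le hM hf.stronglyMeasurable_mk.measurable h1 hb hq hqp)
  simp only [conv, convolution_def]
  refine (enorm_integral_le_lintegral_enorm _).trans_eq ?_
  simp [posConv]

lemma toReal_inv_le_one {q : ℝ≥0∞} (hq : 1 ≤ q) : (q⁻¹).toReal ≤ 1 := by
  rw [← ENNReal.toReal_one]
  exact ENNReal.toReal_mono ENNReal.one_ne_top (ENNReal.inv_le_one.2 hq)

/-- The convolution of a kernel in `L¹ ∩ L^∞` with an `L^q` function converges everywhere. -/
lemma convExists_of_memLp {M f : R3 → ℂ} (hM : Continuous M) (hi : Integrable M) {κ : ℝ}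
    (hb : ∀ x, ‖M x‖ ≤ κ) {q : ℝ≥0∞} (hq : 1 ≤ q) (hf : MemLp f q volume) : ConvExists M f := by
  intro x
  have hqm := quasiMeasurePreserving_sub_left (volume : Measure R3) x
  have hfx : AEStronglyMeasurable (fun t => f (x - t)) volume :=
    hf.1.comp_quasiMeasurePreserving hqm
  refine ⟨hM.aestronglyMeasurable.mul hfx, ?_⟩
  have hb' : ∀ x, ‖M x‖ₑ ≤ ENNReal.ofReal κ := fun x => by
    rw [← ofReal_norm]; exact ENNReal.ofReal_le_ofReal (hb x)
  have h := posConv_enorm_le hM hf.1.stronglyMeasurable_mk.measurable le_rfl hb' hq x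
  rw [← eLpNorm_congr_ae hf.1.ae_eq_mk] at h
  have h2 : ∫⁻ t, ‖(ContinuousLinearMap.mul ℂ ℂ) (M t) (f (x - t))‖ₑ =
      posConv (fun t => ‖M t‖ₑ) (fun t => ‖hf.1.mk f t‖ₑ) x := by
    refine lintegral_congr_ae ?_
    filter_upwards [hqm.ae hf.1.ae_eq_mk] with t ht
    simp [ht]
  rw [HasFiniteIntegral, h2]
  refine h.trans_lt (ENNReal.mul_lt_top (ENNReal.mul_lt_top ?_ ?_) hf.2)
  · exact ENNReal.rpow_lt_top_of_nonneg (sub_nonneg.2 (toReal_inv_le_one hq)) hi.2.ne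
  · exact ENNReal.rpow_lt_top_of_nonneg ENNReal.toReal_nonneg ENNReal.ofReal_ne_top

/-! ### Pairing convolutions with test functions -/

section Translation

variable {f u M : R3 → ℂ} {r : ℝ≥0∞}

/-- A translation-invariant Hölder bound. -/
lemma exists_lintegral_mul_translate_le (hr : 1 ≤ r) (hf : MemLp f r volume) (hu : Continuous u)
    (hus : HasCompactSupport u) : ∃ B : ℝ≥0∞, B < ∞ ∧ ∀ z, ∫⁻ y, ‖f y‖ₑ * ‖u (y + z)‖ₑ ≤ B := by
  have hc := ENNReal.HolderConjugate.conjExponent hr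
  have huL : MemLp u r.conjExponent volume := hu.memLp_of_hasCompactSupport hus
  refine ⟨eLpNorm f r volume * eLpNorm u r.conjExponent volume, ENNReal.mul_lt_top hf.2 huL.2,
    fun z => ?_⟩
  have h := eLpNorm_smul_le_mul_eLpNorm (μ := (volume : Measure R3)) (p := r)
    (q := r.conjExponent) (r := 1) (f := fun y => u (y + z)) (φ := f)
    (hu.comp (continuous_add_const z)).aestronglyMeasurable hf.1
  have h2 : eLpNorm (fun y => u (y + z)) r.conjExponent volume =
      eLpNorm u r.conjExponent volume :=
    eLpNorm_comp_measurePreserving hu.aestronglyMeasurable (measurePreserving_add_right volume z)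
  rw [h2, eLpNorm_one_eq_lintegral_enorm] at h
  simpa [enorm_mul] using h

lemma integrable_pairing (hr : 1 ≤ r) (hf : MemLp f r volume) (hu : Continuous u)
    (hus : HasCompactSupport u) (hM : Continuous M) (hi : Integrable M) :
    Integrable (fun y : R3 × R3 => f y.1 * (M y.2 * u (y.1 + y.2)))
      ((volume : Measure R3).prod volume) := by
  obtain ⟨B, hB, hb⟩ := exists_lintegral_mul_translate_le hr hf hu hus
  have hm : AEStronglyMeasurable (fun y : R3 × R3 => f y.1 * (M y.2 * u (y.1 + y.2)))
      ((volume : Measure R3).prod volume) :=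
    hf.1.comp_fst.mul (Continuous.aestronglyMeasurable (by fun_prop))
  refine ⟨hm, ?_⟩
  rw [HasFiniteIntegral, lintegral_prod_symm _ hm.enorm]
  refine (lintegral_mono (g := fun z => ‖M z‖ₑ * B) fun z => ?_).trans_lt ?_
  · simp only [enorm_mul]
    calc _ = ∫⁻ y, ‖M z‖ₑ * (‖f y‖ₑ * ‖u (y + z)‖ₑ) := by
          refine lintegral_congr fun y => by ring
      _ = ‖M z‖ₑ * ∫⁻ y, ‖f y‖ₑ * ‖u (y + z)‖ₑ := lintegral_const_mul' _ _ enorm_ne_top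
      _ ≤ _ := by gcongr; exact hb z
  · rw [lintegral_mul_const _ hM.measurable.enorm]
    exact ENNReal.mul_lt_top hi.2 hB

lemma integral_pairing_swap (hr : 1 ≤ r) (hf : MemLp f r volume) (hu : Continuous u)
    (hus : HasCompactSupport u) (hM : Continuous M) (hi : Integrable M) :
    ∫ y, f y * ∫ z, M z * u (y + z) = ∫ z, M z * ∫ y, f y * u (y + z) := by
  have h := integral_integral_swap (f := fun y z => f y * (M z * u (y + z)))
    (integrable_pairing hr hf hu hus hM hi)
  simp only [integral_const_mul] at h
  rw [h]
  refine integral_congr_ae (Filter.Eventually.of_forall fun z => ?_)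
  simp only
  rw [← integral_const_mul]
  exact integral_congr_ae (Filter.Eventually.of_forall fun y => by simp only; ring)

/-- Fubini and a shift of the inner variable put all the action on z ↦ ∫ f(y) u(y + z) dy. Absolute
convergence holds since that pairing is bounded uniformly in z by Hölder and the kernel is
integrable. -/
lemma integral_conv_mul (hr : 1 ≤ r) (hf : MemLp f r volume) (hu : Continuous u)
    (hus : HasCompactSupport u) (hM : Continuous M) (hi : Integrable M) :
    ∫ x, conv M f x * u x = ∫ z, M z * ∫ y, f y * u (y + z) := by
  obtain ⟨B, hB, hb⟩ := exists_lintegral_mul_translate_le hr hf hu hus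
  have hm : AEStronglyMeasurable (fun y : R3 × R3 => M y.2 * f (y.1 - y.2) * u y.1)
      ((volume : Measure R3).prod volume) :=
    (hM.aestronglyMeasurable.convolution_integrand (ContinuousLinearMap.mul ℂ ℂ)
      hf.1 (μ := volume) (ν := volume)).mul (hu.comp continuous_fst).aestronglyMeasurable
  have hint : Integrable (fun y : R3 × R3 => M y.2 * f (y.1 - y.2) * u y.1)
      ((volume : Measure R3).prod volume) := by
    refine ⟨hm, ?_⟩
    rw [HasFiniteIntegral, lintegral_prod_symm _ hm.enorm]
    refine (lintegral_mono (g := fun z => ‖M z‖ₑ * B) fun z => ?_).trans_lt ?_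
    · simp only [enorm_mul]
      calc _ = ∫⁻ y, ‖M z‖ₑ * (‖f (y - z)‖ₑ * ‖u y‖ₑ) := by
            refine lintegral_congr fun y => by ring
        _ = ‖M z‖ₑ * ∫⁻ y, ‖f (y - z)‖ₑ * ‖u y‖ₑ := lintegral_const_mul' _ _ enorm_ne_top
        _ = ‖M z‖ₑ * ∫⁻ y, ‖f y‖ₑ * ‖u (y + z)‖ₑ := by
            rw [← lintegral_sub_right_eq_self (fun y => ‖f y‖ₑ * ‖u (y + z)‖ₑ) z]
            simp
        _ ≤ _ := by gcongr; exact hb z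
    · rw [lintegral_mul_const _ hM.measurable.enorm]
      exact ENNReal.mul_lt_top hi.2 hB
  simp only [conv, convolution_def, ContinuousLinearMap.mul_apply', ← integral_mul_const]
  rw [integral_integral_swap hint]
  refine integral_congr_ae (Filter.Eventually.of_forall fun z => ?_)
  simp only
  rw [← integral_sub_right_eq_self (fun y => f y * u (y + z)) z, ← integral_const_mul]
  exact integral_congr_ae (Filter.Eventually.of_forall fun y => by simp only [sub_add_cancel]; ring)

end Translation

/-! ### Weak derivatives of convolutions -/

lemma derivSymbol_succ {k : ℕ} (I : Fin (k + 1) → Fin 3) (ξ : R3) :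
    derivSymbol I ξ = derivSymbol (fun i => I i.succ) ξ * (Complex.I * (ξ (I 0) : ℂ)) := by
  rw [derivSymbol, Fin.prod_univ_succ, mul_comm]
  rfl

lemma partialDeriv_succ {k : ℕ} (I : Fin (k + 1) → Fin 3) {u : R3 → ℂ}
    (hu : ContDiff ℝ (⊤ : ℕ∞) u) (x : R3) : partialDeriv I u x =
      fderiv ℝ (partialDeriv (fun i => I i.succ) u) x (EuclideanSpace.single (I 0) 1) := by
  have hd : DifferentiableAt ℝ (iteratedFDeriv ℝ k u) x :=
    (hu.differentiable_iteratedFDeriv (by exact_mod_cast ENat.natCast_lt_top k)) x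
  rw [partialDeriv, iteratedFDeriv_succ_apply_left]
  unfold partialDeriv
  rw [fderiv_continuousMultilinear_apply_const_apply hd]
  rfl

lemma contDiff_partialDeriv {k : ℕ} (I : Fin k → Fin 3) {u : R3 → ℂ}
    (hu : ContDiff ℝ (⊤ : ℕ∞) u) : ContDiff ℝ (⊤ : ℕ∞) (partialDeriv I u) := by
  have h : ContDiff ℝ (⊤ : ℕ∞) (iteratedFDeriv ℝ k u) :=
    hu.iteratedFDeriv_right (by exact_mod_cast le_top)
  exact (ContinuousMultilinearMap.apply ℝ (fun _ : Fin k => R3) ℂ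
    (fun i => EuclideanSpace.single (I i) (1 : ℝ))).contDiff.comp h

lemma hasCompactSupport_partialDeriv {k : ℕ} (I : Fin k → Fin 3) {u : R3 → ℂ}
    (hu : HasCompactSupport u) : HasCompactSupport (partialDeriv I u) :=
  (hu.iteratedFDeriv (𝕜 := ℝ) k).comp_left
    (g := fun L : ContinuousMultilinearMap ℝ (fun _ : Fin k => R3) ℂ =>
      L fun i => EuclideanSpace.single (I i) (1 : ℝ)) rfl

lemma partialDeriv_translate {k : ℕ} (I : Fin k → Fin 3) (u : R3 → ℂ) (y x : R3) :
    partialDeriv I (fun z => u (y + z)) x = partialDeriv I u (y + x) := by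
  rw [partialDeriv, iteratedFDeriv_comp_add_left]
  rfl

lemma fderiv_invFourier_single {m : R3 → ℂ} (hm : IsBddSymbol m) (j : Fin 3) (x : R3) :
    fderiv ℝ (invFourier m) x (EuclideanSpace.single j 1) =
      invFourier (fun ξ => Complex.I * (ξ j : ℂ) * m ξ) x := by
  have h := congrFun (partialDeriv_invFourier hm ![j]) x
  rw [partialDeriv, iteratedFDeriv_one_apply] at h
  simpa [derivSymbol] using h

/-- Integration by parts against a test function. -/
lemma integral_invFourier_mul_partialDeriv {k : ℕ} (I : Fin k → Fin 3) {u : R3 → ℂ}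
    (hu : ContDiff ℝ (⊤ : ℕ∞) u) (hus : HasCompactSupport u) {m : R3 → ℂ} (hm : IsBddSymbol m) :
    ∫ x, invFourier m x * partialDeriv I u x =
      (-1) ^ k * ∫ x, invFourier (fun ξ => derivSymbol I ξ * m ξ) x * u x := by
  induction k generalizing m with
  | zero => simp [derivSymbol, partialDeriv]
  | succ k ih =>
    set J : Fin k → Fin 3 := fun i => I i.succ
    have hm' : IsBddSymbol fun ξ => Complex.I * (ξ (I 0) : ℂ) * m ξ :=
      hm.continuous_mul (by fun_prop)
    have hv := contDiff_partialDeriv J hu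
    have hvs := hasCompactSupport_partialDeriv J hus
    have hF := contDiff_invFourier hm
    have hdv : Continuous fun x => fderiv ℝ (partialDeriv J u) x (EuclideanSpace.single (I 0) 1) :=
      (hv.continuous_fderiv (by simp)).clm_apply continuous_const
    have hdF : Continuous fun x => fderiv ℝ (invFourier m) x (EuclideanSpace.single (I 0) 1) :=
      (hF.continuous_fderiv (by simp)).clm_apply continuous_const
    have hdvs : HasCompactSupport fun x =>
        fderiv ℝ (partialDeriv J u) x (EuclideanSpace.single (I 0) 1) :=
      hvs.fderiv_apply ℝ _
    simp only [partialDeriv_succ I hu]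
    rw [integral_mul_fderiv_eq_neg_fderiv_mul_of_integrable
      ((hdF.mul hv.continuous).integrable_of_hasCompactSupport hvs.mul_left)
      ((hF.continuous.mul hdv).integrable_of_hasCompactSupport hdvs.mul_left)
      ((hF.continuous.mul hv.continuous).integrable_of_hasCompactSupport hvs.mul_left)
      (fun x _ => hF.differentiable (by simp) x) (fun x _ => hv.differentiable (by simp) x)]
    simp only [fderiv_invFourier_single hm]
    rw [ih J hm', pow_succ]
    simp only [derivSymbol_succ I, J, mul_assoc]
    ring

/-- If the symbol of `∂_A K` factors through derivatives of order `k`, the derivative `∂_A` of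
`K ∗ g` is expressed by `∇^k g`. -/
lemma integral_conv_mul_partialDeriv {α k : ℕ} {r q : ℝ≥0∞} (hr : 1 ≤ r) (hq : 1 ≤ q)
    {g : R3 → ℂ} {G : R3 → EuclideanSpace ℂ (Fin k → Fin 3)} (hg : MemLp g r volume)
    (hgG : HasWeakGrad k g G) (hG : MemLp G q volume) {m : R3 → ℂ} (hm : IsBddSymbol m)
    (hmi : Integrable (invFourier m)) (A : Fin α → Fin 3) {n : (Fin k → Fin 3) → R3 → ℂ}
    (hn : ∀ I, IsBddSymbol (n I)) (hni : ∀ I, Integrable (invFourier (n I)))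
    (h : ∀ ξ, derivSymbol A ξ * m ξ = ∑ I, derivSymbol I ξ * n I ξ) {u : R3 → ℂ}
    (hu : ContDiff ℝ (⊤ : ℕ∞) u) (hus : HasCompactSupport u) :
    ∫ x, conv (invFourier m) g x * partialDeriv A u x =
      (-1) ^ α * ∑ I, ∫ x, conv (invFourier (n I)) (fun y => G y I) x * u x := by
  have hGI : ∀ I, MemLp (fun y => G y I) q volume := fun I =>
    (EuclideanSpace.proj (𝕜 := ℂ) I).comp_memLp' hG
  have hut : ∀ y, ContDiff ℝ (⊤ : ℕ∞) fun z => u (y + z) := fun y =>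
    hu.comp (contDiff_const.add contDiff_id)
  have hust : ∀ y, HasCompactSupport fun z => u (y + z) := fun y =>
    hus.comp_homeomorph (Homeomorph.addLeft y)
  have hpc : ∀ {k : ℕ} (I : Fin k → Fin 3), Continuous (partialDeriv I u) := fun I =>
    (contDiff_partialDeriv I hu).continuous
  have hps : ∀ {k : ℕ} (I : Fin k → Fin 3), HasCompactSupport (partialDeriv I u) := fun I =>
    hasCompactSupport_partialDeriv I hus
  have hprod : ∀ (F : R3 → ℂ) (_ : Continuous F) (y : R3),
      Integrable fun z => F z * u (y + z) := fun F hF y =>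
    (hF.mul (hut y).continuous).integrable_of_hasCompactSupport (hust y).mul_left
  -- ∂_A is moved from the test function to the smooth kernel, rewritten through the factorization
  -- as a sum of ∂_I, and these are moved back onto the test function. The two integrations by parts
  -- give the sign (-1)^{α+k}.
  have key : ∀ y, ∫ z, invFourier m z * partialDeriv A u (y + z) =
      (-1) ^ (α + k) * ∑ I, ∫ z, invFourier (n I) z * partialDeriv I u (y + z) := by
    intro y
    simp only [← partialDeriv_translate]
    rw [integral_invFourier_mul_partialDeriv A (hut y) (hust y) hm]
    have e : (fun ξ => derivSymbol A ξ * m ξ) = fun ξ => ∑ I, derivSymbol I ξ * n I ξ := funext h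
    rw [e, invFourier_sum _ fun I _ => (hn I).continuous_mul (continuous_derivSymbol I)]
    simp only [integral_invFourier_mul_partialDeriv _ (hut y) (hust y) (hn _), Finset.sum_mul]
    rw [integral_finsetSum _ fun I _ => hprod _ (continuous_invFourier
      ((hn I).continuous_mul (continuous_derivSymbol I))) y, ← Finset.mul_sum, ← mul_assoc,
      pow_add, mul_assoc ((-1) ^ α), ← mul_pow]
    norm_num
  have hint : ∀ I, Integrable fun y => g y * ∫ z, invFourier (n I) z * partialDeriv I u (y + z) := by
    intro I
    have := (integrable_pairing hr hg (hpc I) (hps I) (continuous_invFourier (hn I))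
      (hni I)).integral_prod_left
    simpa only [integral_const_mul] using this
  rw [integral_conv_mul hr hg (hpc A) (hps A) (continuous_invFourier hm) hmi,
    ← integral_pairing_swap hr hg (hpc A) (hps A) (continuous_invFourier hm) hmi]
  simp only [key]
  have e2 : ∀ y, g y * ((-1) ^ (α + k) * ∑ I, ∫ z, invFourier (n I) z * partialDeriv I u (y + z)) =
      (-1) ^ (α + k) * ∑ I, g y * ∫ z, invFourier (n I) z * partialDeriv I u (y + z) := by
    intro y
    rw [← Finset.mul_sum]
    ring
  simp only [e2]
  rw [integral_const_mul, integral_finsetSum _ fun I _ => hint I, pow_add, mul_assoc]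
  congr 1
  rw [Finset.mul_sum]
  refine Finset.sum_congr rfl fun I _ => ?_
  rw [integral_pairing_swap hr hg (hpc I) (hps I) (continuous_invFourier (hn I)) (hni I),
    integral_conv_mul hq (hGI I) hu.continuous hus (continuous_invFourier (hn I)) (hni I),
    ← integral_const_mul]
  refine integral_congr_ae (Filter.Eventually.of_forall fun z => ?_)
  simp only
  have hz : ∀ y, u (y + z) = (fun x => u (z + x)) y := fun y => by simp only [add_comm]
  have hz' : ∀ y, partialDeriv I u (y + z) = partialDeriv I (fun x => u (z + x)) y := fun y => by
    rw [partialDeriv_translate, add_comm]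
  simp only [hz, hz']
  have hs : ((-1 : ℂ)) ^ k * (-1) ^ k = 1 := by rw [← mul_pow]; norm_num
  -- The definition of the weak gradient, applied to the translated test function; its sign (-1)^k
  -- cancels the one left over.
  rw [hgG.integral_eq I _ (hut z) (hust z)]
  linear_combination (invFourier (n I) z * ∫ x, G x I * u (z + x)) * hs

/-! ### From admissibility to the approximation bound -/

lemma convExists_of_holderConjugate {M f : R3 → ℂ} {s r : ℝ≥0∞} [s.HolderConjugate r]
    (hM : MemLp M s volume) (hf : MemLp f r volume) : ConvExists M f := by
  intro x
  have hqm : MeasurePreserving (fun t => x - t) (volume : Measure R3) volume :=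
    Measure.measurePreserving_sub_left volume x
  exact hM.integrable_mul (hf.comp_measurePreserving hqm)

lemma conv_sub_left {A B g : R3 → ℂ} (hA : ConvExists A g) (hB : ConvExists B g) :
    conv (A - B) g = conv A g - conv B g := by
  funext x
  have := integral_sub (hA x) (hB x)
  simp only [conv, convolution_def, Pi.sub_apply]
  rw [← this]
  simp

/-- With θ = 1/q - 1/p, Young's inequality takes the L¹ bound to the power 1 - θ and the sup bound
to the power θ, and γ(1 - θ) + (γ - 5/2)θ = γ - (5/2)θ. -/
lemma HasKernelBound.eLpNorm_conv_le {γ : ℝ} {M : ℝ → R3 → ℂ} (hM : HasKernelBound γ M)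
    (hc : ∀ t, 0 ≤ t → Continuous (M t)) {p q : ℝ≥0∞} (hq : 1 ≤ q) (hqp : q ≤ p) :
    ∃ C : ℝ, 0 < C ∧ ∀ t, 0 ≤ t → ∀ f : R3 → ℂ, AEStronglyMeasurable f volume →
      eLpNorm (conv (M t) f) p volume ≤
        ENNReal.ofReal (C * (1 + t) ^ (γ - 5 / 2 * ((q⁻¹).toReal - (p⁻¹).toReal))) *
          eLpNorm f q volume := by
  obtain ⟨C, hC, hb⟩ := hM
  refine ⟨C, hC, fun t ht f hf => ?_⟩
  have hT : 0 < 1 + t := by linarith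
  set θ := (q⁻¹).toReal - (p⁻¹).toReal
  have hθ0 : 0 ≤ θ := by
    refine sub_nonneg.2 (ENNReal.toReal_mono ?_ (ENNReal.inv_le_inv.2 hqp))
    exact (ENNReal.inv_le_one.2 hq).trans_lt ENNReal.one_lt_top |>.ne
  have hθ1 : 0 ≤ 1 - θ := by
    have h1 := toReal_inv_le_one hq
    have h2 : 0 ≤ (p⁻¹).toReal := ENNReal.toReal_nonneg
    simp only [θ]
    linarith
  have h1 : ∫⁻ x, ‖M t x‖ₑ ≤ ENNReal.ofReal (C * (1 + t) ^ γ) := by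
    rw [← ofReal_integral_norm_eq_lintegral_enorm (hb t ht).1]
    exact ENNReal.ofReal_le_ofReal (hb t ht).2.1
  have h2 : ∀ x, ‖M t x‖ₑ ≤ ENNReal.ofReal (C * (1 + t) ^ (γ - 5 / 2)) := fun x => by
    rw [← ofReal_norm]; exact ENNReal.ofReal_le_ofReal ((hb t ht).2.2 x)
  refine (_root_.eLpNorm_conv_le (hc t ht) hf h1 h2 hq hqp).trans_eq ?_
  congr 1
  rw [ENNReal.ofReal_rpow_of_nonneg (by positivity) hθ1,
    ENNReal.ofReal_rpow_of_nonneg (by positivity) hθ0, ← ENNReal.ofReal_mul (by positivity)]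
  congr 1
  rw [Real.mul_rpow hC.le (by positivity), Real.mul_rpow hC.le (by positivity),
    ← Real.rpow_mul hT.le, ← Real.rpow_mul hT.le]
  have e1 : C = C ^ (1 - θ) * C ^ θ := by
    rw [← Real.rpow_add hC]; simp
  have e2 : (1 + t) ^ (γ - 5 / 2 * θ) = (1 + t) ^ (γ * (1 - θ)) * (1 + t) ^ ((γ - 5 / 2) * θ) := by
    rw [← Real.rpow_add hT]; congr 1; ring
  rw [e2]
  nth_rewrite 3 [e1]
  ring

lemma norm_toLp_le_sum {ι : Type*} [Fintype ι] (v : ι → ℂ) :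
    ‖(WithLp.toLp 2 v : EuclideanSpace ℂ ι)‖ ≤ ∑ i, ‖v i‖ := by
  rw [EuclideanSpace.norm_eq]
  refine Real.sqrt_le_iff.2 ⟨Finset.sum_nonneg fun i _ => norm_nonneg _, ?_⟩
  exact Finset.sum_sq_le_sq_sum_of_nonneg fun i _ => norm_nonneg _

lemma eLpNorm_toLp_le {ι : Type*} [Fintype ι] {v : ι → R3 → ℂ} {p : ℝ≥0∞} (hp : 1 ≤ p)
    (hv : ∀ i, AEStronglyMeasurable (v i) volume) :
    eLpNorm (fun x => (WithLp.toLp 2 fun i => v i x : EuclideanSpace ℂ ι)) p volume ≤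
      ∑ i, eLpNorm (v i) p volume := by
  calc _ ≤ eLpNorm (∑ i, fun x => ‖v i x‖) p volume := by
        refine eLpNorm_mono_real fun x => ?_
        rw [Finset.sum_apply]
        exact norm_toLp_le_sum _
    _ ≤ ∑ i, eLpNorm (fun x => ‖v i x‖) p volume := eLpNorm_sum_le (fun i _ => (hv i).norm) hp
    _ = _ := by simp only [eLpNorm_norm]


/-- Admissible differences of kernels give the approximation bound. -/
lemma approxBound_of_isAdmissible {α k : ℕ} {γ : ℝ} {m : ℝ → R3 → ℂ} (hm : IsAdmissible α k γ m)
    {p q : ℝ≥0∞} (hq : 1 ≤ q) (hqp : q ≤ p) {A B : ℝ → R3 → ℂ}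
    (hAB : ∀ t, 0 ≤ t → A t - B t = invFourier (m t))
    (hB : ∀ t, 0 ≤ t → ∀ s : ℝ≥0∞, 1 < s → MemLp (B t) s volume) :
    ApproxBound α k p q (γ - 5 / 2 * ((q⁻¹).toReal - (p⁻¹).toReal)) A B := by
  obtain ⟨γ', C', hC', hK⟩ := hm.hasKernelBound
  choose n hn hn' using hm.factor
  have hcont : ∀ J I t, 0 ≤ t → Continuous (invFourier (n J I t)) := fun J I t ht =>
    continuous_invFourier ((hn J I).1 t ht)
  choose C hC hbound using fun J I => (hn J I).2.eLpNorm_conv_le (hcont J I) hq hqp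
  set γ₀ := γ - 5 / 2 * ((q⁻¹).toReal - (p⁻¹).toReal)
  have hp : 1 ≤ p := hq.trans hqp
  refine ⟨1 + ∑ J, ∑ I, C J I, ?_, fun t ht r hr g G hg hgG hG => ?_⟩
  · have : 0 ≤ ∑ J, ∑ I, C J I :=
      Finset.sum_nonneg fun J _ => Finset.sum_nonneg fun I _ => (hC J I).le
    linarith
  have hT : 0 < 1 + t := by linarith
  have hmt := hm.isBddSymbol t ht
  have hmc := continuous_invFourier hmt
  obtain ⟨hKi, -, hKb⟩ := hK t ht
  have hGI : ∀ I, MemLp (fun y => G y I) q volume := fun I =>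
    (EuclideanSpace.proj (𝕜 := ℂ) I).comp_memLp' hG
  have hGle : ∀ I, eLpNorm (fun y => G y I) q volume ≤ eLpNorm G q volume := fun I =>
    eLpNorm_mono fun y => PiLp.norm_apply_le (G y) I
  have hni : ∀ J I, Integrable (invFourier (n J I t)) := fun J I => by
    obtain ⟨_, _, hb⟩ := (hn J I).2
    exact (hb t ht).1
  have hD : ConvExists (A t - B t) g := by
    rw [hAB t ht]
    exact convExists_of_memLp hmc hKi hKb hr hg
  refine ⟨hD, fun hrt => ?_, ?_⟩
  · have hrs := ENNReal.HolderConjugate.conjExponent hr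
    have hsr : r.conjExponent.HolderConjugate r := hrs.symm
    -- This is where r < ∞ is used: B(t) is only known to lie in L^s for s > 1, so the exponent dual
    -- to r must exceed one.
    have hs : 1 < r.conjExponent := by
      rw [ENNReal.conjExponent]
      refine ENNReal.lt_add_right ENNReal.one_ne_top (ENNReal.inv_ne_zero.2 ?_)
      exact (tsub_le_self.trans_lt (lt_top_iff_ne_top.2 hrt)).ne
    have hBe : ConvExists (B t) g := convExists_of_holderConjugate (hB t ht _ hs) hg
    -- No decay of A(t) itself is needed: A = (A - B) + B, and both convolutions converge.
    have hAe : ConvExists (A t) g := by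
      intro x
      have h := (hD x).add (hBe x)
      refine h.congr (Filter.Eventually.of_forall fun y => ?_)
      simp
    exact ⟨hAe, hBe, conv_sub_left hAe hBe⟩
  have hHm : ∀ J I, AEStronglyMeasurable (conv (invFourier (n J I t)) fun y => G y I) volume :=
    fun J I => aestronglyMeasurable_conv (hcont J I t ht) (hGI I).1
  have hle : ∀ J, eLpNorm (∑ I, conv (invFourier (n J I t)) fun y => G y I) p volume ≤
      ENNReal.ofReal ((∑ I, C J I) * (1 + t) ^ γ₀) * eLpNorm G q volume := by
    intro J
    refine (eLpNorm_sum_le (fun I _ => hHm J I) hp).trans ?_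
    rw [Finset.sum_mul, ENNReal.ofReal_sum_of_nonneg fun I _ => mul_nonneg (hC J I).le
      (by positivity), Finset.sum_mul]
    refine Finset.sum_le_sum fun I _ => (hbound J I t ht _ (hGI I).1).trans ?_
    gcongr
    exact hGle I
  have hHm' : ∀ J, AEStronglyMeasurable (∑ I, conv (invFourier (n J I t)) fun y => G y I) volume :=
    fun J => Finset.aestronglyMeasurable_sum _ fun I _ => hHm J I
  have hHle : eLpNorm (fun x => (WithLp.toLp 2 fun J =>
      (∑ I, conv (invFourier (n J I t)) fun y => G y I) x : EuclideanSpace ℂ (Fin α → Fin 3))) p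
      volume ≤ ENNReal.ofReal ((1 + ∑ J, ∑ I, C J I) * (1 + t) ^ γ₀) * eLpNorm G q volume := by
    calc _ ≤ ∑ J, ENNReal.ofReal ((∑ I, C J I) * (1 + t) ^ γ₀) * eLpNorm G q volume :=
          (eLpNorm_toLp_le hp hHm').trans (Finset.sum_le_sum fun J _ => hle J)
      _ = ENNReal.ofReal ((∑ J, ∑ I, C J I) * (1 + t) ^ γ₀) * eLpNorm G q volume := by
          rw [Finset.sum_mul, ENNReal.ofReal_sum_of_nonneg fun J _ => mul_nonneg
            (Finset.sum_nonneg fun I _ => (hC J I).le) (by positivity), Finset.sum_mul]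
      _ ≤ _ := by
          gcongr
          linarith
  have hHmem : MemLp (fun x => (WithLp.toLp 2 fun J =>
      (∑ I, conv (invFourier (n J I t)) fun y => G y I) x : EuclideanSpace ℂ (Fin α → Fin 3))) p
      volume := by
    refine ⟨?_, hHle.trans_lt (ENNReal.mul_lt_top ENNReal.ofReal_lt_top hG.2)⟩
    have h1 : AEMeasurable (fun x J => (∑ I, conv (invFourier (n J I t)) fun y => G y I) x)
        volume := aemeasurable_pi_lambda _ fun J => (hHm' J).aemeasurable
    exact ((PiLp.continuous_toLp 2 _).measurable.comp_aemeasurable h1).aestronglyMeasurable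
  have hKg : MemLp (conv (invFourier (m t)) g) r volume := by
    refine ⟨aestronglyMeasurable_conv hmc hg.1, (_root_.eLpNorm_conv_le hmc hg.1
      (κ := ENNReal.ofReal (C' * (1 + t) ^ (γ' - 5 / 2))) le_rfl (fun x => ?_) hr le_rfl).trans_lt ?_⟩
    · rw [← ofReal_norm]
      exact ENNReal.ofReal_le_ofReal (hKb x)
    · simp only [sub_self, sub_zero, ENNReal.rpow_one, ENNReal.rpow_zero, mul_one]
      exact ENNReal.mul_lt_top hKi.2 hg.2
  refine ⟨_, ⟨?_, hHmem.locallyIntegrable hp, fun J u hu hus => ?_⟩, hHmem, hHle⟩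
  · rw [hAB t ht]
    exact hKg.locallyIntegrable hr
  rw [hAB t ht, integral_conv_mul_partialDeriv hr hq hg hgG hG hmt hKi J (fun I => (hn J I).1 t ht)
    (hni J) (hn' J t ht) hu hus]
  congr 1
  simp only [Finset.sum_apply, Finset.sum_mul]
  rw [integral_finsetSum]
  intro I _
  have hmem : MemLp (conv (invFourier (n J I t)) fun y => G y I) p volume :=
    ⟨hHm J I, (hbound J I t ht _ (hGI I).1).trans_lt
      (ENNReal.mul_lt_top ENNReal.ofReal_lt_top (hGI I).2)⟩
  simpa only [smul_eq_mul, mul_comm] using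
    (hmem.locallyIntegrable hp).integrable_smul_left_of_hasCompactSupport hu.continuous hus

/-! ### Integrability of the diffusion wave kernels -/

lemma integral_heat_weight {x : ℝ} (hx : 0 ≤ x) :
    IntegrableOn (fun τ => (√(1 + τ))⁻¹ * ((√(1 + τ) + x) ^ 4)⁻¹) (Ioi 0) ∧
    ∫ τ in Ioi (0 : ℝ), (√(1 + τ))⁻¹ * ((√(1 + τ) + x) ^ 4)⁻¹ = 2 / 3 * ((1 + x) ^ 3)⁻¹ := by
  have hd : ∀ τ ∈ Ioi (0 : ℝ), HasDerivAt (fun τ => -(2 / 3) * ((√(1 + τ) + x) ^ 3)⁻¹)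
      ((√(1 + τ))⁻¹ * ((√(1 + τ) + x) ^ 4)⁻¹) τ := by
    intro τ hτ
    have hT : 0 < 1 + τ := by have := mem_Ioi.1 hτ; linarith
    have hs : 0 < √(1 + τ) := Real.sqrt_pos.2 hT
    have h1 : HasDerivAt (fun τ : ℝ => 1 + τ) 1 τ := (hasDerivAt_id' τ).const_add 1
    have h2 : HasDerivAt (fun τ : ℝ => (√(1 + τ) + x) ^ 3) _ τ :=
      ((h1.sqrt hT.ne').add_const x).pow 3
    refine ((h2.inv (by positivity)).const_mul (-(2 / 3))).congr_deriv ?_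
    push_cast
    field_simp
  have hc : ContinuousWithinAt (fun τ => -(2 / 3) * ((√(1 + τ) + x) ^ 3)⁻¹) (Ici 0) 0 := by
    refine ContinuousAt.continuousWithinAt ?_
    refine ContinuousAt.mul continuousAt_const (ContinuousAt.inv₀ (by fun_prop) ?_)
    simp only [add_zero, Real.sqrt_one]
    positivity
  have hp : ∀ τ ∈ Ioi (0 : ℝ), 0 ≤ (√(1 + τ))⁻¹ * ((√(1 + τ) + x) ^ 4)⁻¹ := fun τ _ => by
    positivity
  have hl : Filter.Tendsto (fun τ => -(2 / 3) * ((√(1 + τ) + x) ^ 3)⁻¹) Filter.atTop (nhds 0) := by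
    rw [show (0 : ℝ) = -(2 / 3) * 0 by ring]
    refine Filter.Tendsto.const_mul _ (Filter.Tendsto.inv_tendsto_atTop ?_)
    refine (Filter.tendsto_pow_atTop (n := 3) (by norm_num)).comp
      (Filter.tendsto_atTop_add_const_right _ _ ?_)
    exact Real.tendsto_sqrt_atTop.comp (Filter.tendsto_atTop_add_const_left _ _ Filter.tendsto_id)
  refine ⟨integrableOn_Ioi_deriv_of_nonneg hc hd hp hl, ?_⟩
  rw [integral_Ioi_of_hasDerivAt_of_nonneg hc hd hp hl]
  simp

/-- Riesz symbols are superpositions of Gaussians. -/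
lemma rieszSymbol_mul_eq_integral (a b : Fin 3) (ξ : R3) : rieszSymbol a ξ * rieszSymbol b ξ =
    ∫ τ in Ioi (0 : ℝ), (ξ a : ℂ) * (ξ b : ℂ) * (Real.exp (-‖ξ‖ ^ 2 * τ) : ℂ) := by
  by_cases h0 : ξ = 0
  · simp [h0, rieszSymbol]
  have hs : 0 < ‖ξ‖ ^ 2 := by have := norm_pos_iff.2 h0; positivity
  rw [integral_const_mul, integral_complex_ofReal, integral_exp_mul_Ioi (by linarith)]
  rw [rieszSymbol_mul]
  simp [div_eq_mul_inv]

/-- The τ-integral of the Gaussian is |ξ|^{-2}, which the two coordinates compensate. The bound does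
not degenerate as ξ → 0, which is what Fubini needs. -/
lemma integral_norm_riesz_gaussian_le (a b : Fin 3) {ξ : R3} (h0 : ξ ≠ 0) :
    IntegrableOn (fun τ : ℝ => (ξ a : ℂ) * (ξ b : ℂ) * (Real.exp (-‖ξ‖ ^ 2 * τ) : ℂ)) (Ioi 0) ∧
    ∫ τ in Ioi (0 : ℝ), ‖(ξ a : ℂ) * (ξ b : ℂ) * (Real.exp (-‖ξ‖ ^ 2 * τ) : ℂ)‖ ≤ 1 := by
  have hs : 0 < ‖ξ‖ ^ 2 := by have := norm_pos_iff.2 h0; positivity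
  refine ⟨((integrableOn_exp_mul_Ioi (by linarith : -‖ξ‖ ^ 2 < 0) 0).ofReal).const_mul _, ?_⟩
  simp only [norm_mul ((ξ a : ℂ) * (ξ b : ℂ)), Complex.norm_real, Real.norm_of_nonneg (Real.exp_pos _).le]
  rw [integral_const_mul, integral_exp_mul_Ioi (by linarith)]
  have h1 := norm_rieszSymbol_le_one a ξ
  have h2 := norm_rieszSymbol_le_one b ξ
  have h3 : ‖rieszSymbol a ξ * rieszSymbol b ξ‖ ≤ 1 := by
    rw [norm_mul]; exact mul_le_one₀ h1 (norm_nonneg _) h2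
  rw [rieszSymbol_mul, norm_div, Complex.norm_real, Real.norm_of_nonneg hs.le] at h3
  simpa [div_eq_mul_inv] using h3

lemma invFourier_riesz_eq_integral {c₀ : ℝ} {η : R3 → ℂ} (hη : IsCutSymbol c₀ η) (a b : Fin 3)
    (x : R3) : invFourier (fun ξ => rieszSymbol a ξ * rieszSymbol b ξ * η ξ) x =
      ∫ τ in Ioi (0 : ℝ), invFourier (fun ξ => (ξ a : ℂ) * (ξ b : ℂ) *
        (Real.exp (-‖ξ‖ ^ 2 * τ) : ℂ) * η ξ) x := by
  have hηc := hη.smooth.continuous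
  have hηi : Integrable η := hηc.integrable_of_hasCompactSupport hη.hasCompactSupport
  have hne : ∀ᵐ ξ : R3, ξ ≠ 0 := by
    simpa using measure_eq_zero_iff_ae_notMem.1 (measure_singleton (0 : R3))
  have hcont : Continuous fun y : R3 × ℝ =>
      Complex.exp (Complex.I * ((inner ℝ x y.1 : ℝ) : ℂ)) *
      ((y.1 a : ℂ) * (y.1 b : ℂ) * (Real.exp (-‖y.1‖ ^ 2 * y.2) : ℂ) * η y.1) := by fun_prop
  have hint : Integrable (fun y : R3 × ℝ => Complex.exp (Complex.I * ((inner ℝ x y.1 : ℝ) : ℂ)) *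
      ((y.1 a : ℂ) * (y.1 b : ℂ) * (Real.exp (-‖y.1‖ ^ 2 * y.2) : ℂ) * η y.1))
      ((volume : Measure R3).prod (volume.restrict (Ioi (0 : ℝ)))) := by
    rw [integrable_prod_iff hcont.aestronglyMeasurable]
    constructor
    · filter_upwards [hne] with ξ hξ
      exact ((integral_norm_riesz_gaussian_le a b hξ).1.mul_const (η ξ)).const_mul _
    · refine hηi.norm.mono' ?_ ?_
      · exact hcont.aestronglyMeasurable.norm.integral_prod_right'
      · filter_upwards [hne] with ξ hξ
        rw [Real.norm_of_nonneg (integral_nonneg fun _ => norm_nonneg _)]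
        simp only [norm_mul _ (η ξ), norm_mul (Complex.exp (Complex.I * ((inner ℝ x ξ : ℝ) : ℂ))),
          norm_exp_I_mul_ofReal_eq_one, one_mul]
        rw [integral_mul_const]
        exact mul_le_of_le_one_left (norm_nonneg _) (integral_norm_riesz_gaussian_le a b hξ).2
  simp only [invFourier_apply]
  rw [integral_const_mul, ← integral_integral_swap hint]
  congr 1
  refine integral_congr_ae (Filter.Eventually.of_forall fun ξ => ?_)
  simp only
  rw [integral_const_mul, integral_mul_const, ← rieszSymbol_mul_eq_integral]

/-- Kernels of localized second order Riesz transforms decay like `|x|^{-3}`. -/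
lemma exists_norm_invFourier_riesz_le {c₀ : ℝ} {η : R3 → ℂ} (hη : IsCutSymbol c₀ η)
    (a b : Fin 3) : ∃ C : ℝ, 0 < C ∧ ∀ x,
      ‖invFourier (fun ξ => rieszSymbol a ξ * rieszSymbol b ξ * η ξ) x‖ ≤
        C * ((1 + ‖x‖) ^ 3)⁻¹ := by
  -- The packet estimate is reused with τ as time: ν = 2 gives e^{-|ξ|²τ}, the amplitude is 1, and
  -- the wave parameter is a dummy. Degree 2 yields the factor (1+τ)^{-5/2}.
  obtain ⟨C, hC, h⟩ := exists_norm_invFourier_wavePacket_le (ν := 2) (e := 0) two_pos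
    (Function.HasTemperateGrowth.const (E := WaveParam × R3) (1 : ℂ)) hη
    ((IsHomPoly.coord b).mul (IsHomPoly.coord a))
  refine ⟨C * (2 / 3), by positivity, fun x => ?_⟩
  have hq : ‖((EuclideanSpace.single (0 : Fin 3) (1 : ℝ), (0 : ℝ)) : R3 × ℝ).1‖ = 1 := by simp
  have hw := integral_heat_weight (norm_nonneg x)
  rw [invFourier_riesz_eq_integral hη, mul_assoc, ← hw.2, ← integral_const_mul]
  refine norm_integral_le_of_norm_le (hw.1.const_mul C) ?_
  filter_upwards [ae_restrict_mem measurableSet_Ioi] with τ hτ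
  have hτ0 : 0 ≤ τ := (mem_Ioi.1 hτ).le
  have hT : 0 < 1 + τ := by linarith
  have hs : 0 < √(1 + τ) := Real.sqrt_pos.2 hT
  have hb := h τ hτ0 (EuclideanSpace.single (0 : Fin 3) (1 : ℝ), (0 : ℝ)) hq
    (by simp) x
  have e1 : wavePacket 2 0 (fun ξ => (ξ a : ℂ) * (ξ b : ℂ)) η (fun _ => (1 : ℂ)) τ
      (EuclideanSpace.single (0 : Fin 3) (1 : ℝ), (0 : ℝ)) = fun ξ => (ξ a : ℂ) * (ξ b : ℂ) *
        (Real.exp (-‖ξ‖ ^ 2 * τ) : ℂ) * η ξ := by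
    funext ξ
    simp only [wavePacket, Real.rpow_zero]
    rw [show -(2 * ‖ξ‖ ^ 2 / 2) * τ = -‖ξ‖ ^ 2 * τ by ring]
    push_cast
    ring
  rw [e1] at hb
  refine hb.trans_eq ?_
  -- Four of the five roots clear the denominator in (1+|x|/√(1+τ))^{-4}, leaving the integrand of
  -- `integral_heat_weight`.
  have e2 : (1 + τ) ^ ((0 : ℝ) - ((1 + 1 : ℕ) : ℝ) / 2 - 3 / 2) = (√(1 + τ) ^ 5)⁻¹ := by
    rw [Real.sqrt_eq_rpow, ← Real.rpow_natCast, ← Real.rpow_mul hT.le, ← Real.rpow_neg hT.le]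
    norm_num
  rw [e2]
  field_simp

/-- Integrability of (1+|x|)^{-3s} in dimension three requires 3s > 3, hence the strict inequality
on s. -/
lemma memLp_of_decay {K : R3 → ℂ} (hK : Continuous K) {C : ℝ}
    (h : ∀ x, ‖K x‖ ≤ C * ((1 + ‖x‖) ^ 3)⁻¹) {s : ℝ≥0∞} (hs : 1 < s) : MemLp K s volume := by
  have hc : Continuous fun x : R3 => ((1 + ‖x‖) ^ 3)⁻¹ :=
    Continuous.inv₀ (by fun_prop) fun x => by positivity
  have hw : MemLp (fun x : R3 => ((1 + ‖x‖) ^ 3)⁻¹) s volume := by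
    by_cases hst : s = ∞
    · subst hst
      refine memLp_top_of_bound hc.aestronglyMeasurable 1 (Filter.Eventually.of_forall fun x => ?_)
      rw [Real.norm_of_nonneg (by positivity)]
      exact inv_le_one_of_one_le₀ (one_le_pow₀ (by linarith [norm_nonneg x]))
    · rw [← integrable_norm_rpow_iff hc.aestronglyMeasurable (zero_lt_one.trans hs).ne' hst]
      have hs1 : 1 < s.toReal := by
        rw [← ENNReal.toReal_one]
        exact (ENNReal.toReal_lt_toReal ENNReal.one_ne_top hst).2 hs
      have := integrable_one_add_norm (E := R3) (μ := volume) (r := 3 * s.toReal)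
        (by rw [finrank_euclideanSpace_fin]; push_cast; linarith)
      refine this.congr (Filter.Eventually.of_forall fun x => ?_)
      have hx : 0 < 1 + ‖x‖ := by positivity
      simp only
      rw [Real.norm_of_nonneg (by positivity), Real.inv_rpow (by positivity), ← Real.rpow_natCast,
        ← Real.rpow_mul hx.le, Real.rpow_neg hx.le]
      norm_num
  refine (hw.const_mul C).mono hK.aestronglyMeasurable (Filter.Eventually.of_forall fun x => ?_)
  exact (h x).trans (le_abs_self _)

/-- Plane waves averaged over the sphere depend smoothly on the frequency. -/
lemma contDiff_integral_sphereMeasure {f : R3 → ℂ} (hf : Continuous f) :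
    ContDiff ℝ (⊤ : ℕ∞) fun v : R3 =>
      ∫ ω, Complex.exp (Complex.I * ((inner ℝ ω v : ℝ) : ℂ)) * f ω ∂sphereMeasure := by
  have h : (fun v : R3 =>
      ∫ ω, Complex.exp (Complex.I * ((inner ℝ ω v : ℝ) : ℂ)) * f ω ∂sphereMeasure) =
      VectorFourier.fourierIntegral Real.fourierChar sphereMeasure
        invFourierPairing.toLinearMap₁₂ f := by
    funext v
    rw [VectorFourier.fourierIntegral]
    refine integral_congr_ae (Filter.Eventually.of_forall fun ξ => ?_)
    simp only [Circle.smul_def, smul_eq_mul, Real.fourierChar_apply]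
    congr 2
    rw [show (invFourierPairing.toLinearMap₁₂ ξ) v = invFourierPairing ξ v from rfl,
      invFourierPairing_apply]
    push_cast
    have : (Real.pi : ℂ) ≠ 0 := by exact_mod_cast Real.pi_ne_zero
    field_simp
  rw [h]
  refine VectorFourier.contDiff_fourierIntegral _ fun n _ => ?_
  -- All weights |ω|^n equal one on the sphere, so every moment is the integral of |f|.
  refine ((integrable_sphereMeasure_of_continuous hf).norm.congr ?_)
  filter_upwards [ae_norm_eq_one_sphereMeasure] with ω hω
  simp [hω]

lemma contDiff_sinc_norm : ContDiff ℝ (⊤ : ℕ∞) fun v : R3 => (Real.sinc ‖v‖ : ℂ) := by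
  simp only [← integral_sphereMeasure_exp]
  simpa using contDiff_integral_sphereMeasure (f := fun _ => (1 : ℂ)) continuous_const

/-- Smoothness at the origin, where |v| is not differentiable, is read off from the spherical mean.
The amplitude iω·v is expanded in coordinates so that each v_j leaves the integral. -/
lemma contDiff_cos_norm : ContDiff ℝ (⊤ : ℕ∞) fun v : R3 => (Real.cos ‖v‖ : ℂ) := by
  have e : (fun v : R3 => (Real.cos ‖v‖ : ℂ)) = fun v => (Real.sinc ‖v‖ : ℂ) +
      ∑ j, (v j : ℂ) * ∫ ω, Complex.exp (Complex.I * ((inner ℝ ω v : ℝ) : ℂ)) *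
        (Complex.I * (ω j : ℂ)) ∂sphereMeasure := by
    funext v
    rw [← integral_sphereMeasure_exp, ← integral_sphereMeasure_one_add_mul_exp]
    simp only [← integral_const_mul]
    rw [← integral_finsetSum _ fun j _ => integrable_sphereMeasure_of_continuous (by fun_prop),
      ← integral_add (integrable_sphereMeasure_of_continuous (by fun_prop))
        (integrable_sphereMeasure_of_continuous (by fun_prop))]
    refine integral_congr_ae (Filter.Eventually.of_forall fun ω => ?_)
    simp only [PiLp.inner_apply, Fin.sum_univ_three, RCLike.inner_apply, conj_trivial]
    push_cast
    ring
  rw [e]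
  refine contDiff_sinc_norm.add (ContDiff.sum fun j _ => ContDiff.mul ?_
    (contDiff_integral_sphereMeasure (by fun_prop)))
  exact Complex.ofRealCLM.contDiff.comp (EuclideanSpace.proj (𝕜 := ℝ) j).contDiff

lemma contDiff_exp_neg_norm_sq (ν t : ℝ) :
    ContDiff ℝ (⊤ : ℕ∞) fun ξ : R3 => (Real.exp (-(ν * ‖ξ‖ ^ 2 / 2) * t) : ℂ) := by
  have h : ContDiff ℝ (⊤ : ℕ∞) fun ξ : R3 => ‖ξ‖ ^ 2 := contDiff_norm_sq ℝ
  exact Complex.ofRealCLM.contDiff.comp (Real.contDiff_exp.comp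
    ((((contDiff_const.mul h).div_const _).neg).mul contDiff_const))

lemma contDiff_symbolG0 (ν : ℝ) {β t : ℝ} (hβ : 0 < β) (ht : 0 ≤ t) :
    ContDiff ℝ (⊤ : ℕ∞) (symbolG0 ν β t) := by
  have e : symbolG0 ν β t = fun ξ => (Real.exp (-(ν * ‖ξ‖ ^ 2 / 2) * t) : ℂ) *
      (Real.cos ‖(β * t) • ξ‖ : ℂ) := by
    funext ξ
    rw [symbolG0, norm_smul, Real.norm_of_nonneg (by positivity), mul_right_comm β t]
    push_cast
    rfl
  rw [e]
  exact (contDiff_exp_neg_norm_sq ν t).mul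
    (contDiff_cos_norm.comp (contDiff_const_smul (β * t)))

lemma contDiff_freeWaveSin (ν : ℝ) {β t : ℝ} (hβ : 0 < β) (ht : 0 ≤ t) :
    ContDiff ℝ (⊤ : ℕ∞) (freeWaveSin ν β t) := by
  have e : freeWaveSin ν β t = fun ξ => (Real.exp (-(ν * ‖ξ‖ ^ 2 / 2) * t) : ℂ) *
      ((t : ℂ) * (Real.sinc ‖(β * t) • ξ‖ : ℂ)) := by
    funext ξ
    rw [freeWaveSin, norm_smul, Real.norm_of_nonneg (by positivity), mul_comm β t, mul_assoc t]
    push_cast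
    rfl
  rw [e]
  exact (contDiff_exp_neg_norm_sq ν t).mul
    (contDiff_const.mul (contDiff_sinc_norm.comp (contDiff_const_smul (β * t))))

/-- The powers of |ξ|² and the smooth f are absorbed into the cut-off, so that a localized Riesz
kernel with |x|^{-3} decay remains. -/
lemma memLp_spaceDeriv_lowKernel {β c₀ : ℝ} {χ : R3 → ℝ} (hχ : IsLowCutoff c₀ χ) (a b : Fin 3)
    (n : ℕ) {f : ℝ → R3 → ℂ} {t : ℝ} (hf : ContDiff ℝ (⊤ : ℕ∞) (f t)) {s : ℝ≥0∞} (hs : 1 < s) :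
    MemLp (spaceDeriv β n (lowKernel f χ a b) t) s volume := by
  have hb := isBddSymbol_lowSymbol hχ a b hf.continuous
  have h1 : ContDiff ℝ (⊤ : ℕ∞) fun ξ : R3 => ((‖ξ‖ ^ (2 * n) : ℝ) : ℂ) := by
    simp only [pow_mul]
    exact Complex.ofRealCLM.contDiff.comp ((contDiff_norm_sq ℝ).pow n)
  have hη : IsCutSymbol c₀ fun ξ => (-1) ^ n * (β : ℂ) ^ (2 * n) *
      (((‖ξ‖ ^ (2 * n) : ℝ) : ℂ) * f t ξ) * (χ ξ : ℂ) :=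
    hχ.isCutSymbol.smooth_mul (contDiff_const.mul (h1.mul hf))
  obtain ⟨C, -, hC⟩ := exists_norm_invFourier_riesz_le hη a b
  have e : (fun ξ => rieszSymbol a ξ * rieszSymbol b ξ * ((-1) ^ n * (β : ℂ) ^ (2 * n) *
      (((‖ξ‖ ^ (2 * n) : ℝ) : ℂ) * f t ξ) * (χ ξ : ℂ))) = fun ξ =>
      (-1) ^ n * (β : ℂ) ^ (2 * n) * (((‖ξ‖ ^ (2 * n) : ℝ) : ℂ) * lowSymbol (f t) χ a b ξ) := by
    funext ξ
    rw [lowSymbol]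
    ring
  rw [spaceDeriv_lowKernel a b n hb]
  rw [e] at hC
  have hc : Continuous fun ξ : R3 => ((‖ξ‖ ^ (2 * n) : ℝ) : ℂ) := by fun_prop
  exact memLp_of_decay (continuous_invFourier ((hb.continuous_mul hc).const_mul _)) hC hs

lemma approxBound_lowKernel {ν β c₀ : ℝ} {χ : R3 → ℝ} (hχ : IsLowCutoff c₀ χ) (a b : Fin 3)
    {α k n : ℕ} {γ : ℝ} {w : Polynomial ℝ × Polynomial ℝ} {f : ℝ → R3 → ℂ}
    (hf : ∀ t, 0 ≤ t → ContDiff ℝ (⊤ : ℕ∞) (f t))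
    (h : IsAdmissible α k γ fun t ξ => lowSymbol (waveComb ν β w t) χ a b ξ -
      (-1) ^ n * (β : ℂ) ^ (2 * n) * (((‖ξ‖ ^ (2 * n) : ℝ) : ℂ) * lowSymbol (f t) χ a b ξ))
    {p q : ℝ≥0∞} (hq : 1 ≤ q) (hqp : q ≤ p) {δ : ℝ}
    (hδ : δ = γ - 5 / 2 * ((q⁻¹).toReal - (p⁻¹).toReal)) :
    ApproxBound α k p q δ (lowKernel (waveComb ν β w) χ a b)
      (spaceDeriv β n (lowKernel f χ a b)) := by
  rw [hδ]
  refine approxBound_of_isAdmissible h hq hqp (fun t ht => ?_) fun t ht s hs =>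
    memLp_spaceDeriv_lowKernel hχ a b n (hf t ht) hs
  have hb := isBddSymbol_lowSymbol hχ a b (hf t ht).continuous
  have hw : Continuous (waveComb ν β w t) := (continuous_waveComb ν β w).uncurry_left t
  have hc : Continuous fun ξ : R3 => ((‖ξ‖ ^ (2 * n) : ℝ) : ℂ) := by fun_prop
  have h2 := (hb.continuous_mul hc).const_mul ((-1) ^ n * (β : ℂ) ^ (2 * n))
  have h3 := invFourier_sub (isBddSymbol_lowSymbol hχ a b hw) h2
  rw [spaceDeriv_lowKernel a b n hb, lowKernel_eq, h3]
  rfl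

/-! ### The four estimates -/

lemma kernelG1_eq {ν β : ℝ} (hβ : 0 < β) (χ : R3 → ℝ) (a b : Fin 3) :
    kernelG1 ν β χ a b = lowKernel (freeWaveSin ν β) χ a b := by
  funext t
  rw [kernelG1, lowKernel_eq, lowKernel_eq, lowSymbol_symbolG1 hβ]

theorem proposition3p1 (ν β c₀ : ℝ) (hν : 0 < ν) (hβ : 0 < β) (hc₀ : 0 < c₀)
    (hc₀' : c₀ < 2 * β / ν) (χ : R3 → ℝ) (hχ : IsLowCutoff c₀ χ) (a b : Fin 3)
    (α α' l l' m : ℕ) (hα : α' ≤ α) (hl : l' ≤ l)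
    (p q : ℝ≥0∞) (hq : 1 ≤ q) (hqp : q ≤ p) :
    (l = 2 * m →
      ApproxBound α (α' + l') p q (decayExponent α α' l l' p q)
        (timeDeriv l (kernelK00 ν β χ a b)) (spaceDeriv β m (kernelG0 ν β χ a b))) ∧
    (l = 2 * m + 1 →
      ApproxBound α (α' + l') p q (decayExponent α α' l l' p q)
        (timeDeriv l (kernelK00 ν β χ a b)) (spaceDeriv β (m + 1) (kernelG1 ν β χ a b))) ∧
    (l = 2 * m →
      ApproxBound α (α' + l') p q (decayExponent α α' l l' p q + 1 / 2)
        (timeDeriv l (kernelK1 ν β χ a b)) (spaceDeriv β m (kernelG1 ν β χ a b))) ∧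
    (l = 2 * m + 1 →
      ApproxBound α (α' + l') p q (decayExponent α α' l l' p q + 1 / 2)
        (timeDeriv l (kernelK1 ν β χ a b)) (spaceDeriv β m (kernelG0 ν β χ a b))) := by
  have hG0 := fun t ht => contDiff_symbolG0 ν hβ (t := t) ht
  have hG1 := fun t ht => contDiff_freeWaveSin ν hβ (t := t) ht
  -- The heat loss 3/2 and the dispersive loss 1 combine to the 5/2 of the kernel bounds.
  have hd : decayExponent α α' l l' p q = -((l : ℝ) - l' + α - α') / 2 -
      5 / 2 * ((q⁻¹).toReal - (p⁻¹).toReal) := by rw [decayExponent]; ring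
  have hd' : decayExponent α α' l l' p q + 1 / 2 = (-((l : ℝ) - l' + α - α') / 2 + 1 / 2) -
      5 / 2 * ((q⁻¹).toReal - (p⁻¹).toReal) := by rw [decayExponent]; ring
  rw [kernelK00_eq, kernelK1_eq hν hβ hc₀' hχ, timeDeriv_lowKernel_waveComb hν hβ hc₀' hχ,
    timeDeriv_lowKernel_waveComb hν hβ hc₀' hχ, kernelG1_eq hβ, kernelG0]
  refine ⟨fun h => ?_, fun h => ?_, fun h => ?_, fun h => ?_⟩
  · refine approxBound_lowKernel hχ a b hG0 ?_ hq hqp hd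
    rw [h]
    exact isAdmissible_cos_even hν hβ hc₀ hc₀' hχ a b (by omega) (by push_cast; linarith)
  · refine approxBound_lowKernel hχ a b hG1 ?_ hq hqp hd
    rw [h]
    simp only [← lowSymbol_symbolG1 hβ]
    exact isAdmissible_cos_odd hν hβ hc₀ hc₀' hχ a b (by omega) (by push_cast; linarith)
  · refine approxBound_lowKernel hχ a b hG1 ?_ hq hqp hd'
    rw [h]
    simp only [← lowSymbol_symbolG1 hβ]
    exact isAdmissible_sin_even hν hβ hc₀ hc₀' hχ a b (by omega) (by push_cast; linarith)
  · refine approxBound_lowKernel hχ a b hG0 ?_ hq hqp hd'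
    rw [h]
    exact isAdmissible_sin_odd hν hβ hc₀ hc₀' hχ a b (by omega) (by push_cast; linarith)

end
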